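/- **Theorem (ten-moment complexity).** Let $F(n)$ be the number of rectangles (of any orientation, non-degenerate) whose vertices are integer points of $[0,n)\times[0,n)$. Put $\operatorname{mult}(x,y)=2$ if $x=y$ and $4$ otherwise, and for integers $n\ge 0$ and $u,y,d\ge 1$ let $$R_{u,y,d}=\sum_{1\le t<u/d}\ \sum_{x\ge y,\ xu+ydt\le n}\operatorname{mult}(x,y)\,(n-xu-ydt)(n-xdt-yu).$$ An *outer triple* for $n$ is a triple $(u,y,d)$ of integers with $1\le u\le n$, $1\le y\le\lfloor n/u\rfloor$ and $d\ge 1$ a squarefree divisor of $u$. For integers $N,a,b\ge0$, $m\ge1$ let $$\mathcal H_{p,q}(N;m,a,b)=\sum_{x=0}^{N-1}x^p\Big\lfloor\frac{ax+b}{m}\Big\rfloor^q,\qquad P_r(N)=\sum_{x=0}^{N-1}x^r,$$ where $(p,q)$ runs over the ten pairs with $p\ge0$, $q\ge1$, $p+q\le4$. Time is the number of operations of a random access machine with unit-cost integer addition, subtraction, multiplication, floor division, comparison and indirectly addressed memory access; space is the number of memory cells. In items 6–8 each algorithm is one fixed program whose integers all have absolute value bounded by a fixed power of $s+2$, where $s$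 is the sum of the inputs in item 6 and $s=n$ in items 7 and 8. Then: 1. The number of outer triples for $n$ is $O(n\log^2 n)$, and the squarefree divisor lists $D(u)=\{(d,\mu(d)): d\mid u,\ d\text{ squarefree}\}$, $1\le u\le n$, have total size $O(n\log n)$. 2. For every $n\ge0$, $$F(n)=\frac{n^2(n-1)^2}{4}+\frac{n(n-1)^2(n-2)}{12}+\sum_{u=2}^{n}\ \sum_{1\le y\le\lfloor n/u\rfloor}\ \sum_{d\mid u}\mu(d)R_{u,y,d}.$$ 3. There are fixed polynomials $c_{p,q}$ and $e$ with rational coefficients such that for all $n$ and every outer triple $(u,y,d)$ for $n$, with $T_0=\lfloor (u-1)/d\rfloor$, $X=\lfloor n/u\rfloor$, $X_1=\max\big(y-1,\lfloor (n-ydT_0)/u\rfloor\big)$ and $T_1=\min\big(T_0,\lfloor (n-uy)/(yd)\rfloor\big)$, $$R_{u,y,d}=\sum_{p,q}c_{p,q}(n,u,y,d,X)\,\mathcal H_{p,q}(X-X_1;\,yd,\,u,\,n-uX)+e(n,u,y,d,T_0,X_1,T_1).$$ 4. (Affine step.) There are fixed rational polynomials $\alpha,\beta$ in two variables (depending only on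 the indices) such that for all $N,a,b\ge0$, $m\ge1$, with $A=\lfloor a/m\rfloor$, $B=\lfloor b/m\rfloor$, $a'=a-Am$, $b'=b-Bm$, $$\mathcal H_{p,q}(N;m,a,b)=\sum_{p',q'}\alpha_{p,q}^{p',q'}(A,B)\,\mathcal H_{p',q'}(N;m,a',b')+\sum_{r=0}^{4}\beta_{p,q}^{r}(A,B)P_r(N).$$ 5. (Reciprocal step.) There are fixed rational numbers $\gamma,\rho$ (depending only on the indices) such that for all $N\ge1$, $1\le a<m$, $0\le b<m$, with $Y=\lfloor (a(N-1)+b)/m\rfloor$, $$\mathcal H_{p,q}(N;m,a,b)=\sum_{p',q'}\gamma_{p,q}^{p',q'}\,\mathcal H_{p',q'}(Y;a,m,m-b-1)+P_p(N)Y^q+\sum_{r=0}^{4}\rho_{p,q}^{r}P_r(Y).$$ In items 4 and 5, $(p,q)$ and $(p',q')$ range over the ten pairs. 6. One program computes, from $(N,m,a,b)$ with $m\ge1$, all ten values $\mathcal H_{p,q}(N;m,a,b)$ in time and space $O(\log m)$ as $m\to\infty$, uniformly in $N,a,b$; in particular in $O(\log n)$ when $m\le n$. 7. One program computes $R_{u,y,d}$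 from $(n,u,y,d)$, for every $n$ and every outer triple $(u,y,d)$ for $n$, in time and space $O(\log n)$, uniformly in the triple. 8. There are a preprocessing program and a main program such that for every $n\ge0$: the preprocessing, given $n$, stores the lists $D(u)$, $1\le u\le n$, in memory in $O(n\log n)$ time; the main program, started on the resulting state, then computes $F(n)$ exactly in $O(n\log^3 n)$ time; and both use $O(n\log n)$ space. -/

import Mathlib

/-! ### Lattice rectangles -/

/-- `V` is the vertex set `{P, P + s, P + t, P + s + t}` of a non-degenerate rectangle with
vertices in `ℤ²` (of any orientation). -/
def IsLatticeRectangle (V : Finset (ℤ × ℤ)) : Prop :=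
  ∃ P s t : ℤ × ℤ, s ≠ 0 ∧ t ≠ 0 ∧ s.1 * t.1 + s.2 * t.2 = 0 ∧ V = {P, P + s, P + t, P + s + t}

open Classical in
/-- The number `F(n)` of lattice rectangles contained in `[0,n) × [0,n)`. -/
noncomputable def rectCount (n : ℕ) : ℕ :=
  ((Finset.Ico (0 : ℤ) n ×ˢ Finset.Ico (0 : ℤ) n).powerset.filter IsLatticeRectangle).card

/-- The contribution `F₀(n)` of the axis-parallel directions and of the direction `(1,1)`. -/
def boundaryCount (n : ℕ) : ℚ :=
  (n : ℚ) ^ 2 * ((n : ℚ) - 1) ^ 2 / 4 + (n : ℚ) * ((n : ℚ) - 1) ^ 2 * ((n : ℚ) - 2) / 12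

/-- `mult(x,y)` for `x ≥ y`. -/
def rectMult (x y : ℕ) : ℤ := if x = y then 2 else 4

/-- `R_{u,y,d}`: the sum over `1 ≤ t < u/d` and over `x ≥ y` with `xu + ydt ≤ n`
(such `x` is at most `n` when `u ≥ 1`) of `mult(x,y) (n - xu - ydt) (n - xdt - yu)`. -/
def outerTerm (n u y d : ℕ) : ℤ :=
  ∑ t ∈ (Finset.Icc 1 u).filter (fun t => d * t < u),
    ∑ x ∈ (Finset.Icc y n).filter (fun x => x * u + y * (d * t) ≤ n),
      rectMult x y * ((n : ℤ) - x * u - y * (d * t)) * ((n : ℤ) - x * (d * t) - y * u)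

/-- `(u,y,d)` is an admissible outer triple for `n`. -/
def IsOuterTriple (n u y d : ℕ) : Prop :=
  1 ≤ u ∧ u ≤ n ∧ 1 ≤ y ∧ y ≤ n / u ∧ d ∣ u ∧ Squarefree d

/-- The squarefree divisors of `u`. -/
def sqfreeDivisors (u : ℕ) : Finset ℕ := u.divisors.filter Squarefree

/-! ### The ten-moment family -/

/-- The ten index pairs `(p,q)` with `q ≥ 1` and `p + q ≤ 4`. -/
def tenStates : Finset (ℕ × ℕ) :=
  (Finset.range 5 ×ˢ Finset.range 5).filter (fun i => 1 ≤ i.2 ∧ i.1 + i.2 ≤ 4)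

/-- The weighted floor sum `H_{p,q}(N;m,a,b) = ∑_{x<N} x^p ⌊(ax+b)/m⌋^q`. -/
def floorMoment (p q N m a b : ℕ) : ℕ :=
  ∑ x ∈ Finset.range N, x ^ p * ((a * x + b) / m) ^ q

/-- The power sum `P_r(N) = ∑_{x<N} x^r`. -/
def powerSum (r N : ℕ) : ℕ := ∑ x ∈ Finset.range N, x ^ r

/-- `T₀ = ⌊(u-1)/d⌋`, the largest admissible `t` (for `u, d ≥ 1`). -/
def tCap (u d : ℕ) : ℕ := (u - 1) / d

/-- The right end of the capped zone: `⌊(n - y d T₀)/u⌋`, or `y - 1` if the capped zone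
`y ≤ x ≤ ⌊(n - y d T₀)/u⌋` is empty. The active-floor zone is
`capEnd n u y d < x ≤ ⌊n/u⌋`. -/
def capEnd (n u y d : ℕ) : ℤ :=
  max ((y : ℤ) - 1) (((n : ℤ) - y * d * tCap u d) / (u : ℤ))

/-- `T(y) = min(T₀, ⌊(n - uy)/(yd)⌋)`, the range of `t` on the diagonal `x = y`
(for `uy ≤ n`). -/
def tDiag (n u y d : ℕ) : ℕ := min (tCap u d) ((n - u * y) / (y * d))

/-! ### A unit-cost random access machine with bounded words

Programs are structured; they use finitely many integer registers and finitely many arrays of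
integer cells with computed addresses. Every operation costs one step. Executions are relative to
a space bound `S` (every address used is in `[0,S)`) and a word bound `W` (every integer that is
ever produced or read has absolute value at most `W`); an execution that leaves these bounds, or
divides by a non-positive integer, is stuck. -/

namespace RAM

structure State where
  reg : ℕ → ℤ
  mem : ℕ → ℕ → ℤ

/-- The initial state: the inputs in registers `0, 1, …`, and zero everywhere else. -/
def State.init (inputs : List ℤ) : State where
  reg r := inputs.getD r 0
  mem _ _ := 0

def State.setReg (s : State) (r : ℕ) (v : ℤ) : State where
  reg := Function.update s.reg r v
  mem := s.mem

def State.setMem (s : State) (a i : ℕ) (v : ℤ) : State where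
  reg := s.reg
  mem := Function.update s.mem a (Function.update (s.mem a) i v)

inductive Expr where
  | const (z : ℤ)
  | reg (r : ℕ)
  | load (a : ℕ) (i : Expr)
  | add (e f : Expr)
  | sub (e f : Expr)
  | mul (e f : Expr)
  | div (e f : Expr)

/-- The value of an expression. Division is only ever used with a positive divisor
(see `Expr.Ok`), where it is the floor of the quotient. -/
def Expr.val (s : State) : Expr → ℤ
  | .const z => z
  | .reg r => s.reg r
  | .load a i => s.mem a (i.val s).toNat
  | .add e f => e.val s + f.val s
  | .sub e f => e.val s - f.val s
  | .mul e f => e.val s * f.val s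
  | .div e f => e.val s / f.val s

/-- The evaluation of the expression respects the space bound and the word bound, and no divisor
is non-positive. -/
def Expr.Ok (S W : ℕ) (s : State) : Expr → Prop
  | .const z => |z| ≤ W
  | .reg r => |s.reg r| ≤ W
  | .load a i => i.Ok S W s ∧ 0 ≤ i.val s ∧ i.val s < S ∧ |s.mem a (i.val s).toNat| ≤ W
  | .add e f => e.Ok S W s ∧ f.Ok S W s ∧ |e.val s + f.val s| ≤ W
  | .sub e f => e.Ok S W s ∧ f.Ok S W s ∧ |e.val s - f.val s| ≤ W
  | .mul e f => e.Ok S W s ∧ f.Ok S W s ∧ |e.val s * f.val s| ≤ W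
  | .div e f => e.Ok S W s ∧ f.Ok S W s ∧ 0 < f.val s ∧ |e.val s / f.val s| ≤ W

/-- One step for each operation, constant, register access or memory access. -/
def Expr.cost : Expr → ℕ
  | .const _ => 1
  | .reg _ => 1
  | .load _ i => i.cost + 1
  | .add e f => e.cost + f.cost + 1
  | .sub e f => e.cost + f.cost + 1
  | .mul e f => e.cost + f.cost + 1
  | .div e f => e.cost + f.cost + 1

/-- Programs. The tests of `ite` and `loop` are `0 < e`. -/
inductive Cmd where
  | skip
  | set (r : ℕ) (e : Expr)
  | store (a : ℕ) (i e : Expr)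
  | seq (c₁ c₂ : Cmd)
  | ite (e : Expr) (c₁ c₂ : Cmd)
  | loop (e : Expr) (c : Cmd)

/-- `Exec S W c s k s'`: started in `s`, the program `c` halts in `s'` after exactly `k` steps,
within the space bound `S` and the word bound `W`. -/
inductive Exec (S W : ℕ) : Cmd → State → ℕ → State → Prop where
  | skip (s : State) : Exec S W .skip s 1 s
  | set (s : State) (r : ℕ) (e : Expr) (he : e.Ok S W s) :
      Exec S W (.set r e) s (e.cost + 1) (s.setReg r (e.val s))
  | store (s : State) (a : ℕ) (i e : Expr) (hi : i.Ok S W s) (he : e.Ok S W s)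
      (h0 : 0 ≤ i.val s) (hS : i.val s < S) :
      Exec S W (.store a i e) s (i.cost + e.cost + 1) (s.setMem a (i.val s).toNat (e.val s))
  | seq {c₁ c₂ : Cmd} {s s₁ s₂ : State} {k₁ k₂ : ℕ}
      (h₁ : Exec S W c₁ s k₁ s₁) (h₂ : Exec S W c₂ s₁ k₂ s₂) :
      Exec S W (.seq c₁ c₂) s (k₁ + k₂) s₂
  | ite_true {e : Expr} {c₁ c₂ : Cmd} {s s' : State} {k : ℕ} (he : e.Ok S W s)
      (h : 0 < e.val s) (h₁ : Exec S W c₁ s k s') :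
      Exec S W (.ite e c₁ c₂) s (e.cost + 1 + k) s'
  | ite_false {e : Expr} {c₁ c₂ : Cmd} {s s' : State} {k : ℕ} (he : e.Ok S W s)
      (h : ¬ 0 < e.val s) (h₂ : Exec S W c₂ s k s') :
      Exec S W (.ite e c₁ c₂) s (e.cost + 1 + k) s'
  | loop_done {e : Expr} {c : Cmd} {s : State} (he : e.Ok S W s) (h : ¬ 0 < e.val s) :
      Exec S W (.loop e c) s (e.cost + 1) s
  | loop_step {e : Expr} {c : Cmd} {s s₁ s₂ : State} {k₁ k₂ : ℕ} (he : e.Ok S W s)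
      (h : 0 < e.val s) (h₁ : Exec S W c s k₁ s₁) (h₂ : Exec S W (.loop e c) s₁ k₂ s₂) :
      Exec S W (.loop e c) s (e.cost + 1 + k₁ + k₂) s₂

/-- Started in `s`, the program `c` halts in `s'` after at most `time` steps, with all addresses
below `space` and all integers of absolute value at most `word`. -/
def RunsWithin (time space word : ℕ) (c : Cmd) (s s' : State) : Prop :=
  ∃ k ≤ time, Exec space word c s k s'

/-- The memory holds the lists `D(u) = {(d, μ(d)) : d ∣ u squarefree}` for all `1 ≤ u ≤ n`:
array `0` holds the list boundaries, and the entries of `D(u)`, each exactly once, occupy the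
cells from `mem 0 u` (included) to `mem 0 (u+1)` (excluded) of the arrays `1` (for `d`) and
`2` (for `μ(d)`). -/
def HoldsDivisorLists (n : ℕ) (s : State) : Prop :=
  ∀ u : ℕ, 1 ≤ u → u ≤ n → ∃ lo hi : ℕ, lo ≤ hi ∧ s.mem 0 u = lo ∧ s.mem 0 (u + 1) = hi ∧
    (Finset.Ico lo hi).val.map (fun j => (s.mem 1 j, s.mem 2 j)) =
      (sqfreeDivisors u).val.map (fun d : ℕ => ((d : ℤ), ArithmeticFunction.moebius d))

end RAM

/-! Counting. A lattice rectangle has exactly one description by side vectors x(U,V) and y(-V,U)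
with U, V coprime, U ≥ 1, V ≥ 0 and x, y ≥ 1. Its bounding box is (xU+yV) by (xV+yU), so the number
of its translates in the square is the product of the truncated differences n-(xU+yV) and n-(xV+yU)
(`rectCount_eq_sum_rectParams`). The directions (1,0) and (1,1) have closed forms. The others pair
up under U ↔ V, and the symmetry x ↔ y reduces to x ≥ y with weights 2 and 4. Möbius inversion, with
v = dt, removes the coprimality (`rectCount_eq_boundaryCount_add`).

Outer terms. For fixed (u,y,d) sum over t first: t runs up to the smaller of T₀ and f =
⌊(n-xu)/(yd)⌋, and the inner sum is a polynomial in x and this upper limit, divisible by the limit.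
Where the cap T₀ is active, everything is polynomial. Elsewhere the substitution i = X - x turns f
into ⌊(ui + n - uX)/(yd)⌋, and the inner sum is a combination of monomials i^p f^q with q ≥ 1 and
p+q ≤ 4, which gives the ten moments (`outerTerm_eq`).

Euclid. Reducing a and b modulo m is a binomial expansion (`floorMoment_affine`); exchanging a and m
counts the lattice points below a line by rows instead of columns (`floorMoment_reciprocal`).
Neither step raises the total degree, so the ten-member family is closed up to power sums. The
product m·(a mod m) at least halves in each round, so the chain has O(log m) rounds
(`FloorInst.lt_of_iterate_N_pos`).

Machine. The kernel descends the chain, stacking lengths and quotients, and climbs back from the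
empty sum, whose moments vanish (`RAM.exists_kernelCore_bounds`). Polynomials with rational
coefficients are evaluated by clearing denominators and dividing exactly once
(`RAM.IsPolyFn.exists_expr`). For word sizes, a loop-free body started on values at most B stays
below B^w, where w depends on the program alone (`RAM.Cmd.exec_run`). Each loop invariant restores
the same B after every round, because the stored values are genuine moments, sums and offsets with a
priori polynomial bounds; hence growth does not compound over the rounds.

Algorithm. A sieve finds smallest prime factors, and D(u) is copied from D(u/p) with p the smallest
prime factor of u, so preprocessing costs O(Σ n/d) (`RAM.preprocess_runs`). The main loops visit the
outer triples at logarithmic cost each, and their number is at most n Σ τ(u)/u ≤ n(1+log n)²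
(`tripleSum_le`, `RAM.mainLoop_runs`). -/

/-! ### Parametrization of lattice rectangles -/

/-- The vertex set of the rectangle with lowest vertex `(i + c, j)` and side vectors `(a, b)` and
`(-c, e)`. -/
def rectVertices (a b c e i j : ℕ) : Finset (ℤ × ℤ) :=
  {((i : ℤ) + c, (j : ℤ)), ((i : ℤ) + c + a, (j : ℤ) + b), ((i : ℤ), (j : ℤ) + e),
    ((i : ℤ) + a, (j : ℤ) + b + e)}

/-- The first four bounds are the bounding box. The last two single out the extreme vertices: the
lowest row begins at abscissa `i + c`, and the leftmost column ends at height `j + e`. This is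
enough to recover all parameters from the set. -/
theorem rectVertices_bounds {a b c e i j : ℕ} (ha : 1 ≤ a) (he : 1 ≤ e) {p : ℤ × ℤ}
    (hp : p ∈ rectVertices a b c e i j) :
    (i : ℤ) ≤ p.1 ∧ (j : ℤ) ≤ p.2 ∧ p.1 ≤ (i : ℤ) + c + a ∧ p.2 ≤ (j : ℤ) + b + e ∧
      (p.2 = j → (i : ℤ) + c ≤ p.1) ∧ (p.1 = i → p.2 ≤ (j : ℤ) + e) := by
  simp only [rectVertices, Finset.mem_insert, Finset.mem_singleton] at hp
  rcases hp with rfl | rfl | rfl | rfl <;> dsimp only <;> omega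

/-- The bounding box and the extreme vertices depend only on the vertex set. Applying
`rectVertices_bounds` to each vertex of one description inside the other, in both directions, yields
opposite inequalities. -/
theorem rectVertices_injective {a b c e i j a' b' c' e' i' j' : ℕ} (ha : 1 ≤ a) (he : 1 ≤ e)
    (ha' : 1 ≤ a') (he' : 1 ≤ e')
    (h : rectVertices a b c e i j = rectVertices a' b' c' e' i' j') :
    a = a' ∧ b = b' ∧ c = c' ∧ e = e' ∧ i = i' ∧ j = j' := by
  have m : ∀ p ∈ rectVertices a b c e i j, p ∈ rectVertices a' b' c' e' i' j' :=
    fun p hp => h ▸ hp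
  have m' : ∀ p ∈ rectVertices a' b' c' e' i' j', p ∈ rectVertices a b c e i j :=
    fun p hp => h ▸ hp
  have q1 := rectVertices_bounds ha' he' (m ((i : ℤ) + c, (j : ℤ)) (by simp [rectVertices]))
  have q2 := rectVertices_bounds ha' he' (m ((i : ℤ) + c + a, (j : ℤ) + b) (by simp [rectVertices]))
  have q3 := rectVertices_bounds ha' he' (m ((i : ℤ), (j : ℤ) + e) (by simp [rectVertices]))
  have q4 := rectVertices_bounds ha' he' (m ((i : ℤ) + a, (j : ℤ) + b + e) (by simp [rectVertices]))
  have r1 := rectVertices_bounds ha he (m' ((i' : ℤ) + c', (j' : ℤ)) (by simp [rectVertices]))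
  have r2 := rectVertices_bounds ha he
    (m' ((i' : ℤ) + c' + a', (j' : ℤ) + b') (by simp [rectVertices]))
  have r3 := rectVertices_bounds ha he (m' ((i' : ℤ), (j' : ℤ) + e') (by simp [rectVertices]))
  have r4 := rectVertices_bounds ha he
    (m' ((i' : ℤ) + a', (j' : ℤ) + b' + e') (by simp [rectVertices]))
  dsimp only at q1 q2 q3 q4 r1 r2 r3 r4
  obtain ⟨-, q1j, -, -, q1c, -⟩ := q1
  obtain ⟨-, -, q2a, -, -, -⟩ := q2
  obtain ⟨q3i, -, -, -, -, q3e⟩ := q3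
  obtain ⟨-, -, -, q4b, -, -⟩ := q4
  obtain ⟨-, r1j, -, -, r1c, -⟩ := r1
  obtain ⟨-, -, r2a, -, -, -⟩ := r2
  obtain ⟨r3i, -, -, -, -, r3e⟩ := r3
  obtain ⟨-, -, -, r4b, -, -⟩ := r4
  have hi : (i : ℤ) = i' := le_antisymm r3i q3i
  have hj : (j : ℤ) = j' := le_antisymm r1j q1j
  replace q1c := q1c hj
  replace r1c := r1c hj.symm
  replace q3e := q3e hi
  replace r3e := r3e hi.symm
  refine ⟨?_, ?_, ?_, ?_, ?_, ?_⟩ <;> omega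

/-- `V` is spanned by `P, s, t`. -/
def SpansRect (V : Finset (ℤ × ℤ)) (P s t : ℤ × ℤ) : Prop :=
  s ≠ 0 ∧ t ≠ 0 ∧ s.1 * t.1 + s.2 * t.2 = 0 ∧ V = {P, P + s, P + t, P + s + t}

theorem SpansRect.swap {V : Finset (ℤ × ℤ)} {P s t : ℤ × ℤ} (h : SpansRect V P s t) :
    SpansRect V P t s := by
  obtain ⟨h1, h2, h3, rfl⟩ := h
  refine ⟨h2, h1, by linarith, ?_⟩
  rw [add_right_comm P t s, Finset.insert_comm (P + t)]

theorem SpansRect.neg_left {V : Finset (ℤ × ℤ)} {P s t : ℤ × ℤ} (h : SpansRect V P s t) :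
    SpansRect V (P + s) (-s) t := by
  obtain ⟨h1, h2, h3, rfl⟩ := h
  refine ⟨neg_ne_zero.2 h1, h2, by simp only [Prod.fst_neg, Prod.snd_neg]; linarith, ?_⟩
  rw [add_neg_cancel_right]
  ext p
  simp only [Finset.mem_insert, Finset.mem_singleton]
  tauto

theorem SpansRect.neg_right {V : Finset (ℤ × ℤ)} {P s t : ℤ × ℤ} (h : SpansRect V P s t) :
    SpansRect V (P + t) s (-t) := h.swap.neg_left.swap

/-- Among the directions ±s, ±t exactly one lies in the half-open first quadrant, and its quarter
turn is again one of these directions up to length. Negating or swapping sides only moves the base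
vertex, so such a pair can be chosen as the spanning sides. -/
theorem IsLatticeRectangle.exists_normalized {V : Finset (ℤ × ℤ)} (h : IsLatticeRectangle V) :
    ∃ P s t : ℤ × ℤ, SpansRect V P s t ∧ 0 < s.1 ∧ 0 ≤ s.2 ∧ t.1 ≤ 0 ∧ 0 < t.2 := by
  have right : ∀ P s t : ℤ × ℤ, SpansRect V P s t → 0 < s.1 → 0 ≤ s.2 →
      ∃ P s t : ℤ × ℤ, SpansRect V P s t ∧ 0 < s.1 ∧ 0 ≤ s.2 ∧ t.1 ≤ 0 ∧ 0 < t.2 := by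
    intro P s t h h1 h2
    have ho := h.2.2.1
    rcases lt_trichotomy t.2 0 with h3 | h3 | h3
    · refine ⟨_, s, -t, h.neg_right, h1, h2, ?_, ?_⟩
      · simp only [Prod.fst_neg]
        by_contra hc
        nlinarith
      · simp only [Prod.snd_neg]; omega
    · have : s.1 * t.1 = 0 := by rw [h3] at ho; linarith
      rcases mul_eq_zero.1 this with h4 | h4
      · omega
      · exact absurd (Prod.ext h4 h3) h.2.1
    · refine ⟨P, s, t, h, h1, h2, ?_, h3⟩
      by_contra hc
      nlinarith
  have upper : ∀ P s t : ℤ × ℤ, SpansRect V P s t → (0 < s.1 ∧ 0 ≤ s.2) ∨ (s.1 ≤ 0 ∧ 0 < s.2) →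
      ∃ P s t : ℤ × ℤ, SpansRect V P s t ∧ 0 < s.1 ∧ 0 ≤ s.2 ∧ t.1 ≤ 0 ∧ 0 < t.2 := by
    rintro P s t h (⟨h1, h2⟩ | ⟨h1, h2⟩)
    · exact right P s t h h1 h2
    · have ho := h.2.2.1
      rcases lt_trichotomy t.1 0 with h3 | h3 | h3
      · refine right _ (-t) s h.neg_right.swap ?_ ?_
        · simp only [Prod.fst_neg]; omega
        · simp only [Prod.snd_neg]
          by_contra hc
          nlinarith
      · have : s.2 * t.2 = 0 := by rw [h3] at ho; linarith
        rcases mul_eq_zero.1 this with h4 | h4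
        · omega
        · exact absurd (Prod.ext h3 h4) h.2.1
      · refine right _ t s h.swap h3 ?_
        by_contra hc
        nlinarith
  obtain ⟨P, s, t, h⟩ := h
  have hs : SpansRect V P s t := h
  have hne : s.1 ≠ 0 ∨ s.2 ≠ 0 := by
    by_contra hc
    push Not at hc
    exact hs.1 (Prod.ext hc.1 hc.2)
  by_cases hu : (0 < s.1 ∧ 0 ≤ s.2) ∨ (s.1 ≤ 0 ∧ 0 < s.2)
  · exact upper P s t hs hu
  · refine upper _ (-s) t hs.neg_left ?_
    simp only [Prod.fst_neg, Prod.snd_neg]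
    omega

/-- The number of positions of the rectangle with side vectors `x * (U, V)` and `y * (-V, U)`. -/
def positions (n U V x y : ℕ) : ℕ := (n - (x * U + y * V)) * (n - (x * V + y * U))

/-- The parameters `((U, V), (x, y))` of the rectangles. -/
def rectParams (n : ℕ) : Finset ((ℕ × ℕ) × ℕ × ℕ) :=
  ((Finset.Icc 1 n ×ˢ Finset.range (n + 1)) ×ˢ (Finset.Icc 1 n ×ˢ Finset.Icc 1 n)).filter
    fun q => Nat.Coprime q.1.1 q.1.2

/-- Rectangles are matched bijectively with a primitive direction, two multipliers and the lower
left corner of the bounding box; the admissible corners form a product of two intervals, which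
accounts for `positions`. -/
theorem rectCount_eq_sum_rectParams (n : ℕ) :
    rectCount n = ∑ q ∈ rectParams n, positions n q.1.1 q.1.2 q.2.1 q.2.2 := by
  classical
  set T := (rectParams n).sigma fun q =>
    Finset.range (n - (q.2.1 * q.1.1 + q.2.2 * q.1.2)) ×ˢ
      Finset.range (n - (q.2.1 * q.1.2 + q.2.2 * q.1.1)) with hT
  have hcard : T.card = ∑ q ∈ rectParams n, positions n q.1.1 q.1.2 q.2.1 q.2.2 := by
    rw [hT, Finset.card_sigma]
    exact Finset.sum_congr rfl fun q _ => by simp [positions]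
  rw [← hcard, rectCount]
  symm
  refine Finset.card_bij (fun z _ => rectVertices (z.1.2.1 * z.1.1.1) (z.1.2.1 * z.1.1.2)
    (z.1.2.2 * z.1.1.2) (z.1.2.2 * z.1.1.1) z.2.1 z.2.2) ?_ ?_ ?_
  · rintro ⟨⟨⟨U, V⟩, x, y⟩, i, j⟩ hz
    simp only [hT, rectParams, Finset.mem_sigma, Finset.mem_filter, Finset.mem_product,
      Finset.mem_Icc, Finset.mem_range] at hz
    obtain ⟨⟨⟨⟨⟨hU, -⟩, -⟩, ⟨hx, -⟩, hy, -⟩, hcop⟩, hi, hj⟩ := hz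
    have ha : 1 ≤ x * U := Nat.mul_pos hx hU
    have he : 1 ≤ y * U := Nat.mul_pos hy hU
    dsimp only
    generalize hA : x * U = A at *
    generalize hB : x * V = B at *
    generalize hC : y * V = C at *
    generalize hE : y * U = E at *
    have horth : A * C = B * E := by rw [← hA, ← hB, ← hC, ← hE]; ring
    rw [Finset.mem_filter, Finset.mem_powerset]
    constructor
    · intro p hp
      have := rectVertices_bounds ha he hp
      rw [Finset.mem_product, Finset.mem_Ico, Finset.mem_Ico]
      omega
    · refine ⟨((i : ℤ) + C, (j : ℤ)), ((A : ℤ), (B : ℤ)), (-(C : ℤ), (E : ℤ)), ?_, ?_, ?_, ?_⟩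
      · intro h; rw [Prod.ext_iff] at h; simp at h; omega
      · intro h; rw [Prod.ext_iff] at h; simp at h; omega
      · have : (A : ℤ) * C = B * E := by exact_mod_cast horth
        dsimp only; linarith
      · simp only [rectVertices, Prod.mk_add_mk]
        congr 3
        · congr 1
          ring
        · congr 1
          ext <;> dsimp only; ring
  · rintro ⟨⟨⟨U, V⟩, x, y⟩, i, j⟩ hz ⟨⟨⟨U', V'⟩, x', y'⟩, i', j'⟩ hz' h
    simp only [hT, rectParams, Finset.mem_sigma, Finset.mem_filter, Finset.mem_product,
      Finset.mem_Icc, Finset.mem_range] at hz hz'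
    obtain ⟨⟨⟨⟨⟨hU, -⟩, -⟩, ⟨hx, -⟩, hy, -⟩, hcop⟩, hi, hj⟩ := hz
    obtain ⟨⟨⟨⟨⟨hU', -⟩, -⟩, ⟨hx', -⟩, hy', -⟩, hcop'⟩, hi', hj'⟩ := hz'
    obtain ⟨e1, e2, e3, e4, rfl, rfl⟩ := rectVertices_injective (Nat.mul_pos hx hU)
      (Nat.mul_pos hy hU) (Nat.mul_pos hx' hU') (Nat.mul_pos hy' hU') h
    dsimp only at e1 e2 e3 e4
    -- Primitivity of the direction makes the multiplier recoverable as the gcd of the coordinates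
    -- of the first side.
    have hxx : x = x' := by
      have h1 : Nat.gcd (x * U) (x * V) = x := by
        rw [Nat.gcd_mul_left, Nat.coprime_iff_gcd_eq_one.1 hcop, mul_one]
      have h2 : Nat.gcd (x' * U') (x' * V') = x' := by
        rw [Nat.gcd_mul_left, Nat.coprime_iff_gcd_eq_one.1 hcop', mul_one]
      rw [← h1, e1, e2, h2]
    subst hxx
    obtain rfl := Nat.eq_of_mul_eq_mul_left hx e1
    obtain rfl := Nat.eq_of_mul_eq_mul_left hx e2
    obtain rfl := Nat.eq_of_mul_eq_mul_right hU e4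
    rfl
  · intro W hW
    rw [Finset.mem_filter, Finset.mem_powerset] at hW
    obtain ⟨hsub, hrect⟩ := hW
    obtain ⟨P, s, t, ⟨-, -, horth, hV⟩, hs1, hs2, ht1, ht2⟩ := hrect.exists_normalized
    obtain ⟨P1, P2⟩ := P
    obtain ⟨s1, s2⟩ := s
    obtain ⟨t1, t2⟩ := t
    dsimp only at *
    obtain ⟨a, rfl⟩ := Int.eq_ofNat_of_zero_le hs1.le
    obtain ⟨b, rfl⟩ := Int.eq_ofNat_of_zero_le hs2
    obtain ⟨c, hc⟩ := Int.eq_ofNat_of_zero_le (neg_nonneg.2 ht1)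
    obtain rfl : t1 = -(c : ℤ) := by omega
    obtain ⟨e, rfl⟩ := Int.eq_ofNat_of_zero_le ht2.le
    have horth' : a * c = b * e := by zify; linarith
    have m1 := hsub (show ((P1, P2) : ℤ × ℤ) ∈ W by simp [hV])
    have m2 := hsub (show ((P1, P2) + ((a : ℤ), (b : ℤ)) : ℤ × ℤ) ∈ W by simp [hV])
    have m3 := hsub (show ((P1, P2) + (-(c : ℤ), (e : ℤ)) : ℤ × ℤ) ∈ W by simp [hV])
    have m4 := hsub (show ((P1, P2) + ((a : ℤ), (b : ℤ)) + (-(c : ℤ), (e : ℤ)) : ℤ × ℤ) ∈ W by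
      simp [hV])
    simp only [Finset.mem_product, Finset.mem_Ico, Prod.mk_add_mk] at m1 m2 m3 m4
    obtain ⟨i, hi⟩ := Int.eq_ofNat_of_zero_le (show 0 ≤ P1 - c by omega)
    obtain ⟨j, rfl⟩ := Int.eq_ofNat_of_zero_le m1.2.1
    obtain rfl : P1 = (i : ℤ) + c := by omega
    have ha : 0 < a := by omega
    have he : 0 < e := by omega
    -- With (a,b) = g(U,V), orthogonality reads Uc = Ve. Coprimality then forces U ∣ e, so the
    -- second side is y(-V,U).
    obtain ⟨g, U, V, hg, hcop, rfl, rfl⟩ := Nat.exists_coprime' (m := a) (n := b)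
      (Nat.gcd_pos_of_pos_left b ha)
    have hU : 0 < U := Nat.pos_of_mul_pos_right ha
    have hUe : U ∣ e := by
      refine hcop.dvd_of_dvd_mul_left ⟨c, ?_⟩
      have : g * (U * c) = g * (V * e) := by linarith
      exact (Nat.eq_of_mul_eq_mul_left hg this).symm
    obtain ⟨y, rfl⟩ := hUe
    have hy : 0 < y := Nat.pos_of_mul_pos_left he
    have hcV : c = V * y := by
      have : g * U * c = g * U * (V * y) := by linarith
      exact Nat.eq_of_mul_eq_mul_left (Nat.mul_pos hg hU) this
    subst hcV
    have k1 : U ≤ U * g := Nat.le_mul_of_pos_right _ hg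
    have k2 : V ≤ V * g := Nat.le_mul_of_pos_right _ hg
    have k3 : g ≤ U * g := Nat.le_mul_of_pos_left _ hU
    have k4 : y ≤ U * y := Nat.le_mul_of_pos_left _ hU
    refine ⟨⟨⟨⟨U, V⟩, g, y⟩, i, j⟩, ?_, ?_⟩
    · simp only [hT, rectParams, Finset.mem_sigma, Finset.mem_filter, Finset.mem_product,
        Finset.mem_Icc, Finset.mem_range]
      rw [mul_comm g U, mul_comm g V, mul_comm y U, mul_comm y V]
      refine ⟨⟨⟨⟨⟨hU, ?_⟩, ?_⟩, ⟨hg, ?_⟩, hy, ?_⟩, hcop⟩, ?_, ?_⟩ <;> omega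
    · dsimp only
      rw [hV, rectVertices, mul_comm g U, mul_comm g V, mul_comm y U, mul_comm y V]
      simp only [Prod.mk_add_mk]
      congr 3
      · congr 1
        ring
      · congr 1
        ext <;> dsimp only; ring

/-! ### Reduction of the rectangle count to the outer terms -/

theorem sum_Icc_sum_Icc_of_symm {M : Type*} [AddCommMonoid M] {f : ℕ → ℕ → M}
    (hf : ∀ x y, f x y = f y x) (n : ℕ) :
    ∑ x ∈ Finset.Icc 1 n, ∑ y ∈ Finset.Icc 1 n, f x y =
      ∑ x ∈ Finset.Icc 1 n, f x x +
        2 • ∑ x ∈ Finset.Icc 1 n, ∑ y ∈ Finset.Ico 1 x, f x y := by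
  induction n with
  | zero => simp
  | succ n ih =>
    have h : ∑ x ∈ Finset.Icc 1 n, f x (n + 1) = ∑ y ∈ Finset.Ico 1 (n + 1), f (n + 1) y :=
      Finset.sum_congr rfl fun x _ => hf _ _
    simp only [Finset.sum_Icc_succ_top (Nat.le_add_left 1 n), Finset.sum_add_distrib, ih, h,
      smul_add, two_smul]
    have h' : ∑ y ∈ Finset.Icc 1 n, f (n + 1) y = ∑ y ∈ Finset.Ico 1 (n + 1), f (n + 1) y := rfl
    rw [h']
    abel

/-- The weights 2 and 4 combine two symmetries: folding the square x, y onto x ≥ y doubles the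
off-diagonal terms, and the overall factor 2 is kept for the later exchange of the direction with
its mirror image. -/
theorem sum_rectMult_mul {f : ℕ → ℕ → ℤ} (hf : ∀ x y, f x y = f y x) (n : ℕ) :
    ∑ y ∈ Finset.Icc 1 n, ∑ x ∈ Finset.Icc y n, rectMult x y * f x y =
      2 * ∑ x ∈ Finset.Icc 1 n, ∑ y ∈ Finset.Icc 1 n, f x y := by
  induction n with
  | zero => simp
  | succ n ih =>
    have h1 : ∑ y ∈ Finset.Icc 1 n, ∑ x ∈ Finset.Icc y (n + 1), rectMult x y * f x y =
        ∑ y ∈ Finset.Icc 1 n, ∑ x ∈ Finset.Icc y n, rectMult x y * f x y +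
          4 * ∑ y ∈ Finset.Icc 1 n, f (n + 1) y := by
      rw [Finset.mul_sum, ← Finset.sum_add_distrib]
      refine Finset.sum_congr rfl fun y hy => ?_
      rw [Finset.mem_Icc] at hy
      rw [Finset.sum_Icc_succ_top (by omega), rectMult, if_neg (by omega)]
    have h2 : ∑ x ∈ Finset.Icc 1 n, f x (n + 1) = ∑ y ∈ Finset.Icc 1 n, f (n + 1) y :=
      Finset.sum_congr rfl fun x _ => hf _ _
    simp only [Finset.sum_Icc_succ_top (Nat.le_add_left 1 n), Finset.sum_add_distrib, h1, ih, h2,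
      Finset.Icc_self, Finset.sum_singleton]
    rw [rectMult, if_pos rfl]
    ring

/-- Möbius inversion for a sum over the residues coprime to `u`. -/
theorem sum_coprime_eq_sum_moebius {u : ℕ} (hu : u ≠ 0) (g : ℕ → ℤ) :
    ∑ v ∈ Finset.Ico 1 u, (if Nat.Coprime u v then g v else 0) =
      ∑ d ∈ u.divisors, ArithmeticFunction.moebius d *
        ∑ t ∈ (Finset.Icc 1 u).filter (fun t => d * t < u), g (d * t) := by
  have hdiv : ∀ d ∈ u.divisors,
      ∑ t ∈ (Finset.Icc 1 u).filter (fun t => d * t < u), g (d * t) =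
        ∑ v ∈ Finset.Ico 1 u, if d ∣ v then g v else 0 := by
    intro d hd
    have hd0 : 0 < d := Nat.pos_of_mem_divisors hd
    rw [← Finset.sum_filter]
    refine Finset.sum_bij (fun t _ => d * t) ?_ ?_ ?_ fun _ _ => rfl
    · intro t ht
      simp only [Finset.mem_filter, Finset.mem_Icc, Finset.mem_Ico] at ht ⊢
      exact ⟨⟨Nat.mul_pos hd0 ht.1.1, ht.2⟩, dvd_mul_right d t⟩
    · intro t _ t' _ h
      exact Nat.eq_of_mul_eq_mul_left hd0 h
    · intro v hv
      simp only [Finset.mem_filter, Finset.mem_Ico] at hv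
      obtain ⟨⟨h1, h2⟩, t, rfl⟩ := hv
      refine ⟨t, ?_, rfl⟩
      simp only [Finset.mem_filter, Finset.mem_Icc]
      have := Nat.le_mul_of_pos_left t hd0
      exact ⟨⟨Nat.pos_of_mul_pos_left h1, by omega⟩, h2⟩
  have hR := Finset.sum_congr rfl fun d hd =>
    congrArg (fun z => ArithmeticFunction.moebius d * z) (hdiv d hd)
  simp only [Finset.mul_sum] at hR ⊢
  rw [hR, Finset.sum_comm]
  refine Finset.sum_congr rfl fun v _ => ?_
  have hgcd : (Nat.gcd u v).divisors = u.divisors.filter (· ∣ v) := by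
    ext d
    simp only [Nat.mem_divisors, Finset.mem_filter, Nat.dvd_gcd_iff]
    have : Nat.gcd u v ≠ 0 := fun h => hu (Nat.eq_zero_of_gcd_eq_zero_left h)
    tauto
  have hsum : ∑ d ∈ (Nat.gcd u v).divisors, ArithmeticFunction.moebius d =
      if Nat.Coprime u v then 1 else 0 := by
    rw [← ArithmeticFunction.coe_mul_zeta_apply, ArithmeticFunction.moebius_mul_coe_zeta,
      ArithmeticFunction.one_apply]
  rw [hgcd, Finset.sum_filter] at hsum
  calc (if Nat.Coprime u v then g v else 0) = (if Nat.Coprime u v then 1 else 0) * g v := by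
        split_ifs <;> simp
    _ = _ := by
        rw [← hsum, Finset.sum_mul]
        refine Finset.sum_congr rfl fun d _ => ?_
        split_ifs <;> simp

/-! ### Sorting the rectangles by direction. -/

theorem positions_swap (n U V x y : ℕ) : positions n U V x y = positions n V U x y :=
  mul_comm _ _

theorem positions_symm (n U V x y : ℕ) : positions n U V x y = positions n U V y x := by
  unfold positions
  rw [mul_comm, add_comm (x * V), add_comm (x * U)]

/-- The number of rectangles with side directions `(U, V)` and `(-V, U)`. -/
def directionCount (n U V : ℕ) : ℕ :=
  ∑ x ∈ Finset.Icc 1 n, ∑ y ∈ Finset.Icc 1 n, positions n U V x y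

theorem directionCount_swap (n U V : ℕ) : directionCount n U V = directionCount n V U :=
  Finset.sum_congr rfl fun _ _ => Finset.sum_congr rfl fun _ _ => positions_swap ..

/-- The mirror symmetry U ↔ V pairs the directions off the diagonal, whence the factor 2.
Coprimality leaves a single direction with V = 0 and a single one with V = U. -/
theorem rectCount_eq_sum_directionCount (n : ℕ) :
    rectCount n = directionCount n 1 0 + directionCount n 1 1 +
      2 * ∑ u ∈ Finset.Icc 2 n, ∑ v ∈ Finset.Ico 1 u,
        if Nat.Coprime u v then directionCount n u v else 0 := by
  set f : ℕ → ℕ → ℕ := fun u v => if Nat.Coprime u v then directionCount n u v else 0 with hf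
  have hsymm : ∀ u v, f u v = f v u := fun u v => by
    simp only [hf, Nat.coprime_comm, directionCount_swap n u v]
  have h1 : rectCount n = ∑ U ∈ Finset.Icc 1 n, ∑ V ∈ Finset.range (n + 1), f U V := by
    rw [rectCount_eq_sum_rectParams, rectParams, Finset.sum_filter, Finset.sum_product,
      Finset.sum_product]
    refine Finset.sum_congr rfl fun U _ => Finset.sum_congr rfl fun V _ => ?_
    simp only [hf, directionCount]
    rw [Finset.sum_product]
    split_ifs <;> simp
  have h2 : ∀ U, ∑ V ∈ Finset.range (n + 1), f U V = f U 0 + ∑ V ∈ Finset.Icc 1 n, f U V := by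
    intro U
    rw [Finset.range_eq_Ico, Finset.sum_eq_sum_Ico_succ_bot (Nat.succ_pos n)]
    rfl
  rcases Nat.eq_zero_or_pos n with rfl | hn
  · simp [h1, directionCount]
  have h3 : ∀ U ∈ Finset.Icc 1 n, U ≠ 1 → f U 0 = 0 ∧ f U U = 0 := by
    intro U _ hU
    simp [hf, Nat.coprime_zero_right, Nat.coprime_self, hU]
  have h4 : (1 : ℕ) ∈ Finset.Icc 1 n := Finset.mem_Icc.2 ⟨le_rfl, hn⟩
  rw [h1, Finset.sum_congr rfl fun U _ => h2 U, Finset.sum_add_distrib,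
    sum_Icc_sum_Icc_of_symm hsymm,
    Finset.sum_eq_single_of_mem 1 h4 fun U hU h => (h3 U hU h).1,
    Finset.sum_eq_single_of_mem 1 h4 fun U hU h => (h3 U hU h).2,
    ← Finset.add_sum_Ioc_eq_sum_Icc hn]
  simp only [hf, Finset.Ico_self, Finset.sum_empty, zero_add, Nat.coprime_one_left_eq_true,
    if_true, smul_eq_mul, ← add_assoc]
  rfl

theorem sum_Icc_sub {M : Type*} [AddCommMonoid M] (f : ℕ → M) (n : ℕ) :
    ∑ x ∈ Finset.Icc 1 n, f (n - x) = ∑ k ∈ Finset.range n, f k := by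
  refine Finset.sum_bij' (fun x _ => n - x) (fun k _ => n - k) ?_ ?_ ?_ ?_ fun _ _ => rfl <;>
    simp only [Finset.mem_Icc, Finset.mem_range] <;> omega

theorem directionCount_axis (n : ℕ) :
    (directionCount n 1 0 : ℚ) = (n : ℚ) ^ 2 * ((n : ℚ) - 1) ^ 2 / 4 := by
  have h : directionCount n 1 0 = (∑ k ∈ Finset.range n, k) ^ 2 := by
    simp only [directionCount, positions, mul_one, mul_zero, add_zero, zero_add]
    rw [← Finset.sum_mul_sum, sum_Icc_sub (fun k => k), sq]
  have h' : ∀ n : ℕ, ∑ k ∈ Finset.range n, (k : ℚ) = (n : ℚ) * (n - 1) / 2 := by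
    intro n
    induction n with
    | zero => simp
    | succ n ih => rw [Finset.sum_range_succ, ih]; push_cast; ring
  rw [h]
  push_cast
  rw [h']
  ring

/-- For U = V = 1 the number of positions is the square of the truncated difference n - x - y, so
reversing both variables gives a double sum of squares. -/
theorem directionCount_diagonal (n : ℕ) :
    (directionCount n 1 1 : ℚ) = (n : ℚ) * ((n : ℚ) - 1) ^ 2 * ((n : ℚ) - 2) / 12 := by
  have h : directionCount n 1 1 = ∑ k ∈ Finset.range n, ∑ m ∈ Finset.range k, m ^ 2 := by
    rw [← sum_Icc_sub (fun k => ∑ m ∈ Finset.range k, m ^ 2)]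
    refine Finset.sum_congr rfl fun x hx => ?_
    rw [← sum_Icc_sub (fun m => m ^ 2)]
    symm
    refine (Finset.sum_congr rfl fun y _ => ?_).trans
      (Finset.sum_subset (Finset.Icc_subset_Icc_right (Nat.sub_le n x)) fun y hy0 hy => ?_)
    · rw [positions, mul_one, mul_one, Nat.sub_sub, sq]
    · simp only [Finset.mem_Icc] at hx hy0 hy
      have : n - (x * 1 + y * 1) = 0 := by omega
      rw [positions, this, zero_mul]
  have h' : ∀ n : ℕ, ∑ m ∈ Finset.range n, (m : ℚ) ^ 2 = (n : ℚ) * (n - 1) * (2 * n - 1) / 6 := by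
    intro n
    induction n with
    | zero => simp
    | succ n ih => rw [Finset.sum_range_succ, ih]; push_cast; ring
  rw [h]
  push_cast
  simp only [h']
  clear h
  induction n with
  | zero => simp
  | succ n ih => rw [Finset.sum_range_succ, ih]; push_cast; ring

/-- By rearrangement, (u-v)(x-y) ≥ 0 gives xv + yu ≤ xu + yv. Hence the one condition on the longer
side of the bounding box governs both truncated factors. -/
theorem cast_positions {n u v x y : ℕ} (hv : v ≤ u) (hy : y ≤ x) :
    (positions n u v x y : ℤ) = if x * u + y * v ≤ n then
      ((n : ℤ) - x * u - y * v) * ((n : ℤ) - x * v - y * u) else 0 := by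
  split_ifs with h
  · have h' : x * v + y * u ≤ n := by
      obtain ⟨k, rfl⟩ := Nat.exists_eq_add_of_le hv
      obtain ⟨l, rfl⟩ := Nat.exists_eq_add_of_le hy
      nlinarith
    rw [positions, Nat.cast_mul, Nat.cast_sub h, Nat.cast_sub h']
    push_cast
    ring
  · rw [positions, Nat.sub_eq_zero_of_le (by omega), zero_mul, Nat.cast_zero]

theorem two_mul_directionCount {n u v : ℕ} (hu : 1 ≤ u) (hv : v ≤ u) :
    2 * (directionCount n u v : ℤ) = ∑ y ∈ Finset.Icc 1 (n / u),
      ∑ x ∈ (Finset.Icc y n).filter (fun x => x * u + y * v ≤ n),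
        rectMult x y * ((n : ℤ) - x * u - y * v) * ((n : ℤ) - x * v - y * u) := by
  rw [directionCount]
  push_cast
  rw [← sum_rectMult_mul fun x y => by rw [positions_symm]]
  symm
  refine (Finset.sum_congr rfl fun y _ => ?_).trans
    (Finset.sum_subset (Finset.Icc_subset_Icc_right (Nat.div_le_self n u)) fun y hy hy' => ?_)
  · rw [Finset.sum_filter]
    refine Finset.sum_congr rfl fun x hx => ?_
    rw [cast_positions hv (Finset.mem_Icc.1 hx).1]
    split_ifs
    · ring
    · simp
  -- The rows y > ⌊n/u⌋ contribute nothing, since already xu ≥ yu > n.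
  · refine Finset.sum_eq_zero fun x hx => ?_
    rw [Finset.mem_Icc] at hy hy' hx
    have h1 : n < y * u := (Nat.div_lt_iff_lt_mul hu).1 (by omega)
    have h2 : y * u ≤ x * u := Nat.mul_le_mul_right u hx.1
    rw [cast_positions hv hx.1, if_neg (by omega), mul_zero]

theorem rectCount_eq_boundaryCount_add (n : ℕ) :
    (rectCount n : ℚ) = boundaryCount n +
      ((∑ u ∈ Finset.Icc 2 n, ∑ y ∈ Finset.Icc 1 (n / u), ∑ d ∈ u.divisors,
        ArithmeticFunction.moebius d * outerTerm n u y d : ℤ) : ℚ) := by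
  have key : ∀ u ∈ Finset.Icc 2 n,
      2 * ∑ v ∈ Finset.Ico 1 u, (if Nat.Coprime u v then (directionCount n u v : ℤ) else 0) =
        ∑ y ∈ Finset.Icc 1 (n / u), ∑ d ∈ u.divisors,
          ArithmeticFunction.moebius d * outerTerm n u y d := by
    intro u hu
    rw [Finset.mem_Icc] at hu
    have h : ∀ v ∈ Finset.Ico 1 u,
        2 * (if Nat.Coprime u v then (directionCount n u v : ℤ) else 0) =
          ∑ y ∈ Finset.Icc 1 (n / u), if Nat.Coprime u v then
            ∑ x ∈ (Finset.Icc y n).filter (fun x => x * u + y * v ≤ n),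
              rectMult x y * ((n : ℤ) - x * u - y * v) * ((n : ℤ) - x * v - y * u) else 0 := by
      intro v hv
      split_ifs
      · exact two_mul_directionCount (by omega) (Finset.mem_Ico.1 hv).2.le
      · simp
    rw [Finset.mul_sum, Finset.sum_congr rfl h, Finset.sum_comm]
    refine Finset.sum_congr rfl fun y _ => ?_
    rw [sum_coprime_eq_sum_moebius (by omega)]
    refine Finset.sum_congr rfl fun d _ => ?_
    rw [outerTerm]
    push_cast
    rfl
  have hz : (rectCount n : ℤ) = directionCount n 1 0 + directionCount n 1 1 +
      ∑ u ∈ Finset.Icc 2 n, ∑ y ∈ Finset.Icc 1 (n / u), ∑ d ∈ u.divisors,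
        ArithmeticFunction.moebius d * outerTerm n u y d := by
    rw [rectCount_eq_sum_directionCount, ← Finset.sum_congr rfl key, ← Finset.mul_sum]
    push_cast
    rfl
  have hq : (rectCount n : ℚ) = ((rectCount n : ℤ) : ℚ) := by simp
  rw [hq, hz, boundaryCount, Int.cast_add, Int.cast_add, Int.cast_natCast, Int.cast_natCast,
    directionCount_axis, directionCount_diagonal]

/-! ### The ten-moment family -/

theorem sum_tenStates {M : Type*} [AddCommMonoid M] (g : ℕ × ℕ → M) :
    ∑ j ∈ tenStates, g j = g (0, 1) + (g (0, 2) + (g (0, 3) + (g (0, 4) + (g (1, 1) + (g (1, 2) +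
      (g (1, 3) + (g (2, 1) + (g (2, 2) + g (3, 1))))))))) := by
  have : tenStates = {(0, 1), (0, 2), (0, 3), (0, 4), (1, 1), (1, 2), (1, 3), (2, 1), (2, 2),
    (3, 1)} := by decide
  rw [this]
  simp

theorem forall_tenStates {P : ℕ × ℕ → Prop} :
    (∀ i ∈ tenStates, P i) ↔ P (0, 1) ∧ P (0, 2) ∧ P (0, 3) ∧ P (0, 4) ∧ P (1, 1) ∧ P (1, 2) ∧
      P (1, 3) ∧ P (2, 1) ∧ P (2, 2) ∧ P (3, 1) := by
  have : tenStates = {(0, 1), (0, 2), (0, 3), (0, 4), (1, 1), (1, 2), (1, 3), (2, 1), (2, 2),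
    (3, 1)} := by decide
  rw [this]
  simp

/-! ### The affine Euclidean step. -/

/-- The coefficient of `x ^ l * f ^ k` in `x ^ p * (A * x + B + f) ^ q`. -/
noncomputable def affineCoeff (i j : ℕ × ℕ) : MvPolynomial (Fin 2) ℚ :=
  if i.1 ≤ j.1 ∧ j.2 ≤ i.2 ∧ j.1 - i.1 ≤ i.2 - j.2 then
    MvPolynomial.C ((i.2.choose j.2 * (i.2 - j.2).choose (j.1 - i.1) : ℕ) : ℚ) *
      MvPolynomial.X 0 ^ (j.1 - i.1) * MvPolynomial.X 1 ^ (i.2 - j.2 - (j.1 - i.1))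
  else 0

/-- Every monomial x^l f^k that occurs has l + k ≤ p + q ≤ 4. Those with k ≥ 1 stay in the ten
states; those with k = 0 become the power-sum terms, with `(r, 0)` used as a formal target index. -/
theorem affineCoeff_expand (A B x f : ℚ) : ∀ i ∈ tenStates, x ^ i.1 * (A * x + B + f) ^ i.2 =
    ∑ j ∈ tenStates, MvPolynomial.eval ![A, B] (affineCoeff i j) * (x ^ j.1 * f ^ j.2) +
      ∑ r ∈ Finset.range 5, MvPolynomial.eval ![A, B] (affineCoeff i (r, 0)) * x ^ r := by
  rw [forall_tenStates]
  refine ⟨?_, ?_, ?_, ?_, ?_, ?_, ?_, ?_, ?_, ?_⟩ <;>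
  · simp [sum_tenStates, Finset.sum_range_succ, affineCoeff, Nat.choose]
    ring

theorem floorMoment_affine (i : ℕ × ℕ) (hi : i ∈ tenStates) (N m a b : ℕ) (hm : 1 ≤ m) :
    (floorMoment i.1 i.2 N m a b : ℚ) =
      (∑ j ∈ tenStates,
        MvPolynomial.eval ![((a / m : ℕ) : ℚ), ((b / m : ℕ) : ℚ)] (affineCoeff i j) *
          (floorMoment j.1 j.2 N m (a % m) (b % m) : ℚ)) +
      ∑ r ∈ Finset.range 5,
        MvPolynomial.eval ![((a / m : ℕ) : ℚ), ((b / m : ℕ) : ℚ)] (affineCoeff i (r, 0)) *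
          (powerSum r N : ℚ) := by
  have hfl : ∀ x, (a * x + b) / m = a / m * x + b / m + (a % m * x + b % m) / m := by
    intro x
    have h1 := Nat.div_add_mod a m
    have h2 := Nat.div_add_mod b m
    have : a * x + b = (a % m * x + b % m) + m * (a / m * x + b / m) := by
      conv_lhs => rw [← h1, ← h2]
      ring
    rw [this, Nat.add_mul_div_left _ _ hm]
    ring
  simp only [floorMoment, powerSum, Nat.cast_sum, Finset.mul_sum]
  rw [Finset.sum_comm, Finset.sum_comm (s := Finset.range 5), ← Finset.sum_add_distrib]
  refine Finset.sum_congr rfl fun x _ => ?_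
  rw [hfl]
  push_cast
  exact affineCoeff_expand _ _ _ _ i hi

/-! ### The reciprocal Euclidean step. -/

/-- The coefficient of `g ^ k` in the power sum `∑_{x ≤ g} x ^ p`. -/
def powerSumCoeff : ℕ → ℕ → ℚ
  | 0, 0 => 1
  | 0, 1 => 1
  | 1, 1 => 1 / 2
  | 1, 2 => 1 / 2
  | 2, 1 => 1 / 6
  | 2, 2 => 1 / 2
  | 2, 3 => 1 / 3
  | 3, 2 => 1 / 4
  | 3, 3 => 1 / 2
  | 3, 4 => 1 / 4
  | _, _ => 0

theorem powerSum_succ_eq (p g : ℕ) (hp : p ≤ 3) :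
    (powerSum p (g + 1) : ℚ) = ∑ k ∈ Finset.range 5, powerSumCoeff p k * (g : ℚ) ^ k := by
  have : p = 0 ∨ p = 1 ∨ p = 2 ∨ p = 3 := by omega
  induction g with
  | zero =>
    rcases this with rfl | rfl | rfl | rfl <;> simp [powerSum, Finset.sum_range_succ, powerSumCoeff]
  | succ g ih =>
    have h1 : (powerSum p (g + 1 + 1) : ℚ) = powerSum p (g + 1) + ((g : ℚ) + 1) ^ p := by
      simp [powerSum, Finset.sum_range_succ _ (g + 1)]
    rw [h1, ih]
    rcases this with rfl | rfl | rfl | rfl <;>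
    simp [Finset.sum_range_succ, powerSumCoeff] <;> ring

/-- The coefficient of `k ^ r` in `(k + 1) ^ q - k ^ q`. -/
def powDiffCoeff (q r : ℕ) : ℚ := if r < q then q.choose r else 0

/-- The difference of q-th powers has degree q - 1 in k and the power sum has degree p + 1 in g, so
the total degree is again at most p + q. The roles of the two exponents are exchanged; terms without
g become power sums. -/
theorem reciprocal_expand (k g : ℚ) : ∀ i ∈ tenStates,
    ((k + 1) ^ i.2 - k ^ i.2) * ∑ l ∈ Finset.range 5, powerSumCoeff i.1 l * g ^ l =
    ∑ j ∈ tenStates, powDiffCoeff i.2 j.1 * powerSumCoeff i.1 j.2 * (k ^ j.1 * g ^ j.2) +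
      ∑ r ∈ Finset.range 5, powDiffCoeff i.2 r * powerSumCoeff i.1 0 * k ^ r := by
  rw [forall_tenStates]
  refine ⟨?_, ?_, ?_, ?_, ?_, ?_, ?_, ?_, ?_, ?_⟩ <;>
  simp [sum_tenStates, Finset.sum_range_succ, powDiffCoeff, powerSumCoeff, Nat.choose] <;> ring

/-- A telescoping sum, extended to the uniform range `Y` by an indicator so that it can be
interchanged with the sum over x. For q = 0 the power 1 would not be recovered, hence `hq`. -/
theorem pow_eq_sum_ite (q f Y : ℕ) (hq : 1 ≤ q) (hf : f ≤ Y) :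
    (f : ℚ) ^ q = ∑ k ∈ Finset.range Y, if k < f then ((k : ℚ) + 1) ^ q - (k : ℚ) ^ q else 0 := by
  rw [← Finset.sum_filter]
  have : (Finset.range Y).filter (fun k => k < f) = Finset.range f := by
    ext k; simp; omega
  rw [this]
  have := Finset.sum_range_sub (fun k : ℕ => (k : ℚ) ^ q) f
  push_cast at this
  rw [this]
  simp [show q ≠ 0 by omega]

/-- Slice the q-th power of the floor by levels k and sum over x first. At each level the surviving
x form a final segment of the range, so the inner sum is a difference of two power sums, the second
one ending at a floor with a and m exchanged. -/
theorem floorMoment_reciprocal (i : ℕ × ℕ) (hi : i ∈ tenStates) (N m a b Y : ℕ) (hN : 1 ≤ N)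
    (ha : 1 ≤ a) (hb : b < m) (hY : Y = (a * (N - 1) + b) / m) :
    (floorMoment i.1 i.2 N m a b : ℚ) =
      (∑ j ∈ tenStates, -(powDiffCoeff i.2 j.1 * powerSumCoeff i.1 j.2) *
        (floorMoment j.1 j.2 Y a m (m - b - 1) : ℚ)) +
      (powerSum i.1 N : ℚ) * (Y : ℚ) ^ i.2 +
      ∑ r ∈ Finset.range 5, -(powDiffCoeff i.2 r * powerSumCoeff i.1 0) * (powerSum r Y : ℚ) := by
  obtain ⟨hq, hp⟩ : 1 ≤ i.2 ∧ i.1 ≤ 3 := by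
    revert i; rw [forall_tenStates]; simp
  have hm : 0 < m := by omega
  have hle : ∀ x ∈ Finset.range N, (a * x + b) / m ≤ Y := by
    intro x hx
    rw [Finset.mem_range] at hx
    rw [hY]
    gcongr
    omega
  -- `g k` is the largest x whose floor is at most k: the condition ax + b < m(k+1) is ax ≤ mk + m -
  -- b - 1 over the integers.
  set g : ℕ → ℕ := fun k => (m * k + (m - b - 1)) / a with hg
  have hlt : ∀ x k, k < (a * x + b) / m ↔ g k < x := by
    intro x k
    rw [hg, Nat.div_lt_iff_lt_mul ha, ← Nat.succ_le_iff, Nat.le_div_iff_mul_le hm]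
    have : (k.succ) * m = m * k + m := by rw [Nat.succ_mul]; ring
    rw [this, mul_comm x a]
    omega
  -- For k < Y the last point x = N - 1 exceeds level k, so the complementary initial segment is not
  -- cut off by N.
  have hgN : ∀ k ∈ Finset.range Y, g k + 1 ≤ N := by
    intro k hk
    rw [Finset.mem_range, hY, hlt] at hk
    omega
  have key : ∀ k ∈ Finset.range Y,
      ∑ x ∈ Finset.range N, (if k < (a * x + b) / m then (x : ℚ) ^ i.1 else 0) =
        powerSum i.1 N - powerSum i.1 (g k + 1) := by
    intro k hk
    simp only [hlt]
    rw [← Finset.sum_filter, eq_sub_iff_add_eq]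
    have h2 : (powerSum i.1 (g k + 1) : ℚ) =
        ∑ x ∈ (Finset.range N).filter (fun x => ¬ g k < x), (x : ℚ) ^ i.1 := by
      rw [powerSum]
      push_cast
      refine Finset.sum_congr ?_ fun _ _ => rfl
      have := hgN k hk
      ext x; simp; omega
    rw [h2, Finset.sum_filter_add_sum_filter_not, powerSum]
    push_cast
    rfl
  have hH : (floorMoment i.1 i.2 N m a b : ℚ) = ∑ k ∈ Finset.range Y,
      (((k : ℚ) + 1) ^ i.2 - (k : ℚ) ^ i.2) * (powerSum i.1 N - powerSum i.1 (g k + 1)) := by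
    rw [floorMoment]
    push_cast
    calc ∑ x ∈ Finset.range N, (x : ℚ) ^ i.1 * (((a * x + b) / m : ℕ) : ℚ) ^ i.2
        = ∑ x ∈ Finset.range N, ∑ k ∈ Finset.range Y, (((k : ℚ) + 1) ^ i.2 - (k : ℚ) ^ i.2) *
            (if k < (a * x + b) / m then (x : ℚ) ^ i.1 else 0) := by
          refine Finset.sum_congr rfl fun x hx => ?_
          rw [pow_eq_sum_ite _ _ Y hq (hle x hx), Finset.mul_sum]
          refine Finset.sum_congr rfl fun k _ => ?_
          split_ifs <;> ring
      _ = _ := by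
          rw [Finset.sum_comm]
          refine Finset.sum_congr rfl fun k hk => ?_
          rw [← Finset.mul_sum, key k hk]
  rw [hH]
  simp only [mul_sub, Finset.sum_sub_distrib]
  rw [← Finset.sum_mul]
  have hY' : ∑ k ∈ Finset.range Y, (((k : ℚ) + 1) ^ i.2 - (k : ℚ) ^ i.2) = (Y : ℚ) ^ i.2 := by
    have := Finset.sum_range_sub (fun k : ℕ => (k : ℚ) ^ i.2) Y
    push_cast at this
    rw [this]
    simp [show i.2 ≠ 0 by omega]
  have hpt : ∑ k ∈ Finset.range Y,
      (((k : ℚ) + 1) ^ i.2 - (k : ℚ) ^ i.2) * (powerSum i.1 (g k + 1) : ℚ) =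
      (∑ j ∈ tenStates, powDiffCoeff i.2 j.1 * powerSumCoeff i.1 j.2 *
        (floorMoment j.1 j.2 Y a m (m - b - 1) : ℚ)) +
      ∑ r ∈ Finset.range 5, powDiffCoeff i.2 r * powerSumCoeff i.1 0 * (powerSum r Y : ℚ) := by
    simp only [floorMoment, powerSum, Nat.cast_sum, Finset.mul_sum (s := Finset.range Y)]
    rw [Finset.sum_comm (s := tenStates), Finset.sum_comm (s := Finset.range 5),
      ← Finset.sum_add_distrib]
    refine Finset.sum_congr rfl fun k _ => ?_
    have h1 := powerSum_succ_eq i.1 (g k) hp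
    simp only [powerSum] at h1
    push_cast at h1
    push_cast
    rw [h1, reciprocal_expand _ _ i hi]
  rw [hY', hpt]
  simp only [neg_mul, Finset.sum_neg_distrib]
  ring

/-! ### The outer contributions -/

/-- The summand of `outerTerm` without its multiplicity. -/
def rectWeight (n u y d x t : ℚ) : ℚ := (n - x * u - y * (d * t)) * (n - x * (d * t) - y * u)

/-- The sum of `rectWeight` over `1 ≤ t ≤ T`. -/
def rectWeightSum (n u y d x T : ℚ) : ℚ :=
  (n - x * u) * (n - y * u) * T - (y * d * (n - y * u) + x * d * (n - x * u)) * (T * (T + 1) / 2) +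
    y * d * (x * d) * (T * (T + 1) * (2 * T + 1) / 6)

theorem sum_rectWeight (n u y d x : ℚ) (T : ℕ) :
    ∑ t ∈ Finset.Icc 1 T, rectWeight n u y d x t = rectWeightSum n u y d x T := by
  induction T with
  | zero => simp [rectWeightSum]
  | succ T ih =>
    rw [Finset.sum_Icc_succ_top (by omega), ih]
    simp only [rectWeight, rectWeightSum]
    push_cast
    ring

/-- The sum of `rectWeightSum` over `y ≤ x ≤ z`. -/
def rectWeightSumSum (n u y d T z : ℚ) : ℚ :=
  (n * (n - y * u) * T - y * d * (n - y * u) * (T * (T + 1) / 2)) * (z - y + 1) +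
  (-u * (n - y * u) * T - d * n * (T * (T + 1) / 2) +
    y * d * d * (T * (T + 1) * (2 * T + 1) / 6)) * ((z * (z + 1) - (y - 1) * y) / 2) +
  (d * u * (T * (T + 1) / 2)) *
    ((z * (z + 1) * (2 * z + 1) - (y - 1) * y * (2 * (y - 1) + 1)) / 6)

theorem sum_rectWeightSum (n u d T : ℚ) (y k : ℕ) :
    ∑ x ∈ Finset.Ico y (y + k), rectWeightSum n u y d x T =
      rectWeightSumSum n u y d T ((y : ℚ) + k - 1) := by
  induction k with
  | zero => simp [rectWeightSumSum]
  | succ k ih =>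
    rw [← add_assoc, Finset.sum_Ico_succ_top (by omega), ih]
    simp only [rectWeightSum, rectWeightSumSum]
    push_cast
    ring

/-- For `x ≤ ⌊n/u⌋`, the number of admissible `t`. -/
def tRange (n u y d x : ℕ) : ℕ := min (tCap u d) ((n - x * u) / (y * d))

/-- After exchanging the sums, t fills a whole interval for each x. The multiplicity is taken to be
4 throughout, and the excess 2 is subtracted on the diagonal x = y. -/
theorem outerTerm_eq_sum {n u y d : ℕ} (hu : 1 ≤ u) (hy : 1 ≤ y) (hd : 1 ≤ d) (hyn : y ≤ n / u) :
    (outerTerm n u y d : ℚ) =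
      4 * ∑ x ∈ Finset.Icc y (n / u), rectWeightSum n u y d x (tRange n u y d x) -
        2 * rectWeightSum n u y d y (tDiag n u y d) := by
  have hyd : 0 < y * d := Nat.mul_pos hy hd
  have hswap : outerTerm n u y d = ∑ x ∈ Finset.Icc y (n / u),
      ∑ t ∈ Finset.Icc 1 (tRange n u y d x),
        rectMult x y * ((n : ℤ) - x * u - y * (d * t)) * ((n : ℤ) - x * (d * t) - y * u) := by
    rw [outerTerm]
    apply Finset.sum_comm'
    intro t x
    simp only [Finset.mem_filter, Finset.mem_Icc, tRange, tCap, le_min_iff]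
    rw [Nat.le_div_iff_mul_le (by omega : 0 < d), Nat.le_div_iff_mul_le hyd,
      Nat.le_div_iff_mul_le (by omega : 0 < u), mul_comm t d]
    have e1 : y * (d * t) = t * (y * d) := by ring
    have e2 : x ≤ x * u := Nat.le_mul_of_pos_right _ hu
    have e3 : t ≤ d * t := Nat.le_mul_of_pos_left _ hd
    rw [e1]
    constructor
    · rintro ⟨⟨⟨h1, h2⟩, h3⟩, ⟨h4, h5⟩, h6⟩
      refine ⟨⟨h1, ?_, ?_⟩, h4, ?_⟩ <;> omega
    · rintro ⟨⟨h1, h2, h3⟩, h4, h5⟩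
      refine ⟨⟨⟨h1, ?_⟩, ?_⟩, ⟨h4, ?_⟩, ?_⟩ <;> omega
  have hcast : ∀ x : ℕ, ((∑ t ∈ Finset.Icc 1 (tRange n u y d x), rectMult x y *
      ((n : ℤ) - x * u - y * (d * t)) * ((n : ℤ) - x * (d * t) - y * u) : ℤ) : ℚ) =
      (rectMult x y : ℚ) * rectWeightSum n u y d x (tRange n u y d x) := by
    intro x
    rw [← sum_rectWeight, Finset.mul_sum]
    push_cast
    refine Finset.sum_congr rfl fun t _ => ?_
    simp only [rectWeight]
    ring
  have hdiag : tDiag n u y d = tRange n u y d y := by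
    simp only [tDiag, tRange, mul_comm u y]
  rw [hswap, Int.cast_sum, Finset.sum_congr rfl fun x _ => hcast x,
    ← Finset.add_sum_Ioc_eq_sum_Icc hyn, ← Finset.add_sum_Ioc_eq_sum_Icc hyn, hdiag]
  have : ∀ x ∈ Finset.Ioc y (n / u), (rectMult x y : ℚ) *
      rectWeightSum n u y d x (tRange n u y d x) =
        4 * rectWeightSum n u y d x (tRange n u y d x) := by
    intro x hx
    rw [Finset.mem_Ioc] at hx
    simp [rectMult, hx.1.ne']
  rw [Finset.sum_congr rfl this, ← Finset.mul_sum]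
  simp only [rectMult, if_true]
  push_cast
  ring

open MvPolynomial in
/-- The coefficient of `i ^ p * f ^ q` in `4 * rectWeightSum n u y d (X - i) f`, a polynomial in
`n, u, y, d, X`. -/
noncomputable def outerCoeff : ℕ × ℕ → MvPolynomial (Fin 5) ℚ
  | (0, 1) => 4 * ((X 0 - X 1 * X 4) * (X 0 - X 2 * X 1)) -
      2 * (X 3 * (X 2 * (X 0 - X 2 * X 1) + X 4 * (X 0 - X 1 * X 4))) +
      C (2 / 3) * (X 2 * X 3 ^ 2 * X 4)
  | (1, 1) => 4 * (X 1 * (X 0 - X 2 * X 1)) -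
      2 * (X 3 * (X 4 * X 1 - (X 0 - X 1 * X 4))) - C (2 / 3) * (X 2 * X 3 ^ 2)
  | (2, 1) => 2 * (X 3 * X 1)
  | (0, 2) => 2 * (X 2 * X 3 ^ 2 * X 4) -
      2 * (X 3 * (X 2 * (X 0 - X 2 * X 1) + X 4 * (X 0 - X 1 * X 4)))
  | (1, 2) => -2 * (X 2 * X 3 ^ 2) - 2 * (X 3 * (X 4 * X 1 - (X 0 - X 1 * X 4)))
  | (2, 2) => 2 * (X 3 * X 1)
  | (0, 3) => C (4 / 3) * (X 2 * X 3 ^ 2 * X 4)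
  | (1, 3) => -C (4 / 3) * (X 2 * X 3 ^ 2)
  | _ => 0

/-- The bound p + q ≤ 4 originates here: the t-sum is linear in x at f³, at most quadratic in x at
f², and has no term free of f. -/
theorem outerCoeff_expand (n u y d X i f : ℚ) :
    4 * rectWeightSum n u y d (X - i) f =
      ∑ j ∈ tenStates, MvPolynomial.eval ![n, u, y, d, X] (outerCoeff j) * (i ^ j.1 * f ^ j.2) := by
  have e4 : (![n, u, y, d, X] : Fin 5 → ℚ) 4 = X := rfl
  have e3 : (![n, u, y, d, X] : Fin 5 → ℚ) 3 = d := rfl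
  simp only [sum_tenStates, outerCoeff, rectWeightSum]
  simp [e3, e4]
  ring

open MvPolynomial in
/-- The contribution of the capped zone and of the diagonal, a polynomial in
`n, u, y, d, T₀, X₁, T₁`. -/
noncomputable def outerCorrection : MvPolynomial (Fin 7) ℚ :=
  4 * ((X 0 * (X 0 - X 2 * X 1) * X 4 -
      C (1 / 2) * (X 2 * X 3 * (X 0 - X 2 * X 1) * (X 4 * (X 4 + 1)))) * (X 5 - X 2 + 1) +
    C (1 / 2) * ((-X 1 * (X 0 - X 2 * X 1) * X 4 - C (1 / 2) * (X 3 * X 0 * (X 4 * (X 4 + 1))) +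
      C (1 / 6) * (X 2 * X 3 * X 3 * (X 4 * (X 4 + 1) * (2 * X 4 + 1)))) *
        (X 5 * (X 5 + 1) - (X 2 - 1) * X 2)) +
    C (1 / 12) * (X 3 * X 1 * (X 4 * (X 4 + 1)) *
      (X 5 * (X 5 + 1) * (2 * X 5 + 1) - (X 2 - 1) * X 2 * (2 * (X 2 - 1) + 1)))) -
  2 * ((X 0 - X 2 * X 1) * (X 0 - X 2 * X 1) * X 6 -
    C (1 / 2) * ((X 2 * X 3 * (X 0 - X 2 * X 1) + X 2 * X 3 * (X 0 - X 2 * X 1)) *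
      (X 6 * (X 6 + 1))) +
    C (1 / 6) * (X 2 * X 3 * (X 2 * X 3) * (X 6 * (X 6 + 1) * (2 * X 6 + 1))))

theorem eval_outerCorrection (n u y d T z T' : ℚ) :
    MvPolynomial.eval ![n, u, y, d, T, z, T'] outerCorrection =
      4 * rectWeightSumSum n u y d T z - 2 * rectWeightSum n u y d y T' := by
  have e3 : (![n, u, y, d, T, z, T'] : Fin 7 → ℚ) 3 = d := rfl
  have e4 : (![n, u, y, d, T, z, T'] : Fin 7 → ℚ) 4 = T := rfl
  have e5 : (![n, u, y, d, T, z, T'] : Fin 7 → ℚ) 5 = z := rfl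
  have e6 : (![n, u, y, d, T, z, T'] : Fin 7 → ℚ) 6 = T' := rfl
  simp only [outerCorrection, rectWeightSum, rectWeightSumSum]
  simp [e3, e4, e5, e6]
  ring

/-- The limit for t is constant up to `capEnd` and equals the floor beyond it. The first zone sums
to a polynomial; in the second, counting x down from X makes the numerator of the floor increasing
and affine with nonnegative coefficients. -/
theorem outerTerm_eq {n u y d : ℕ} (h : IsOuterTriple n u y d) :
    (outerTerm n u y d : ℚ) =
      (∑ i ∈ tenStates,
        MvPolynomial.eval ![(n : ℚ), (u : ℚ), (y : ℚ), (d : ℚ), ((n / u : ℕ) : ℚ)] (outerCoeff i) *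
          (floorMoment i.1 i.2 (((n / u : ℕ) : ℤ) - capEnd n u y d).toNat
            (y * d) u (n - u * (n / u)) : ℚ)) +
      MvPolynomial.eval ![(n : ℚ), (u : ℚ), (y : ℚ), (d : ℚ), (tCap u d : ℚ),
        (capEnd n u y d : ℚ), (tDiag n u y d : ℚ)] outerCorrection := by
  obtain ⟨hu, -, hy, hyn, hdu, -⟩ := h
  have hd : 1 ≤ d := Nat.pos_of_dvd_of_pos hdu hu
  have hyd : 0 < y * d := Nat.mul_pos hy hd
  have huX : u * (n / u) ≤ n := Nat.mul_div_le n u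
  rw [outerTerm_eq_sum hu hy hd hyn, eval_outerCorrection]
  -- `k` is the number of capped x; the lower bound y - 1 in the definition of `capEnd` makes it 0
  -- when that zone is empty.
  obtain ⟨k, hk⟩ : ∃ k : ℕ, capEnd n u y d = (y : ℤ) + k - 1 := by
    obtain ⟨k, hk⟩ := Int.eq_ofNat_of_zero_le
      (sub_nonneg.2 (le_max_left ((y : ℤ) - 1) (((n : ℤ) - y * d * tCap u d) / (u : ℤ))))
    exact ⟨k, by rw [capEnd]; omega⟩
  have hcapX : (y : ℤ) + k - 1 ≤ (n / u : ℕ) := by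
    rw [← hk, capEnd, max_le_iff]
    refine ⟨by omega, ?_⟩
    push_cast
    exact Int.ediv_le_ediv (by omega) (by nlinarith [show 0 ≤ y * d * tCap u d by positivity])
  have hsplit : Finset.Icc y (n / u) = Finset.Ico y (y + k) ∪ Finset.Ico (y + k) (n / u + 1) := by
    ext x; simp; omega
  have hdisj : Disjoint (Finset.Ico y (y + k)) (Finset.Ico (y + k) (n / u + 1)) :=
    Finset.Ico_disjoint_Ico_consecutive _ _ _
  rw [hsplit, Finset.sum_union hdisj]
  have hcapped : ∑ x ∈ Finset.Ico y (y + k), rectWeightSum n u y d x (tRange n u y d x) =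
      rectWeightSumSum n u y d (tCap u d) ((y : ℚ) + k - 1) := by
    rw [← sum_rectWeightSum]
    refine Finset.sum_congr rfl fun x hx => ?_
    rw [Finset.mem_Ico] at hx
    have hxc : (x : ℤ) ≤ ((n : ℤ) - y * d * tCap u d) / (u : ℤ) := by
      have hmax := hk
      rw [capEnd] at hmax
      rcases max_choice ((y : ℤ) - 1) (((n : ℤ) - y * d * tCap u d) / (u : ℤ)) with h | h <;>
      · rw [h] at hmax; omega
    rw [Int.le_ediv_iff_mul_le (by omega)] at hxc
    have hxc' : tCap u d * (y * d) + x * u ≤ n := by zify; linarith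
    have : tRange n u y d x = tCap u d := by
      rw [tRange, min_eq_left]
      rw [Nat.le_div_iff_mul_le hyd]
      omega
    rw [this]
  have hactive : 4 * ∑ x ∈ Finset.Ico (y + k) (n / u + 1),
      rectWeightSum n u y d x (tRange n u y d x) = ∑ i ∈ tenStates,
        MvPolynomial.eval ![(n : ℚ), (u : ℚ), (y : ℚ), (d : ℚ), ((n / u : ℕ) : ℚ)] (outerCoeff i) *
          (floorMoment i.1 i.2 (n / u + 1 - (y + k)) (y * d) u (n - u * (n / u)) : ℚ) := by
    simp only [floorMoment, Nat.cast_sum, Finset.mul_sum]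
    rw [Finset.sum_comm]
    symm
    refine Finset.sum_bij' (fun i _ => n / u - i) (fun x _ => n / u - x) ?_ ?_ ?_ ?_ ?_
    · intro i hi; rw [Finset.mem_range] at hi; rw [Finset.mem_Ico]; omega
    · intro x hx; rw [Finset.mem_Ico] at hx; rw [Finset.mem_range]; omega
    · intro i hi; rw [Finset.mem_range] at hi; omega
    · intro x hx; rw [Finset.mem_Ico] at hx; omega
    · intro i hi
      rw [Finset.mem_range] at hi
      have hiX : i ≤ n / u := by omega
      have hmul : (n / u - i) * u + u * i = u * (n / u) := by
        rw [mul_comm _ u, ← mul_add]; congr 1; omega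
      have hxc : ((n : ℤ) - y * d * tCap u d) / (u : ℤ) < ((n / u - i : ℕ) : ℤ) := by
        have := le_max_right ((y : ℤ) - 1) (((n : ℤ) - y * d * tCap u d) / (u : ℤ))
        rw [← capEnd, hk] at this
        omega
      rw [Int.ediv_lt_iff_lt_mul (by omega)] at hxc
      have hxc' : n < tCap u d * (y * d) + (n / u - i) * u := by
        zify at hxc ⊢; linarith
      -- Beyond `capEnd` the cap is not attained, so the minimum is the floor, and n - xu is
      -- rewritten with x = X - i.
      have hT : tRange n u y d (n / u - i) = (u * i + (n - u * (n / u))) / (y * d) := by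
        rw [tRange, min_eq_right]
        · congr 1; omega
        · rw [Nat.div_le_iff_le_mul_add_pred hyd]
          have : tCap u d * (y * d) = y * d * tCap u d := mul_comm _ _
          omega
      rw [hT, Nat.cast_sub hiX, outerCoeff_expand]
      push_cast
      rfl
  have hN : (((n / u : ℕ) : ℤ) - capEnd n u y d).toNat = n / u + 1 - (y + k) := by
    rw [hk]; omega
  rw [hN, ← hactive, mul_add, hcapped, hk]
  push_cast
  ring

/-! ### Execution of random access programs -/

namespace RAM

/-- All registers and all memory cells have absolute value at most `B`. -/
def State.Bdd (B : ℕ) (s : State) : Prop :=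
  (∀ r, |s.reg r| ≤ B) ∧ ∀ a i, |s.mem a i| ≤ B

theorem State.Bdd.mono {B B' : ℕ} {s : State} (h : s.Bdd B) (hB : B ≤ B') : s.Bdd B' :=
  ⟨fun r => (h.1 r).trans (by exact_mod_cast hB), fun a i => (h.2 a i).trans (by exact_mod_cast hB)⟩

theorem State.Bdd.setReg {B : ℕ} {s : State} (h : s.Bdd B) (r : ℕ) {v : ℤ} (hv : |v| ≤ B) :
    (s.setReg r v).Bdd B := by
  refine ⟨fun r' => ?_, h.2⟩
  by_cases hr : r' = r
  · subst hr; simpa [State.setReg] using hv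
  · simpa [State.setReg, Function.update_of_ne hr] using h.1 r'

theorem State.Bdd.setMem {B : ℕ} {s : State} (h : s.Bdd B) (a i : ℕ) {v : ℤ} (hv : |v| ≤ B) :
    (s.setMem a i v).Bdd B := by
  refine ⟨h.1, fun a' i' => ?_⟩
  by_cases ha : a' = a
  · subst ha
    by_cases hi : i' = i
    · subst hi; simpa [State.setMem] using hv
    · simpa [State.setMem, Function.update_of_ne hi] using h.2 a' i'
  · simpa [State.setMem, Function.update_of_ne ha] using h.2 a' i'

theorem State.setReg_reg (s : State) (r r' : ℕ) (v : ℤ) :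
    (s.setReg r v).reg r' = if r' = r then v else s.reg r' := by
  simp [State.setReg, Function.update_apply]

theorem State.setReg_mem (s : State) (r : ℕ) (v : ℤ) : (s.setReg r v).mem = s.mem := rfl

theorem State.setMem_reg (s : State) (a i : ℕ) (v : ℤ) : (s.setMem a i v).reg = s.reg := rfl

theorem State.setMem_mem (s : State) (a a' i i' : ℕ) (v : ℤ) :
    (s.setMem a i v).mem a' i' = if a' = a ∧ i' = i then v else s.mem a' i' := by
  by_cases ha : a' = a
  · subst ha; simp [State.setMem, Function.update_apply]
  · simp [State.setMem, ha]

/-- Divisors are positive and addresses are below `S`. -/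
def Expr.Safe (S : ℕ) (s : State) : Expr → Prop
  | .const _ => True
  | .reg _ => True
  | .load _ i => i.Safe S s ∧ 0 ≤ i.val s ∧ i.val s < S
  | .add e f => e.Safe S s ∧ f.Safe S s
  | .sub e f => e.Safe S s ∧ f.Safe S s
  | .mul e f => e.Safe S s ∧ f.Safe S s
  | .div e f => e.Safe S s ∧ f.Safe S s ∧ 0 < f.val s

/-- An exponent that bounds the growth of the evaluation of an expression. -/
def Expr.weight : Expr → ℕ
  | .const z => z.natAbs + 1
  | .reg _ => 1
  | .load _ i => i.weight + 1
  | .add e f => e.weight + f.weight + 1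
  | .sub e f => e.weight + f.weight + 1
  | .mul e f => e.weight + f.weight + 1
  | .div e f => e.weight + f.weight + 1

theorem Expr.one_le_weight (e : Expr) : 1 ≤ e.weight := by
  cases e <;> simp [Expr.weight]

theorem Expr.Ok.mono {S S' W W' : ℕ} (hS : S ≤ S') (hW : W ≤ W') {s : State} {e : Expr}
    (h : e.Ok S W s) : e.Ok S' W' s := by
  have hW' : (W : ℤ) ≤ W' := by exact_mod_cast hW
  have hS' : (S : ℤ) ≤ S' := by exact_mod_cast hS
  induction e with
  | const z => exact le_trans h hW'
  | reg r => exact le_trans h hW'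
  | load a i ih => exact ⟨ih h.1, h.2.1, h.2.2.1.trans_le hS', h.2.2.2.trans hW'⟩
  | add e f ihe ihf => exact ⟨ihe h.1, ihf h.2.1, h.2.2.trans hW'⟩
  | sub e f ihe ihf => exact ⟨ihe h.1, ihf h.2.1, h.2.2.trans hW'⟩
  | mul e f ihe ihf => exact ⟨ihe h.1, ihf h.2.1, h.2.2.trans hW'⟩
  | div e f ihe ihf => exact ⟨ihe h.1, ihf h.2.1, h.2.2.1, h.2.2.2.trans hW'⟩

theorem Exec.mono {S S' W W' : ℕ} (hS : S ≤ S') (hW : W ≤ W') {c : Cmd} {s s' : State} {k : ℕ}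
    (h : Exec S W c s k s') : Exec S' W' c s k s' := by
  induction h with
  | skip s => exact .skip s
  | set s r e he => exact .set s r e (he.mono hS hW)
  | store s a i e hi he h0 h1 =>
    exact .store s a i e (hi.mono hS hW) (he.mono hS hW) h0 (h1.trans_le (by exact_mod_cast hS))
  | seq _ _ h₁ h₂ => exact .seq h₁ h₂
  | ite_true he h _ h₁ => exact .ite_true (he.mono hS hW) h h₁
  | ite_false he h _ h₁ => exact .ite_false (he.mono hS hW) h h₁
  | loop_done he h => exact .loop_done (he.mono hS hW) h
  | loop_step he h _ _ h₁ h₂ => exact .loop_step (he.mono hS hW) h h₁ h₂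

theorem abs_ediv_le_abs (x y : ℤ) (hy : 0 < y) : |x / y| ≤ |x| := by
  rw [abs_le]
  constructor
  · rw [Int.le_ediv_iff_mul_le hy]
    nlinarith [neg_abs_le x, abs_nonneg x]
  · exact Int.ediv_le_of_le_mul hy (by nlinarith [le_abs_self x, abs_nonneg x])

/-- With B ≥ 2 one additional power of B absorbs the doubling in a sum; this is the reason for the
summand 1 in `Expr.weight`. -/
theorem pow_add_pow_le {B a b : ℕ} (hB : 2 ≤ B) : B ^ a + B ^ b ≤ B ^ (a + b + 1) := by
  have h1 : B ^ a ≤ B ^ (a + b) := Nat.pow_le_pow_right (by omega) (by omega)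
  have h2 : B ^ b ≤ B ^ (a + b) := Nat.pow_le_pow_right (by omega) (by omega)
  calc B ^ a + B ^ b ≤ 2 * B ^ (a + b) := by omega
    _ ≤ B * B ^ (a + b) := Nat.mul_le_mul_right _ hB
    _ = B ^ (a + b + 1) := by ring

/-- The evaluation of a safe expression on a bounded state stays within a power of the bound. -/
theorem Expr.Safe.ok_and_le {S B : ℕ} (hB : 2 ≤ B) {s : State} (hs : s.Bdd B) {e : Expr}
    (h : e.Safe S s) : e.Ok S (B ^ e.weight) s ∧ |e.val s| ≤ (B ^ e.weight : ℕ) := by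
  have pm : ∀ {a b : ℕ}, a ≤ b → B ^ a ≤ B ^ b := fun h => Nat.pow_le_pow_right (by omega) h
  have pz : ∀ {a b : ℕ}, a ≤ b → ((B ^ a : ℕ) : ℤ) ≤ (B ^ b : ℕ) :=
    fun h => by exact_mod_cast pm h
  have p1 : (B : ℤ) ≤ (B ^ 1 : ℕ) := by simp
  induction e with
  | const z =>
    have : |z| ≤ (B ^ (z.natAbs + 1) : ℕ) := by
      rw [Int.abs_eq_natAbs]
      have h1 : z.natAbs < 2 ^ z.natAbs := Nat.lt_two_pow_self
      have h2 : 2 ^ z.natAbs ≤ B ^ z.natAbs := Nat.pow_le_pow_left hB _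
      have h3 := pm (Nat.le_succ z.natAbs)
      exact_mod_cast (h1.le.trans h2).trans h3
    exact ⟨this, this⟩
  | reg r =>
    have : |s.reg r| ≤ (B ^ 1 : ℕ) := (hs.1 r).trans p1
    exact ⟨this, this⟩
  | load a i ih =>
    have hm : |s.mem a (i.val s).toNat| ≤ (B ^ (i.weight + 1) : ℕ) :=
      ((hs.2 _ _).trans p1).trans (pz (by omega))
    exact ⟨⟨(ih h.1).1.mono le_rfl (pm (by simp [Expr.weight])), h.2.1, h.2.2, hm⟩, hm⟩
  | add e f ihe ihf =>
    have h1 := ihe h.1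
    have h2 := ihf h.2
    have hb : |e.val s + f.val s| ≤ (B ^ (e.weight + f.weight + 1) : ℕ) :=
      (abs_add_le _ _).trans ((add_le_add h1.2 h2.2).trans (by exact_mod_cast pow_add_pow_le hB))
    exact ⟨⟨h1.1.mono le_rfl (pm (by simp [Expr.weight]; omega)),
      h2.1.mono le_rfl (pm (by simp [Expr.weight]; omega)), hb⟩, hb⟩
  | sub e f ihe ihf =>
    have h1 := ihe h.1
    have h2 := ihf h.2
    have hb : |e.val s - f.val s| ≤ (B ^ (e.weight + f.weight + 1) : ℕ) :=
      (abs_sub _ _).trans ((add_le_add h1.2 h2.2).trans (by exact_mod_cast pow_add_pow_le hB))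
    exact ⟨⟨h1.1.mono le_rfl (pm (by simp [Expr.weight]; omega)),
      h2.1.mono le_rfl (pm (by simp [Expr.weight]; omega)), hb⟩, hb⟩
  | mul e f ihe ihf =>
    have h1 := ihe h.1
    have h2 := ihf h.2
    have hb : |e.val s * f.val s| ≤ (B ^ (e.weight + f.weight + 1) : ℕ) := by
      rw [abs_mul]
      refine (mul_le_mul h1.2 h2.2 (abs_nonneg _) (by positivity)).trans ?_
      refine le_trans ?_ (pz (Nat.le_succ _))
      push_cast; rw [pow_add]
    exact ⟨⟨h1.1.mono le_rfl (pm (by simp [Expr.weight]; omega)),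
      h2.1.mono le_rfl (pm (by simp [Expr.weight]; omega)), hb⟩, hb⟩
  | div e f ihe ihf =>
    have h1 := ihe h.1
    have h2 := ihf h.2.1
    have hb : |e.val s / f.val s| ≤ (B ^ (e.weight + f.weight + 1) : ℕ) :=
      (abs_ediv_le_abs _ _ h.2.2).trans (h1.2.trans (pz (by omega)))
    exact ⟨⟨h1.1.mono le_rfl (pm (by simp [Expr.weight]; omega)),
      h2.1.mono le_rfl (pm (by simp [Expr.weight]; omega)), h.2.2, hb⟩, hb⟩

theorem Expr.Safe.ok {S B W : ℕ} (hB : 2 ≤ B) {s : State} (hs : s.Bdd B) {e : Expr}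
    (h : e.Safe S s) (hW : B ^ e.weight ≤ W) : e.Ok S W s :=
  (h.ok_and_le hB hs).1.mono le_rfl hW

/-- Loop-free programs. -/
def Cmd.LoopFree : Cmd → Prop
  | .skip => True
  | .set _ _ => True
  | .store _ _ _ => True
  | .seq c₁ c₂ => c₁.LoopFree ∧ c₂.LoopFree
  | .ite _ c₁ c₂ => c₁.LoopFree ∧ c₂.LoopFree
  | .loop _ _ => False

/-- The final state of a loop-free program. -/
def Cmd.run : Cmd → State → State
  | .skip, s => s
  | .set r e, s => s.setReg r (e.val s)
  | .store a i e, s => s.setMem a (i.val s).toNat (e.val s)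
  | .seq c₁ c₂, s => c₂.run (c₁.run s)
  | .ite e c₁ c₂, s => if 0 < e.val s then c₁.run s else c₂.run s
  | .loop _ _, s => s

/-- A loop-free program only divides by positive integers and only uses addresses below `S`. -/
def Cmd.Safe (S : ℕ) : Cmd → State → Prop
  | .skip, _ => True
  | .set _ e, s => e.Safe S s
  | .store _ i e, s => i.Safe S s ∧ e.Safe S s ∧ 0 ≤ i.val s ∧ i.val s < S
  | .seq c₁ c₂, s => c₁.Safe S s ∧ c₂.Safe S (c₁.run s)
  | .ite e c₁ c₂, s => e.Safe S s ∧ (0 < e.val s → c₁.Safe S s) ∧ (¬ 0 < e.val s → c₂.Safe S s)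
  | .loop _ _, _ => True

/-- An upper bound for the time of a loop-free program. -/
def Cmd.size : Cmd → ℕ
  | .skip => 1
  | .set _ e => e.cost + 1
  | .store _ i e => i.cost + e.cost + 1
  | .seq c₁ c₂ => c₁.size + c₂.size
  | .ite e c₁ c₂ => e.cost + 1 + c₁.size + c₂.size
  | .loop e c => e.cost + 1 + c.size

/-- An exponent that bounds the growth of the integers in a loop-free program. -/
def Cmd.weight : Cmd → ℕ
  | .skip => 1
  | .set _ e => e.weight
  | .store _ i e => i.weight + e.weight
  | .seq c₁ c₂ => c₁.weight * c₂.weight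
  | .ite e c₁ c₂ => e.weight + c₁.weight + c₂.weight
  | .loop e c => e.weight + c.weight

theorem Cmd.one_le_weight (c : Cmd) : 1 ≤ c.weight := by
  induction c with
  | skip => simp [Cmd.weight]
  | set r e => exact e.one_le_weight
  | store a i e => have := e.one_le_weight; simp only [Cmd.weight]; omega
  | seq c₁ c₂ h₁ h₂ => exact Nat.mul_pos h₁ h₂
  | ite e c₁ c₂ h₁ h₂ => simp only [Cmd.weight]; omega
  | loop e c h => simp only [Cmd.weight]; omega

/-- The exponent depends on the program and not on the state, so a fixed body keeps polynomial word
size. All verification of straight-line code is thereby reduced to computing `Cmd.run` and checking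
`Cmd.Safe`. -/
theorem Cmd.exec_run {S : ℕ} {c : Cmd} (hc : c.LoopFree) {B : ℕ} (hB : 2 ≤ B) {s : State}
    (hs : s.Bdd B) (h : c.Safe S s) :
    (∃ k ≤ c.size, Exec S (B ^ c.weight) c s k (c.run s)) ∧ (c.run s).Bdd (B ^ c.weight) := by
  induction c generalizing s B with
  | skip => exact ⟨⟨1, le_rfl, .skip s⟩, hs.mono (by simp [Cmd.weight])⟩
  | set r e =>
    have he := Expr.Safe.ok_and_le hB hs h
    exact ⟨⟨_, le_rfl, .set s r e he.1⟩,
      (hs.mono (Nat.le_self_pow (by have := e.one_le_weight; simp only [Cmd.weight]; omega)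
        _)).setReg r he.2⟩
  | store a i e =>
    obtain ⟨h1, h2, h3, h4⟩ := h
    have hi := Expr.Safe.ok_and_le hB hs h1
    have he := Expr.Safe.ok_and_le hB hs h2
    have l1 : B ^ i.weight ≤ B ^ (i.weight + e.weight) :=
      Nat.pow_le_pow_right (by omega) (by omega)
    have l2 : B ^ e.weight ≤ B ^ (i.weight + e.weight) :=
      Nat.pow_le_pow_right (by omega) (by omega)
    refine ⟨⟨_, le_rfl, .store s a i e (hi.1.mono le_rfl l1) (he.1.mono le_rfl l2) h3 h4⟩, ?_⟩
    exact (hs.mono (Nat.le_self_pow (by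
      have := e.one_le_weight; simp only [Cmd.weight]; omega) _)).setMem a _
        (he.2.trans (by exact_mod_cast l2))
  | seq c₁ c₂ ih₁ ih₂ =>
    obtain ⟨⟨k₁, hk₁, e₁⟩, b₁⟩ := ih₁ hc.1 hB hs h.1
    have w1 := c₁.one_le_weight
    have w2 := c₂.one_le_weight
    have hB' : 2 ≤ B ^ c₁.weight := hB.trans (Nat.le_self_pow (by omega) _)
    obtain ⟨⟨k₂, hk₂, e₂⟩, b₂⟩ := ih₂ hc.2 hB' b₁ h.2
    -- The second command starts from the bound `B ^ c₁.weight`, which is why weights multiply under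
    -- composition.
    rw [← pow_mul] at e₂ b₂
    refine ⟨⟨k₁ + k₂, add_le_add hk₁ hk₂, .seq (e₁.mono le_rfl ?_) e₂⟩, b₂⟩
    exact Nat.pow_le_pow_right (by omega) (Nat.le_mul_of_pos_right _ w2)
  | ite e c₁ c₂ ih₁ ih₂ =>
    have he := Expr.Safe.ok_and_le hB hs h.1
    have l0 : B ^ e.weight ≤ B ^ (e.weight + c₁.weight + c₂.weight) :=
      Nat.pow_le_pow_right (by omega) (by omega)
    have l1 : B ^ c₁.weight ≤ B ^ (e.weight + c₁.weight + c₂.weight) :=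
      Nat.pow_le_pow_right (by omega) (by omega)
    have l2 : B ^ c₂.weight ≤ B ^ (e.weight + c₁.weight + c₂.weight) :=
      Nat.pow_le_pow_right (by omega) (by omega)
    by_cases hpos : 0 < e.val s
    · obtain ⟨⟨k₁, hk₁, e₁⟩, b₁⟩ := ih₁ hc.1 hB hs (h.2.1 hpos)
      simp only [Cmd.run, hpos, if_true]
      exact ⟨⟨_, by simp only [Cmd.size]; omega,
        .ite_true (he.1.mono le_rfl l0) hpos (e₁.mono le_rfl l1)⟩, b₁.mono l1⟩
    · obtain ⟨⟨k₁, hk₁, e₁⟩, b₁⟩ := ih₂ hc.2 hB hs (h.2.2 hpos)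
      simp only [Cmd.run, hpos, if_false]
      exact ⟨⟨_, by simp only [Cmd.size]; omega,
        .ite_false (he.1.mono le_rfl l0) hpos (e₁.mono le_rfl l2)⟩, b₁.mono l2⟩
  | loop e c => exact hc.elim

/-- `c`, started in `s`, halts within time `T` in a state with the property `Q`. -/
def Runs (S W T : ℕ) (c : Cmd) (s : State) (Q : State → Prop) : Prop :=
  ∃ s', RunsWithin T S W c s s' ∧ Q s'

theorem Runs.mono {S S' W W' T T' : ℕ} {c : Cmd} {s : State} {Q Q' : State → Prop}
    (h : Runs S W T c s Q) (hS : S ≤ S') (hW : W ≤ W') (hT : T ≤ T') (hQ : ∀ s', Q s' → Q' s') :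
    Runs S' W' T' c s Q' := by
  obtain ⟨s', ⟨k, hk, he⟩, hq⟩ := h
  exact ⟨s', ⟨k, hk.trans hT, he.mono hS hW⟩, hQ _ hq⟩

theorem Runs.seq {S W T₁ T₂ : ℕ} {c₁ c₂ : Cmd} {s : State} {Q : State → Prop}
    (h : Runs S W T₁ c₁ s fun s' => Runs S W T₂ c₂ s' Q) :
    Runs S W (T₁ + T₂) (.seq c₁ c₂) s Q := by
  obtain ⟨s', ⟨k, hk, he⟩, s'', ⟨k', hk', he'⟩, hq⟩ := h
  exact ⟨s'', ⟨k + k', add_le_add hk hk', .seq he he'⟩, hq⟩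

theorem Runs.seq_of {S W T₁ T₂ : ℕ} {c₁ c₂ : Cmd} {s : State} {P Q : State → Prop}
    (h₁ : Runs S W T₁ c₁ s P) (h₂ : ∀ s', P s' → Runs S W T₂ c₂ s' Q) :
    Runs S W (T₁ + T₂) (.seq c₁ c₂) s Q :=
  (h₁.mono le_rfl le_rfl le_rfl h₂).seq

theorem Runs.ite {S W T : ℕ} {e : Expr} {c₁ c₂ : Cmd} {s : State} {Q : State → Prop}
    (he : e.Ok S W s) (h₁ : 0 < e.val s → Runs S W T c₁ s Q)
    (h₂ : ¬ 0 < e.val s → Runs S W T c₂ s Q) :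
    Runs S W (e.cost + 1 + T) (.ite e c₁ c₂) s Q := by
  by_cases h : 0 < e.val s
  · obtain ⟨s', ⟨k, hk, hx⟩, hq⟩ := h₁ h
    exact ⟨s', ⟨_, Nat.add_le_add_left hk _, .ite_true he h hx⟩, hq⟩
  · obtain ⟨s', ⟨k, hk, hx⟩, hq⟩ := h₂ h
    exact ⟨s', ⟨_, Nat.add_le_add_left hk _, .ite_false he h hx⟩, hq⟩

theorem Runs.loopFree {S W B : ℕ} {c : Cmd} (hc : c.LoopFree) (hB : 2 ≤ B) {s : State}
    (hs : s.Bdd B) (h : c.Safe S s) (hW : B ^ c.weight ≤ W) {Q : State → Prop}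
    (hQ : Q (c.run s)) : Runs S W c.size c s Q := by
  obtain ⟨⟨k, hk, he⟩, -⟩ := Cmd.exec_run hc hB hs h
  exact ⟨_, ⟨k, hk, he.mono le_rfl hW⟩, hQ⟩

/-- A loop with an invariant `I`, indexed by the number of completed rounds, and at most `n`
rounds. -/
theorem Runs.loop {S W : ℕ} {e : Expr} {c : Cmd} (I : ℕ → State → Prop) (C : ℕ → ℕ) (n : ℕ)
    (hok : ∀ k s, I k s → e.Ok S W s)
    (hstep : ∀ k s, I k s → 0 < e.val s → k < n ∧ Runs S W (C k) c s (I (k + 1)))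
    {s : State} (h0 : I 0 s) :
    Runs S W (∑ j ∈ Finset.range n, (C j + (e.cost + 1)) + (e.cost + 1)) (.loop e c) s
      fun s' => ∃ k ≤ n, I k s' ∧ ¬ 0 < e.val s' := by
  -- The induction is on the fuel `i`, an upper bound for the rounds still to come; the time sum
  -- starts at the current round.
  suffices H : ∀ i k s, I k s → n ≤ k + i → k ≤ n →
      Runs S W (∑ j ∈ Finset.Ico k n, (C j + (e.cost + 1)) + (e.cost + 1)) (.loop e c) s
      fun s' => ∃ k ≤ n, I k s' ∧ ¬ 0 < e.val s' by
    rw [Finset.range_eq_Ico]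
    exact H n 0 s h0 (by omega) (by omega)
  intro i
  induction i with
  | zero =>
    intro k s hI hk hkn
    by_cases hpos : 0 < e.val s
    · have := (hstep k s hI hpos).1; omega
    · exact ⟨s, ⟨_, Nat.le_add_left _ _, .loop_done (hok k s hI) hpos⟩, k, hkn, hI, hpos⟩
  | succ i ih =>
    intro k s hI hk hkn
    by_cases hpos : 0 < e.val s
    · obtain ⟨hlt, s₁, ⟨t₁, ht₁, e₁⟩, hI₁⟩ := hstep k s hI hpos
      obtain ⟨s₂, ⟨t₂, ht₂, e₂⟩, hq⟩ := ih (k + 1) s₁ hI₁ (by omega) hlt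
      refine ⟨s₂, ⟨_, ?_, .loop_step (hok k s hI) hpos e₁ e₂⟩, hq⟩
      rw [Finset.sum_eq_sum_Ico_succ_bot hlt]
      omega
    · exact ⟨s, ⟨_, Nat.le_add_left _ _, .loop_done (hok k s hI) hpos⟩, k, hkn, hI, hpos⟩

/-! ### Polynomial expressions -/

/-- `f` is a polynomial function of the registers, with rational coefficients. -/
def IsPolyFn (f : (ℕ → ℚ) → ℚ) : Prop := ∃ p : MvPolynomial ℕ ℚ, ∀ v, MvPolynomial.eval v p = f v

theorem IsPolyFn.const (a : ℚ) : IsPolyFn fun _ => a := ⟨MvPolynomial.C a, by simp⟩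

theorem IsPolyFn.var (r : ℕ) : IsPolyFn fun v => v r := ⟨MvPolynomial.X r, by simp⟩

theorem IsPolyFn.add {f g : (ℕ → ℚ) → ℚ} (hf : IsPolyFn f) (hg : IsPolyFn g) :
    IsPolyFn fun v => f v + g v := by
  obtain ⟨p, hp⟩ := hf
  obtain ⟨q, hq⟩ := hg
  exact ⟨p + q, by simp [hp, hq]⟩

theorem IsPolyFn.mul {f g : (ℕ → ℚ) → ℚ} (hf : IsPolyFn f) (hg : IsPolyFn g) :
    IsPolyFn fun v => f v * g v := by
  obtain ⟨p, hp⟩ := hf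
  obtain ⟨q, hq⟩ := hg
  exact ⟨p * q, by simp [hp, hq]⟩

theorem IsPolyFn.pow {f : (ℕ → ℚ) → ℚ} (hf : IsPolyFn f) (k : ℕ) : IsPolyFn fun v => f v ^ k := by
  obtain ⟨p, hp⟩ := hf
  exact ⟨p ^ k, by simp [hp]⟩

theorem IsPolyFn.sum {ι : Type*} {f : ι → (ℕ → ℚ) → ℚ} {t : Finset ι}
    (hf : ∀ i ∈ t, IsPolyFn (f i)) : IsPolyFn fun v => ∑ i ∈ t, f i v := by
  classical
  induction t using Finset.induction_on with
  | empty => simpa using IsPolyFn.const 0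
  | insert a t ha ih =>
    simp only [Finset.sum_insert ha]
    exact (hf a (Finset.mem_insert_self a t)).add
      (ih fun i hi => hf i (Finset.mem_insert_of_mem hi))

theorem IsPolyFn.eval {k : ℕ} (p : MvPolynomial (Fin k) ℚ) {f : Fin k → (ℕ → ℚ) → ℚ}
    (hf : ∀ i, IsPolyFn (f i)) : IsPolyFn fun v => MvPolynomial.eval (fun i => f i v) p := by
  choose q hq using hf
  refine ⟨MvPolynomial.bind₁ q p, fun v => ?_⟩
  rw [MvPolynomial.eval, MvPolynomial.eval₂Hom_bind₁]
  change MvPolynomial.eval (fun i => MvPolynomial.eval v (q i)) p = _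
  simp only [hq]

/-- A polynomial function with rational coefficients is computed by an expression wherever its
value is an integer. -/
theorem IsPolyFn.exists_expr {f : (ℕ → ℚ) → ℚ} (hf : IsPolyFn f) :
    ∃ e : Expr, (∀ S s, e.Safe S s) ∧
      ∀ (s : State) (z : ℤ), f (fun r => s.reg r) = z → e.val s = z := by
  obtain ⟨p, hp⟩ := hf
  -- A common denominator `D` is carried along the construction of the polynomial; one final
  -- division by `D` is exact wherever the value is an integer.
  suffices H : ∃ (D : ℕ) (e : Expr), 0 < D ∧ (∀ S s, e.Safe S s) ∧
      ∀ s, (e.val s : ℚ) = D * MvPolynomial.eval (fun r => (s.reg r : ℚ)) p by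
    obtain ⟨D, e, hD, hsafe, he⟩ := H
    refine ⟨.div e (.const D), fun S s => ⟨hsafe S s, trivial, by simpa [Expr.val] using hD⟩,
      fun s z hz => ?_⟩
    have h1 : e.val s = D * z := by
      have := he s
      rw [hp, hz] at this
      exact_mod_cast this
    simp only [Expr.val, h1]
    exact Int.mul_ediv_cancel_left _ (by exact_mod_cast hD.ne')
  clear hp
  induction p using MvPolynomial.induction_on with
  | C a =>
    refine ⟨a.den, .const a.num, a.pos, fun S s => trivial, fun s => ?_⟩
    simp only [Expr.val, MvPolynomial.eval_C]
    exact (Rat.den_mul_eq_num a).symm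
  | add p q hp hq =>
    obtain ⟨D, e, hD, hs, he⟩ := hp
    obtain ⟨D', e', hD', hs', he'⟩ := hq
    refine ⟨D * D', .add (.mul (.const D') e) (.mul (.const D) e'), Nat.mul_pos hD hD',
      fun S s => ⟨⟨trivial, hs S s⟩, trivial, hs' S s⟩, fun s => ?_⟩
    simp only [Expr.val, map_add]
    push_cast
    rw [he, he']
    ring
  | mul_X p i hp =>
    obtain ⟨D, e, hD, hs, he⟩ := hp
    refine ⟨D, .mul e (.reg i), hD, fun S s => ⟨hs S s, trivial⟩, fun s => ?_⟩
    simp only [Expr.val, map_mul, MvPolynomial.eval_X]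
    push_cast
    rw [he]
    ring

/-! ### Parallel assignment -/

/-- Assign `e r` to the register `r`, for all `r` in the list. -/
def Cmd.setAll (e : ℕ → Expr) : List ℕ → Cmd
  | [] => .skip
  | r :: l => .seq (.set r (e r)) (Cmd.setAll e l)

theorem Cmd.setAll_loopFree (e : ℕ → Expr) (l : List ℕ) : (Cmd.setAll e l).LoopFree := by
  induction l with
  | nil => trivial
  | cons r l ih => exact ⟨trivial, ih⟩

theorem Cmd.setAll_safe {S : ℕ} {e : ℕ → Expr} (h : ∀ r s, (e r).Safe S s) (l : List ℕ) (s : State) :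
    (Cmd.setAll e l).Safe S s := by
  induction l generalizing s with
  | nil => trivial
  | cons r l ih => exact ⟨h r s, ih _⟩

/-- The assignments are sequential, but the hypothesis makes the values independent of the registers
being overwritten, so they act as a simultaneous assignment. -/
theorem Cmd.setAll_run {e : ℕ → Expr} {l : List ℕ} {z : ℕ → ℤ} {s : State}
    (h : ∀ s' : State, (∀ r, r ∉ l → s'.reg r = s.reg r) → ∀ r ∈ l, (e r).val s' = z r) :
    (Cmd.setAll e l).run s = ⟨fun r => if r ∈ l then z r else s.reg r, s.mem⟩ := by
  suffices H : ∀ (l' : List ℕ) (s' : State), l' ⊆ l → (∀ r, r ∉ l → s'.reg r = s.reg r) →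
      s'.mem = s.mem → (Cmd.setAll e l').run s' =
        ⟨fun r => if r ∈ l' then z r else s'.reg r, s.mem⟩ from
    H l s (List.Subset.refl _) (fun _ _ => rfl) rfl
  intro l'
  induction l' with
  | nil => intro s' _ _ hm; simp [Cmd.setAll, Cmd.run, ← hm]
  | cons r l' ih =>
    intro s' hsub hreg hmem
    have hr : r ∈ l := hsub (by simp)
    have hv := h s' hreg r hr
    simp only [Cmd.setAll, Cmd.run]
    rw [ih (s'.setReg r ((e r).val s')) (fun x hx => hsub (by simp [hx])) ?_ hmem, hv]
    · congr 1
      funext x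
      by_cases hx : x = r
      · subst hx; simp [State.setReg]
      · simp [State.setReg, hx]
    · intro x hx
      have : x ≠ r := fun h => hx (h ▸ hr)
      simp [State.setReg, Function.update_of_ne this, hreg x hx]

end RAM

/-! ### The Euclidean chain of a floor sum -/

/-- The parameters of a weighted floor sum. -/
structure FloorInst where
  N : ℕ
  m : ℕ
  a : ℕ
  b : ℕ

namespace FloorInst

/-- The moments of an instance. -/
def moment (q : FloorInst) (i : ℕ × ℕ) : ℕ := floorMoment i.1 i.2 q.N q.m q.a q.b

/-- The moments of the instance after the affine step. -/
def reducedMoment (q : FloorInst) (i : ℕ × ℕ) : ℕ :=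
  floorMoment i.1 i.2 q.N q.m (q.a % q.m) (q.b % q.m)

/-- The instance after an affine and a reciprocal step. -/
def next (q : FloorInst) : FloorInst where
  N := (q.a % q.m * (q.N - 1) + q.b % q.m) / q.m
  m := q.a % q.m
  a := q.m
  b := q.m - q.b % q.m - 1

/-- If the reduced slope is 0, every floor is ⌊(b mod m)/m⌋ = 0, so the next range is empty. Testing
the length therefore also protects against a zero modulus. -/
theorem one_le_next_m {q : FloorInst} (hm : 1 ≤ q.m) (h : 0 < q.next.N) : 1 ≤ q.next.m := by
  by_contra h0
  have h0' : q.a % q.m = 0 := by simpa [next] using h0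
  simp only [next, h0', zero_mul, zero_add] at h
  rw [Nat.div_eq_of_lt (Nat.mod_lt _ hm)] at h
  exact lt_irrefl _ h

theorem iterate_m_pos {q : FloorInst} (hm : 1 ≤ q.m) (k : ℕ)
    (h : ∀ j ≤ k, 0 < (next^[j] q).N) : 1 ≤ (next^[k] q).m := by
  induction k with
  | zero => exact hm
  | succ k ih =>
    have := h (k + 1) le_rfl
    rw [Function.iterate_succ_apply'] at this ⊢
    exact one_le_next_m (ih fun j hj => h j (by omega)) this

/-- With r = a mod m, the product m·r becomes r·(m mod r), and m mod r is at most m/2, because m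
contains at least one full copy of r besides the remainder. -/
theorem two_mul_next_potential_le (q : FloorInst) :
    2 * (q.next.m * (q.next.a % q.next.m)) ≤ q.m * (q.a % q.m) := by
  simp only [next]
  rcases Nat.eq_zero_or_pos (q.a % q.m) with h | h
  · simp [h]
  rcases Nat.eq_zero_or_pos q.m with h0 | h0
  · simp [h0]
  have h1 : q.a % q.m < q.m := Nat.mod_lt _ h0
  have h2 : q.m % (q.a % q.m) < q.a % q.m := Nat.mod_lt _ h
  have h3 := Nat.div_add_mod q.m (q.a % q.m)
  have h4 : 1 ≤ q.m / (q.a % q.m) := Nat.div_pos h1.le h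
  have h5 : 2 * (q.m % (q.a % q.m)) ≤ q.m := by nlinarith
  nlinarith

theorem iterate_potential_le (q : FloorInst) (k : ℕ) :
    2 ^ k * ((next^[k] q).m * ((next^[k] q).a % (next^[k] q).m)) ≤ q.m * (q.a % q.m) := by
  induction k with
  | zero => simp
  | succ k ih =>
    rw [Function.iterate_succ_apply']
    have := two_mul_next_potential_le (next^[k] q)
    calc _ = 2 ^ k * (2 * ((next^[k] q).next.m * ((next^[k] q).next.a % (next^[k] q).next.m))) := by
          ring
      _ ≤ _ := (Nat.mul_le_mul_left _ this).trans ih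

/-- The Euclidean chain has logarithmic length. -/
theorem lt_of_iterate_N_pos {q : FloorInst} (hm : 1 ≤ q.m) {k : ℕ}
    (h : ∀ j ≤ k, 0 < (next^[j] q).N) : k < 2 * Nat.log 2 q.m + 3 := by
  rcases k with _ | k
  · omega
  have hmk := iterate_m_pos hm k fun j hj => h j (by omega)
  have hnext := h (k + 1) le_rfl
  rw [Function.iterate_succ_apply'] at hnext
  -- A nonempty range at level k + 1 forces a nonzero remainder at level k, so the potential there
  -- is at least 1 and 2^k ≤ m².
  have hr : 1 ≤ (next^[k] q).a % (next^[k] q).m := one_le_next_m hmk hnext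
  have hpot := iterate_potential_le q k
  have h1 : 2 ^ k ≤ q.m * q.m := by
    calc 2 ^ k ≤ 2 ^ k * ((next^[k] q).m * ((next^[k] q).a % (next^[k] q).m)) :=
          Nat.le_mul_of_pos_right _ (Nat.mul_pos hmk hr)
      _ ≤ q.m * (q.a % q.m) := hpot
      _ ≤ q.m * q.m := Nat.mul_le_mul_left _ (Nat.mod_lt _ hm).le
  have h2 : q.m < 2 ^ (Nat.log 2 q.m + 1) := Nat.lt_pow_succ_log_self (by norm_num) _
  have h3 : 2 ^ k < 2 ^ (2 * (Nat.log 2 q.m + 1)) := by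
    calc 2 ^ k ≤ q.m * q.m := h1
      _ < 2 ^ (Nat.log 2 q.m + 1) * 2 ^ (Nat.log 2 q.m + 1) := Nat.mul_lt_mul'' h2 h2
      _ = _ := by ring
  have := (Nat.pow_lt_pow_iff_right (by norm_num : 1 < 2)).1 h3
  omega

/-- All parameters are at most `M`. -/
def Bounded (M : ℕ) (q : FloorInst) : Prop := q.N ≤ M ∧ q.m ≤ M ∧ q.a ≤ M ∧ q.b ≤ M

theorem Bounded.next {M : ℕ} {q : FloorInst} (h : q.Bounded M) : q.next.Bounded M := by
  obtain ⟨h1, h2, h3, h4⟩ := h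
  refine ⟨?_, (Nat.mod_le _ _).trans h3, h2, ?_⟩
  · simp only [FloorInst.next]
    rcases Nat.eq_zero_or_pos q.m with h0 | h0
    · simp [h0]
    rw [Nat.div_le_iff_le_mul_add_pred h0]
    have h5 : q.a % q.m < q.m := Nat.mod_lt _ h0
    have h6 : q.b % q.m < q.m := Nat.mod_lt _ h0
    have : q.a % q.m * (q.N - 1) ≤ q.m * M := Nat.mul_le_mul h5.le (by omega)
    omega
  · simp only [FloorInst.next]; omega

theorem Bounded.iterate {M : ℕ} {q : FloorInst} (h : q.Bounded M) (k : ℕ) :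
    (FloorInst.next^[k] q).Bounded M := by
  induction k with
  | zero => exact h
  | succ k ih => rw [Function.iterate_succ_apply']; exact ih.next

end FloorInst

theorem floorMoment_le {M N m a b : ℕ} (hN : N ≤ M) (ha : a ≤ M) (hb : b ≤ M)
    (hM : 1 ≤ M) {i : ℕ × ℕ} (hi : i ∈ tenStates) : floorMoment i.1 i.2 N m a b ≤ M ^ 9 := by
  -- Each floor is at most M² and there are at most M summands; the exponent p + 2q + 1 is largest
  -- for (p,q) = (0,4).
  have hi' : i.1 + i.2 * 2 + 1 ≤ 9 := by
    revert i; rw [forall_tenStates]; simp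
  have : ∀ x ∈ Finset.range N, x ^ i.1 * ((a * x + b) / m) ^ i.2 ≤ M ^ (i.1 + i.2 * 2) := by
    intro x hx
    rw [Finset.mem_range] at hx
    have h1 : (a * x + b) / m ≤ M ^ 2 := by
      refine (Nat.div_le_self _ _).trans ?_
      have : a * x ≤ M * (M - 1) := Nat.mul_le_mul ha (by omega)
      obtain ⟨M, rfl⟩ : ∃ k, M = k + 1 := ⟨M - 1, by omega⟩
      simp only [Nat.add_sub_cancel] at this
      nlinarith
    rw [pow_add, mul_comm i.2 2, pow_mul]
    exact Nat.mul_le_mul (Nat.pow_le_pow_left (by omega) _) (Nat.pow_le_pow_left h1 _)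
  calc floorMoment i.1 i.2 N m a b ≤ N * M ^ (i.1 + i.2 * 2) := by
        simpa [floorMoment] using Finset.sum_le_card_nsmul _ _ _ this
    _ ≤ M * M ^ (i.1 + i.2 * 2) := Nat.mul_le_mul_right _ hN
    _ = M ^ (i.1 + i.2 * 2 + 1) := by ring
    _ ≤ M ^ 9 := Nat.pow_le_pow_right hM hi'

namespace FloorInst

/-- The reciprocal step needs a positive slope. When the slope reduces to 0, all floors vanish and
the next length is 0, so the same formula holds as 0 = 0 and the program needs no case distinction.
-/
theorem reducedMoment_eq {q : FloorInst} (hm : 1 ≤ q.m) (hN : 1 ≤ q.N) (i : ℕ × ℕ)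
    (hi : i ∈ tenStates) :
    (q.reducedMoment i : ℚ) =
      (∑ j ∈ tenStates, -(powDiffCoeff i.2 j.1 * powerSumCoeff i.1 j.2) * (q.next.moment j : ℚ)) +
      (powerSum i.1 q.N : ℚ) * (q.next.N : ℚ) ^ i.2 +
      ∑ r ∈ Finset.range 5,
        -(powDiffCoeff i.2 r * powerSumCoeff i.1 0) * (powerSum r q.next.N : ℚ) := by
  rcases Nat.eq_zero_or_pos (q.a % q.m) with h | h
  · have hi2 : i.2 ≠ 0 := by
      revert i; rw [forall_tenStates]; simp
    have h0 : q.next.N = 0 := by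
      simp only [next, h, zero_mul, zero_add]
      exact Nat.div_eq_of_lt (Nat.mod_lt _ hm)
    have h1 : q.reducedMoment i = 0 := by
      simp only [reducedMoment, floorMoment, h, zero_mul, zero_add]
      rw [Nat.div_eq_of_lt (Nat.mod_lt _ hm)]
      simp [hi2]
    simp [h1, moment, floorMoment, powerSum, h0, hi2]
  · exact floorMoment_reciprocal i hi q.N q.m (q.a % q.m) (q.b % q.m) _ hN h
      (Nat.mod_lt _ hm) rfl

end FloorInst

/-- Faulhaber's polynomial for `powerSum`. -/
def faulhaber (r : ℕ) (x : ℚ) : ℚ :=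
  ∑ i ∈ Finset.range (r + 1), bernoulli i * (r + 1).choose i * x ^ (r + 1 - i) / (r + 1)

theorem faulhaber_natCast (r N : ℕ) : faulhaber r N = powerSum r N := by
  rw [powerSum, faulhaber, ← sum_range_pow]
  push_cast
  rfl

namespace RAM

theorem IsPolyFn.faulhaber {f : (ℕ → ℚ) → ℚ} (hf : IsPolyFn f) (r : ℕ) :
    IsPolyFn fun v => _root_.faulhaber r (f v) := by
  unfold _root_.faulhaber
  refine IsPolyFn.sum fun i _ => ?_
  simp only [div_eq_mul_inv]
  exact ((IsPolyFn.const _).mul (hf.pow _)).mul (IsPolyFn.const _)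

/-! ### The kernel program -/

/-- One step down the Euclidean chain. The instance is in the registers `20`–`23`, the depth `k`
in register `24`; the data for the way back are stored in the cells `k` of the arrays `4`–`7`. -/
def descendBody : Cmd :=
  .seq (.set 26 (.div (.reg 22) (.reg 21))) <|
  .seq (.set 27 (.div (.reg 23) (.reg 21))) <|
  .seq (.set 22 (.sub (.reg 22) (.mul (.reg 26) (.reg 21)))) <|
  .seq (.set 23 (.sub (.reg 23) (.mul (.reg 27) (.reg 21)))) <|
  .seq (.set 30 (.div (.add (.mul (.reg 22) (.sub (.reg 20) (.const 1))) (.reg 23)) (.reg 21))) <|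
  .seq (.store 4 (.reg 24) (.reg 20)) <|
  .seq (.store 5 (.reg 24) (.reg 26)) <|
  .seq (.store 6 (.reg 24) (.reg 27)) <|
  .seq (.store 7 (.reg 24) (.reg 30)) <|
  .seq (.set 20 (.reg 30)) <|
  .seq (.set 23 (.sub (.sub (.reg 21) (.reg 23)) (.const 1))) <|
  .seq (.set 30 (.reg 21)) <|
  .seq (.set 21 (.reg 22)) <|
  .seq (.set 22 (.reg 30)) <|
  .set 24 (.add (.reg 24) (.const 1))

/-- The registers `20`–`23` hold the instance `q`. -/
def State.HoldsInst (s : State) (q : FloorInst) : Prop :=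
  s.reg 20 = q.N ∧ s.reg 21 = q.m ∧ s.reg 22 = q.a ∧ s.reg 23 = q.b

/-- Symbolic execution matched with `FloorInst.next`. The integer differences N - 1 and m - (b mod
m) - 1 agree with the truncated ones because N ≥ 1 and b mod m < m. -/
theorem descendBody_run {s : State} {q : FloorInst} (hq : s.HoldsInst q) (hm : 1 ≤ q.m)
    (hN : 1 ≤ q.N) {k : ℕ} (hk : s.reg 24 = k) :
    descendBody.run s = (((((((((((((((s.setReg 26 (q.a / q.m : ℕ)).setReg 27
      (q.b / q.m : ℕ)).setReg 22 (q.a % q.m : ℕ)).setReg 23 (q.b % q.m : ℕ)).setReg 30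
      q.next.N).setMem 4 k q.N).setMem 5 k (q.a / q.m : ℕ)).setMem 6 k (q.b / q.m : ℕ)).setMem 7 k
      q.next.N).setReg 20 q.next.N).setReg 23 q.next.b).setReg 30 q.m).setReg 21
      q.next.m).setReg 22 q.next.a).setReg 24 (k + 1 : ℕ)) := by
  obtain ⟨h1, h2, h3, h4⟩ := hq
  have e1 : (q.a : ℤ) / q.m = (q.a / q.m : ℕ) := by simp
  have e2 : (q.b : ℤ) / q.m = (q.b / q.m : ℕ) := by simp
  have e3 : (q.a : ℤ) - (q.a / q.m : ℕ) * q.m = (q.a % q.m : ℕ) := by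
    have := Nat.div_add_mod q.a q.m
    zify at this ⊢; linarith
  have e4 : (q.b : ℤ) - (q.b / q.m : ℕ) * q.m = (q.b % q.m : ℕ) := by
    have := Nat.div_add_mod q.b q.m
    zify at this ⊢; linarith
  have e5 : (((q.a % q.m : ℕ) : ℤ) * ((q.N : ℤ) - 1) + (q.b % q.m : ℕ)) / q.m = q.next.N := by
    simp only [FloorInst.next]
    rw [Int.natCast_div]
    push_cast [Nat.cast_sub hN]
    rfl
  have e6 : (q.m : ℤ) - (q.b % q.m : ℕ) - 1 = q.next.b := by
    have := Nat.mod_lt q.b hm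
    simp only [FloorInst.next]
    omega
  have e7 : (k : ℤ) + 1 = (k + 1 : ℕ) := by simp
  simp only [descendBody, Cmd.run, Expr.val, State.setReg_reg, State.setMem_reg, h1, h2, h3, h4, hk,
    Nat.reduceEqDiff, if_true, if_false, Int.toNat_natCast, e1, e2, e3, e4,
    e5, e6, e7]
  rfl

theorem abs_natCast_le {k B : ℕ} (h : k ≤ B) : |(k : ℤ)| ≤ B := by
  rw [Nat.abs_cast]; exact_mod_cast h

/-- The state after `k` steps down the chain of `q`, started in `s₀`. -/
structure DescendInv (B : ℕ) (s₀ : State) (q : FloorInst) (k : ℕ) (s : State) : Prop where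
  inst : s.HoldsInst (FloorInst.next^[k] q)
  depth : s.reg 24 = k
  bdd : s.Bdd B
  pos : ∀ j < k, 0 < (FloorInst.next^[j] q).N
  stack : ∀ j < k, s.mem 4 j = (FloorInst.next^[j] q).N ∧
    s.mem 5 j = ((FloorInst.next^[j] q).a / (FloorInst.next^[j] q).m : ℕ) ∧
    s.mem 6 j = ((FloorInst.next^[j] q).b / (FloorInst.next^[j] q).m : ℕ) ∧
    s.mem 7 j = (FloorInst.next^[j + 1] q).N
  reg_eq : ∀ r, 200 ≤ r → s.reg r = s₀.reg r
  mem_eq : ∀ a < 4, s.mem a = s₀.mem a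

theorem descendBody_step {S B M : ℕ} {s₀ s : State} {q : FloorInst} {k : ℕ}
    (hqM : q.Bounded M) (hMB : M ≤ B) (hSB : k + 1 ≤ B) (hm : 1 ≤ q.m) (hkS : k < S)
    (h : DescendInv B s₀ q k s) (hN : 0 < (FloorInst.next^[k] q).N) :
    descendBody.Safe S s ∧ DescendInv B s₀ q (k + 1) (descendBody.run s) := by
  -- The modulus is positive on every level that is reached, since all lengths up to this level are
  -- positive; this makes the divisions safe.
  have hmk := FloorInst.iterate_m_pos hm k fun j hj => by
    rcases hj.lt_or_eq with hj | rfl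
    exacts [h.pos j hj, hN]
  have hb := hqM.iterate k
  have hb' := hb.next
  have hit : FloorInst.next^[k + 1] q = (FloorInst.next^[k] q).next :=
    Function.iterate_succ_apply' _ _ _
  have hstack := h.stack
  have hinst := h.inst
  generalize hp : FloorInst.next^[k] q = p at *
  have hrun := descendBody_run hinst hmk hN h.depth
  refine ⟨?_, ?_⟩
  · obtain ⟨h1, h2, h3, h4⟩ := hinst
    simp [descendBody, Cmd.Safe, Cmd.run, Expr.Safe, Expr.val, State.setReg_reg, State.setMem_reg,
      h2, h.depth]
    omega
  · rw [hrun]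
    obtain ⟨b1, b2, b3, b4⟩ := hb
    obtain ⟨c1, c2, c3, c4⟩ := hb'
    constructor
    · rw [hit]
      simp [State.HoldsInst, State.setReg_reg]
    · simp [State.setReg_reg]
    · have d1 := (Nat.div_le_self p.a p.m)
      have d2 := (Nat.div_le_self p.b p.m)
      have d3 := (Nat.mod_le p.a p.m)
      have d4 := (Nat.mod_le p.b p.m)
      have hbdd := h.bdd
      repeat' first | apply State.Bdd.setReg | apply State.Bdd.setMem
      any_goals exact hbdd
      all_goals exact abs_natCast_le (by omega)
    · intro j hj
      rcases Nat.lt_succ_iff_lt_or_eq.1 hj with hj | rfl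
      · exact h.pos j hj
      · rw [hp]; exact hN
    · intro j hj
      rcases Nat.lt_succ_iff_lt_or_eq.1 hj with hj | rfl
      · have := hstack j hj
        simpa [State.setReg_mem, State.setMem_mem, hj.ne] using this
      · rw [hit, hp]
        simp [State.setReg_mem, State.setMem_mem]
    · intro r hr
      rw [← h.reg_eq r hr]
      simp only [State.setReg_reg, State.setMem_reg]
      repeat rw [if_neg (by omega)]
    · intro a ha
      rw [← h.mem_eq a ha]
      funext i
      simp only [State.setReg_mem, State.setMem_mem]
      repeat rw [if_neg (by omega)]

/-- The reciprocal step as a function of the registers: the moments of the next instance are in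
the registers `5 * p + q`, its length is in register `30`, and the length of the current instance
in register `31`. -/
def reciprocalFn (i : ℕ × ℕ) (v : ℕ → ℚ) : ℚ :=
  ∑ j ∈ tenStates, -(powDiffCoeff i.2 j.1 * powerSumCoeff i.1 j.2) * v (5 * j.1 + j.2) +
    faulhaber i.1 (v 31) * v 30 ^ i.2 +
    ∑ r ∈ Finset.range 5, -(powDiffCoeff i.2 r * powerSumCoeff i.1 0) * faulhaber r (v 30)

/-- The affine step as a function of the registers: the reduced moments are in the registers
`100 + (5 * p + q)`, the quotients in the registers `26` and `27`, the length in register `31`. -/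
noncomputable def affineFn (i : ℕ × ℕ) (v : ℕ → ℚ) : ℚ :=
  ∑ j ∈ tenStates,
    MvPolynomial.eval ![v 26, v 27] (affineCoeff i j) * v (100 + (5 * j.1 + j.2)) +
    ∑ r ∈ Finset.range 5,
      MvPolynomial.eval ![v 26, v 27] (affineCoeff i (r, 0)) * faulhaber r (v 31)

theorem reciprocalFn_isPolyFn (i : ℕ × ℕ) : IsPolyFn (reciprocalFn i) :=
  ((IsPolyFn.sum fun _ _ => (IsPolyFn.const _).mul (IsPolyFn.var _)).add
    (((IsPolyFn.var 31).faulhaber _).mul ((IsPolyFn.var 30).pow _))).add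
    (IsPolyFn.sum fun _ _ => (IsPolyFn.const _).mul ((IsPolyFn.var 30).faulhaber _))

theorem affineFn_isPolyFn (i : ℕ × ℕ) : IsPolyFn (affineFn i) := by
  have h : ∀ p : MvPolynomial (Fin 2) ℚ, IsPolyFn fun v => MvPolynomial.eval ![v 26, v 27] p := by
    intro p
    have := IsPolyFn.eval p (f := ![fun v => v 26, fun v => v 27])
      (by intro i; fin_cases i <;> exact IsPolyFn.var _)
    have hv : ∀ v : ℕ → ℚ, ![v 26, v 27] =
        fun i => (![fun v => v 26, fun v => v 27] : Fin 2 → (ℕ → ℚ) → ℚ) i v := by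
      intro v; ext i; fin_cases i <;> rfl
    simpa only [hv] using this
  exact (IsPolyFn.sum fun _ _ => (h _).mul (IsPolyFn.var _)).add
    (IsPolyFn.sum fun _ _ => (h _).mul ((IsPolyFn.var 31).faulhaber _))

/-- An expression for the reciprocal step. -/
noncomputable def reciprocalExpr (i : ℕ × ℕ) : Expr := (reciprocalFn_isPolyFn i).exists_expr.choose

/-- An expression for the affine step. -/
noncomputable def affineExpr (i : ℕ × ℕ) : Expr := (affineFn_isPolyFn i).exists_expr.choose

theorem reciprocalExpr_val {s : State} {q : FloorInst} (hm : 1 ≤ q.m) (hN : 1 ≤ q.N)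
    (h31 : s.reg 31 = q.N) (h30 : s.reg 30 = q.next.N)
    (hH : ∀ j ∈ tenStates, s.reg (5 * j.1 + j.2) = q.next.moment j) {i : ℕ × ℕ}
    (hi : i ∈ tenStates) : (reciprocalExpr i).val s = q.reducedMoment i := by
  refine (reciprocalFn_isPolyFn i).exists_expr.choose_spec.2 s _ ?_
  rw [Int.cast_natCast, FloorInst.reducedMoment_eq hm hN i hi, reciprocalFn, h31, h30]
  simp only [Int.cast_natCast, faulhaber_natCast]
  rw [Finset.sum_congr rfl fun j hj => by rw [hH j hj, Int.cast_natCast]]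

theorem affineExpr_val {s : State} {q : FloorInst} (hm : 1 ≤ q.m)
    (h31 : s.reg 31 = q.N) (h26 : s.reg 26 = (q.a / q.m : ℕ)) (h27 : s.reg 27 = (q.b / q.m : ℕ))
    (hG : ∀ j ∈ tenStates, s.reg (100 + (5 * j.1 + j.2)) = q.reducedMoment j) {i : ℕ × ℕ}
    (hi : i ∈ tenStates) : (affineExpr i).val s = q.moment i := by
  refine (affineFn_isPolyFn i).exists_expr.choose_spec.2 s _ ?_
  rw [Int.cast_natCast, FloorInst.moment, floorMoment_affine i hi _ _ _ _ hm, affineFn, h31, h26,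
    h27]
  simp only [Int.cast_natCast, faulhaber_natCast]
  rw [Finset.sum_congr rfl fun j hj => by rw [hG j hj, Int.cast_natCast]]
  rfl

/-- The registers of the ten moments. -/
def momentRegs : List ℕ := [1, 2, 3, 4, 6, 7, 8, 11, 12, 16]

theorem decode_mem_tenStates : ∀ r ∈ momentRegs, (r / 5, r % 5) ∈ tenStates := by decide

theorem encode_mem_momentRegs : ∀ i ∈ tenStates, 5 * i.1 + i.2 ∈ momentRegs := by decide

theorem decode_encode : ∀ i ∈ tenStates, ((5 * i.1 + i.2) / 5, (5 * i.1 + i.2) % 5) = i := by decide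

theorem le_of_mem_momentRegs : ∀ r ∈ momentRegs, r ≤ 16 := by decide

/-- Load the data of the last level of the stack. -/
def ascendLoad : Cmd :=
  .seq (.set 24 (.sub (.reg 24) (.const 1))) <|
  .seq (.set 31 (.load 4 (.reg 24))) <|
  .seq (.set 26 (.load 5 (.reg 24))) <|
  .seq (.set 27 (.load 6 (.reg 24))) <|
  .set 30 (.load 7 (.reg 24))

/-- One step up the Euclidean chain. -/
noncomputable def ascendBody : Cmd :=
  .seq ascendLoad <|
  .seq (.setAll (fun r => reciprocalExpr ((r - 100) / 5, (r - 100) % 5))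
    (momentRegs.map (100 + ·))) <|
  .setAll (fun r => affineExpr (r / 5, r % 5)) momentRegs

theorem ascendBody_loopFree : ascendBody.LoopFree :=
  ⟨⟨trivial, trivial, trivial, trivial, trivial⟩, Cmd.setAll_loopFree _ _,
    Cmd.setAll_loopFree _ _⟩

theorem ascendBody_safe {S : ℕ} {s : State} {k : ℕ} (hk : s.reg 24 = (k + 1 : ℕ)) (hkS : k < S) :
    ascendBody.Safe S s := by
  refine ⟨?_, Cmd.setAll_safe (fun r s => ?_) _ _, Cmd.setAll_safe (fun r s => ?_) _ _⟩
  · simp [ascendLoad, Cmd.Safe, Cmd.run, Expr.Safe, Expr.val, State.setReg_reg, hk, hkS]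
  · exact (reciprocalFn_isPolyFn _).exists_expr.choose_spec.1 S s
  · exact (affineFn_isPolyFn _).exists_expr.choose_spec.1 S s

/-- The reduced moments are kept at an offset of 100 so that neither of the two blocks of
assignments reads a register it writes, as `Cmd.setAll_run` requires. -/
theorem ascendBody_run {s : State} {q : FloorInst} (hm : 1 ≤ q.m) (hN : 1 ≤ q.N) {k : ℕ}
    (hk : s.reg 24 = (k + 1 : ℕ)) (h4 : s.mem 4 k = q.N) (h5 : s.mem 5 k = (q.a / q.m : ℕ))
    (h6 : s.mem 6 k = (q.b / q.m : ℕ)) (h7 : s.mem 7 k = q.next.N)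
    (hH : ∀ j ∈ tenStates, s.reg (5 * j.1 + j.2) = q.next.moment j) :
    ascendBody.run s = ⟨fun r => if r ∈ momentRegs then q.moment (r / 5, r % 5) else
      if r ∈ momentRegs.map (100 + ·) then q.reducedMoment ((r - 100) / 5, (r - 100) % 5) else
      if r = 30 then q.next.N else if r = 27 then (q.b / q.m : ℕ) else
      if r = 26 then (q.a / q.m : ℕ) else if r = 31 then q.N else if r = 24 then k else s.reg r,
      s.mem⟩ := by
  have hload : ascendLoad.run s = ((((s.setReg 24 k).setReg 31 q.N).setReg 26
      (q.a / q.m : ℕ)).setReg 27 (q.b / q.m : ℕ)).setReg 30 q.next.N := by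
    have e : ((k + 1 : ℕ) : ℤ) - 1 = k := by simp
    simp only [ascendLoad, Cmd.run, Expr.val, State.setReg_reg, State.setReg_mem, hk, e,
      Nat.reduceEqDiff, if_true, if_false, Int.toNat_natCast, h4, h5, h6, h7]
  have hG : ∀ r ∈ momentRegs.map (100 + ·), 101 ≤ r ∧ r ≤ 116 := by decide
  simp only [ascendBody, Cmd.run, hload]
  rw [Cmd.setAll_run (l := momentRegs.map (100 + ·))
      (z := fun r => q.reducedMoment ((r - 100) / 5, (r - 100) % 5)),
    Cmd.setAll_run (z := fun r => q.moment (r / 5, r % 5))]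
  · simp only [State.setReg_reg, State.setReg_mem]
  · intro s' hs' r hr
    have hs'' : ∀ r, 17 ≤ r → s'.reg r = _ := fun r h =>
      hs' r fun h' => by have := le_of_mem_momentRegs r h'; omega
    refine affineExpr_val hm ?_ ?_ ?_ ?_ (decode_mem_tenStates r hr)
    · rw [hs'' _ (by norm_num)]; rfl
    · rw [hs'' _ (by norm_num)]; rfl
    · rw [hs'' _ (by norm_num)]; rfl
    · intro j hj
      rw [hs'' _ (by omega)]
      have hmem : 100 + (5 * j.1 + j.2) ∈ momentRegs.map (100 + ·) :=
        List.mem_map_of_mem (encode_mem_momentRegs j hj)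
      simp only [hmem, if_true, Nat.add_sub_cancel_left, decode_encode j hj]
  · intro s' hs' r hr
    have hs'' : ∀ r, r ≤ 99 → s'.reg r = _ := fun r h =>
      hs' r fun h' => by have := hG r h'; omega
    obtain ⟨t, ht, rfl⟩ := List.mem_map.1 hr
    rw [Nat.add_sub_cancel_left]
    refine reciprocalExpr_val hm hN ?_ ?_ ?_ (decode_mem_tenStates t ht)
    · rw [hs'' _ (by norm_num)]; simp [State.setReg_reg]
    · rw [hs'' _ (by norm_num)]; simp [State.setReg_reg]
    · intro j hj
      have := le_of_mem_momentRegs _ (encode_mem_momentRegs j hj)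
      rw [hs'' _ (by omega), ← hH j hj]
      simp only [State.setReg_reg]
      repeat rw [if_neg (by omega)]

/-- The state after `j` steps up the chain of `q` from the level `L`. -/
structure AscendInv (B : ℕ) (s₀ : State) (q : FloorInst) (L j : ℕ) (s : State) : Prop where
  le : j ≤ L
  depth : s.reg 24 = (L - j : ℕ)
  moments : ∀ i ∈ tenStates, s.reg (5 * i.1 + i.2) = (FloorInst.next^[L - j] q).moment i
  bdd : s.Bdd B
  mem_eq : s.mem = s₀.mem
  reg_eq : ∀ r, 200 ≤ r → s.reg r = s₀.reg r

theorem FloorInst_moment_le {M : ℕ} {q : FloorInst} (h : q.Bounded M) (hM : 1 ≤ M) {i : ℕ × ℕ}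
    (hi : i ∈ tenStates) : q.moment i ≤ M ^ 9 ∧ q.reducedMoment i ≤ M ^ 9 :=
  ⟨floorMoment_le h.1 h.2.2.1 h.2.2.2 hM hi,
    floorMoment_le h.1 ((Nat.mod_le _ _).trans h.2.2.1) ((Nat.mod_le _ _).trans h.2.2.2) hM hi⟩

/-- The bound `B` is restored not by tracking arithmetic but because the new register contents are
moments, reduced moments and chain data, all at most M⁹. -/
theorem ascendBody_step {S B M : ℕ} {s₀ s₁ s : State} {q : FloorInst} {L j : ℕ}
    (hqM : q.Bounded M) (hM : 1 ≤ M) (hMB : M ^ 9 ≤ B) (hm : 1 ≤ q.m) (hLS : L ≤ S)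
    (hd : DescendInv B s₀ q L s₁) (h : AscendInv B s₁ q L j s) (hj : j < L) (hLB : L ≤ B) :
    ascendBody.Safe S s ∧ AscendInv B s₁ q L (j + 1) (ascendBody.run s) := by
  obtain ⟨k, hk⟩ : ∃ k, L - j = k + 1 := ⟨L - j - 1, by omega⟩
  have hk' : L - (j + 1) = k := by omega
  have hkL : k < L := by omega
  have hdepth : s.reg 24 = (k + 1 : ℕ) := by rw [h.depth, hk]
  have hmom := h.moments
  rw [hk, Function.iterate_succ_apply'] at hmom
  obtain ⟨h4, h5, h6, h7⟩ := hd.stack k hkL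
  rw [← h.mem_eq] at h4 h5 h6 h7
  have hN := hd.pos k hkL
  have hmk := FloorInst.iterate_m_pos hm k fun j hj => hd.pos j (by omega)
  have hb := hqM.iterate k
  rw [Function.iterate_succ_apply'] at h7
  generalize hp : FloorInst.next^[k] q = p at *
  have hb' := hb.next
  have hM9 : M ≤ M ^ 9 := Nat.le_self_pow (by norm_num) M
  refine ⟨ascendBody_safe hdepth (by omega), ?_⟩
  rw [ascendBody_run hmk hN hdepth h4 h5 h6 h7 hmom]
  refine ⟨by omega, ?_, ?_, ⟨?_, h.bdd.2⟩, h.mem_eq, ?_⟩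
  · rw [hk']
    have h1 : 24 ∉ momentRegs := by decide
    have h2 : 24 ∉ momentRegs.map (100 + ·) := by decide
    simp only [h1, h2, if_false]
    simp
  · intro i hi
    simp only [encode_mem_momentRegs i hi, if_true, decode_encode i hi, hk', hp]
  · intro r
    have ⟨b1, b2, b3, b4⟩ := hb
    have d1 := (Nat.div_le_self p.a p.m)
    have d2 := (Nat.div_le_self p.b p.m)
    have d3 := hb'.1
    dsimp only
    split_ifs with h1 h2
    · exact abs_natCast_le ((FloorInst_moment_le hb hM (decode_mem_tenStates r h1)).1.trans hMB)
    · obtain ⟨t, ht, rfl⟩ := List.mem_map.1 h2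
      rw [Nat.add_sub_cancel_left]
      exact abs_natCast_le ((FloorInst_moment_le hb hM (decode_mem_tenStates t ht)).2.trans hMB)
    · exact abs_natCast_le (by omega)
    · exact abs_natCast_le (by omega)
    · exact abs_natCast_le (by omega)
    · exact abs_natCast_le (by omega)
    · exact abs_natCast_le (by omega)
    · exact h.bdd.1 r
  · intro r hr
    have hG : ∀ r ∈ momentRegs.map (100 + ·), r ≤ 116 := by decide
    dsimp only
    rw [if_neg (fun h' => by have := le_of_mem_momentRegs r h'; omega),
      if_neg (fun h' => by have := hG r h'; omega), ← h.reg_eq r hr]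
    repeat rw [if_neg (by omega)]

/-- The kernel: all ten moments of the instance in the registers `20`–`23`. -/
noncomputable def kernelCore : Cmd :=
  .seq (.set 24 (.const 0)) <|
  .seq (.loop (.reg 20) descendBody) <|
  .seq (.setAll (fun _ => .const 0) momentRegs) <|
  .loop (.reg 24) ascendBody

/-- `B` bounds the states between rounds and `B ^ K` the values inside a round. The conclusion
returns a state with the same `B` and leaves registers from 200 on and arrays 0 to 3 alone, so the
kernel can be called repeatedly. -/
theorem exists_kernelCore_bounds : ∃ K C : ℕ, ∀ (S B M : ℕ) (q : FloorInst) (s : State), 1 ≤ q.m →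
    q.Bounded M → 2 ≤ M → M ^ 9 ≤ B → s.Bdd B → s.HoldsInst q → 2 * Nat.log 2 q.m + 3 ≤ S →
    Runs S (B ^ K) (C * (Nat.log 2 q.m + 1)) kernelCore s fun s' =>
      (∀ i ∈ tenStates, s'.reg (5 * i.1 + i.2) = q.moment i) ∧ s'.Bdd B ∧
      (∀ r, 200 ≤ r → s'.reg r = s.reg r) ∧ ∀ a < 4, s'.mem a = s.mem a := by
  set zeroCmd : Cmd := .setAll (fun _ => .const 0) momentRegs with hzero
  set K := descendBody.weight + ascendBody.weight + zeroCmd.weight + 1 with hK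
  set C := 2 + zeroCmd.size + 3 * (descendBody.size + 2) + 2 + 3 * (ascendBody.size + 2) + 2 with hC
  refine ⟨K, C, fun S B M q s hm hqM hM hMB hs hq hS => ?_⟩
  set n := 2 * Nat.log 2 q.m + 3 with hn
  -- The factor leaves room below `B` for the depth counter, which is only logarithmic in the
  -- modulus.
  have hM9 : 256 * M ≤ M ^ 9 := by
    calc 256 * M = 2 ^ 8 * M := by norm_num
      _ ≤ M ^ 8 * M := Nat.mul_le_mul_right _ (Nat.pow_le_pow_left hM 8)
      _ = M ^ 9 := by ring
  have hB : 2 ≤ B := by omega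
  have hlog : Nat.log 2 q.m ≤ M := (Nat.log_le_self 2 q.m).trans hqM.2.1
  have hnB : n + 1 ≤ B := by omega
  have pw : ∀ w ≤ K, B ^ w ≤ B ^ K := fun w hw => Nat.pow_le_pow_right (by omega) hw
  have regOk : ∀ (s : State) (r : ℕ), s.Bdd B → (Expr.reg r).Ok S (B ^ K) s := fun s r h =>
    Expr.Safe.ok hB h trivial (pw _ (by simp only [Expr.weight]; omega))
  have dfree : descendBody.LoopFree := by simp [descendBody, Cmd.LoopFree]
  have zfree : zeroCmd.LoopFree := Cmd.setAll_loopFree _ _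
  have hinit : DescendInv B s q 0 (s.setReg 24 0) := by
    obtain ⟨h1, h2, h3, h4⟩ := hq
    refine ⟨⟨by simpa [State.setReg_reg] using h1, by simpa [State.setReg_reg] using h2,
      by simpa [State.setReg_reg] using h3, by simpa [State.setReg_reg] using h4⟩,
      by simp [State.setReg_reg], hs.setReg _ (by simp), by simp, by simp, fun r hr => ?_,
      fun _ _ => rfl⟩
    rw [State.setReg_reg, if_neg (by omega)]
  have T1 : Runs S (B ^ K) 2 (.set 24 (.const 0)) s (DescendInv B s q 0) :=
    Runs.loopFree (c := .set 24 (.const 0)) trivial hB hs trivial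
      (pw _ (by simp only [Cmd.weight, Expr.weight]; simp; omega)) hinit
  have T2 : ∀ s', DescendInv B s q 0 s' →
      Runs S (B ^ K) (n * (descendBody.size + 2) + 2) (.loop (.reg 20) descendBody) s'
        fun s' => ∃ L ≤ n, DescendInv B s q L s' ∧ (FloorInst.next^[L] q).N = 0 := by
    intro s' hs'
    refine (Runs.loop (I := DescendInv B s q) (fun _ => descendBody.size) n
      (fun k s' h => regOk _ _ h.bdd) (fun k s' h hpos => ?_) hs').mono le_rfl le_rfl
      (by simp [Expr.cost]) ?_
    · have hN : 0 < (FloorInst.next^[k] q).N := by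
        have : 0 < s'.reg 20 := hpos
        rw [h.inst.1] at this
        exact_mod_cast this
      have hkn : k < n := FloorInst.lt_of_iterate_N_pos hm fun j hj => by
        rcases hj.lt_or_eq with hj | rfl
        exacts [h.pos j hj, hN]
      obtain ⟨hsafe, hinv⟩ := descendBody_step (S := S) hqM (by omega : M ≤ B)
        (by omega : k + 1 ≤ B) hm (by omega) h hN
      exact ⟨hkn, Runs.loopFree dfree hB h.bdd hsafe (pw _ (by omega)) hinv⟩
    · rintro s'' ⟨L, hL, hinv, hpos⟩
      refine ⟨L, hL, hinv, ?_⟩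
      have : ¬ 0 < s''.reg 20 := hpos
      rw [hinv.inst.1] at this
      simpa using this
  -- The descent stops at an empty range, where all ten moments are 0; zeroing the registers is thus
  -- the correct start of the ascent.
  have T3 : ∀ L s', DescendInv B s q L s' → (FloorInst.next^[L] q).N = 0 →
      Runs S (B ^ K) zeroCmd.size zeroCmd s' (AscendInv B s' q L 0) := by
    intro L s' hs' hN
    refine Runs.loopFree zfree hB hs'.bdd
      (Cmd.setAll_safe (e := fun _ => .const 0) (fun _ _ => trivial) _ _)
      (pw _ (by omega)) ?_
    rw [hzero, Cmd.setAll_run (z := fun _ => 0) (fun _ _ _ _ => rfl)]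
    refine ⟨by omega, ?_, ?_, ⟨fun r => ?_, hs'.bdd.2⟩, rfl, ?_⟩
    · have : 24 ∉ momentRegs := by decide
      simp [this, hs'.depth]
    · intro i hi
      simp [encode_mem_momentRegs i hi, FloorInst.moment, floorMoment, hN]
    · dsimp only
      split_ifs
      · simp
      · exact hs'.bdd.1 r
    · intro r hr
      dsimp only
      rw [if_neg fun h' => by have := le_of_mem_momentRegs r h'; omega]
  have T4 : ∀ L s₁ s', L ≤ n → DescendInv B s q L s₁ → AscendInv B s₁ q L 0 s' →
      Runs S (B ^ K) (n * (ascendBody.size + 2) + 2) (.loop (.reg 24) ascendBody) s'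
        (AscendInv B s₁ q L L) := by
    intro L s₁ s' hL hd hs'
    refine (Runs.loop (I := AscendInv B s₁ q L) (fun _ => ascendBody.size) n
      (fun k s' h => regOk _ _ h.bdd) (fun k s' h hpos => ?_) hs').mono le_rfl le_rfl
      (by simp [Expr.cost]) ?_
    · have hkL : k < L := by
        have : 0 < s'.reg 24 := hpos
        rw [h.depth] at this
        omega
      obtain ⟨hsafe, hinv⟩ := ascendBody_step (S := S) hqM (by omega) hMB hm (by omega) hd h hkL
        (by omega)
      exact ⟨by omega, Runs.loopFree ascendBody_loopFree hB h.bdd hsafe (pw _ (by omega)) hinv⟩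
    · rintro s'' ⟨k, hk, hinv, hpos⟩
      have : ¬ 0 < s''.reg 24 := hpos
      rw [hinv.depth] at this
      have hle := hinv.le
      obtain rfl : k = L := by omega
      exact hinv
  have T34 : ∀ s', (∃ L ≤ n, DescendInv B s q L s' ∧ (FloorInst.next^[L] q).N = 0) →
      Runs S (B ^ K) (zeroCmd.size + (n * (ascendBody.size + 2) + 2))
        (.seq zeroCmd (.loop (.reg 24) ascendBody)) s' fun s' =>
        (∀ i ∈ tenStates, s'.reg (5 * i.1 + i.2) = q.moment i) ∧ s'.Bdd B ∧
        (∀ r, 200 ≤ r → s'.reg r = s.reg r) ∧ ∀ a < 4, s'.mem a = s.mem a := by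
    rintro s₂ ⟨L, hL, hd, hN⟩
    refine (T3 L s₂ hd hN).seq_of fun s₃ h₃ =>
      (T4 L s₂ s₃ hL hd h₃).mono le_rfl le_rfl le_rfl fun s₄ h₄ => ⟨?_, h₄.bdd, ?_, ?_⟩
    · simpa using h₄.moments
    · intro r hr; rw [h₄.reg_eq r hr, hd.reg_eq r hr]
    · intro a ha; rw [h₄.mem_eq, hd.mem_eq a ha]
  refine (T1.seq_of fun s₁ h₁ => (T2 s₁ h₁).seq_of T34).mono le_rfl le_rfl ?_ fun _ h => h
  have : n ≤ 3 * (Nat.log 2 q.m + 1) := by omega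
  calc _ ≤ 2 + (3 * (Nat.log 2 q.m + 1) * (descendBody.size + 2) + 2 +
        (zeroCmd.size + (3 * (Nat.log 2 q.m + 1) * (ascendBody.size + 2) + 2))) := by gcongr
    _ ≤ C * (Nat.log 2 q.m + 1) := by rw [hC]; nlinarith [Nat.zero_le (Nat.log 2 q.m)]

end RAM

namespace RAM

/-! ### The program for the outer contributions -/

theorem IsPolyFn.eval_reg {k : ℕ} (p : MvPolynomial (Fin k) ℚ) (ρ : Fin k → ℕ) :
    IsPolyFn fun v => MvPolynomial.eval (fun i => v (ρ i)) p :=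
  IsPolyFn.eval p fun _ => IsPolyFn.var _

/-- The outer contribution as a function of the registers: `n, u, y, d` are in the registers
`200`–`203`, `T₀, X, X₁, T₁` in the registers `204`–`207`, and the moments in the registers
`5 * p + q`. -/
noncomputable def outerFn (v : ℕ → ℚ) : ℚ :=
  ∑ i ∈ tenStates, MvPolynomial.eval (fun k => v (![200, 201, 202, 203, 205] k)) (outerCoeff i) *
    v (5 * i.1 + i.2) +
    MvPolynomial.eval (fun k => v (![200, 201, 202, 203, 204, 206, 207] k)) outerCorrection

theorem outerFn_isPolyFn : IsPolyFn outerFn :=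
  (IsPolyFn.sum fun _ _ => (IsPolyFn.eval_reg _ _).mul (IsPolyFn.var _)).add
    (IsPolyFn.eval_reg _ _)

/-- An expression for the outer contribution. -/
noncomputable def outerExpr : Expr := outerFn_isPolyFn.exists_expr.choose

/-- The floor sum that belongs to an outer triple. -/
def outerInst (n u y d : ℕ) : FloorInst where
  N := (((n / u : ℕ) : ℤ) - capEnd n u y d).toNat
  m := y * d
  a := u
  b := n - u * (n / u)

theorem outerExpr_val {s : State} {n u y d : ℕ} (h : IsOuterTriple n u y d)
    (h0 : s.reg 200 = n) (h1 : s.reg 201 = u) (h2 : s.reg 202 = y) (h3 : s.reg 203 = d)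
    (h4 : s.reg 204 = tCap u d) (h5 : s.reg 205 = (n / u : ℕ)) (h6 : s.reg 206 = capEnd n u y d)
    (h7 : s.reg 207 = tDiag n u y d)
    (hH : ∀ i ∈ tenStates, s.reg (5 * i.1 + i.2) = (outerInst n u y d).moment i) :
    outerExpr.val s = outerTerm n u y d := by
  refine outerFn_isPolyFn.exists_expr.choose_spec.2 s _ ?_
  rw [outerTerm_eq h, outerFn]
  have e1 : (fun k => ((s.reg (![200, 201, 202, 203, 205] k) : ℤ) : ℚ)) =
      ![(n : ℚ), (u : ℚ), (y : ℚ), (d : ℚ), ((n / u : ℕ) : ℚ)] := by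
    funext k
    fin_cases k <;> simp [h0, h1, h2, h3, h5, -Int.natCast_ediv]
  have e2 : (fun k => ((s.reg (![200, 201, 202, 203, 204, 206, 207] k) : ℤ) : ℚ)) =
      ![(n : ℚ), (u : ℚ), (y : ℚ), (d : ℚ), (tCap u d : ℚ), (capEnd n u y d : ℚ),
        (tDiag n u y d : ℚ)] := by
    funext k
    fin_cases k <;> simp [h0, h1, h2, h3, h4, h6, h7]
  rw [e1, e2]
  rw [Finset.sum_congr rfl fun i hi => by rw [hH i hi, Int.cast_natCast]]
  rfl

/-- Compute the data of an outer triple and of its floor sum. -/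
def outerPrep : Cmd :=
  .seq (.set 204 (.div (.sub (.reg 201) (.const 1)) (.reg 203))) <|
  .seq (.set 205 (.div (.reg 200) (.reg 201))) <|
  .seq (.ite (.sub (.div (.sub (.reg 200) (.mul (.mul (.reg 202) (.reg 203)) (.reg 204)))
      (.reg 201)) (.sub (.reg 202) (.const 1)))
    (.set 206 (.div (.sub (.reg 200) (.mul (.mul (.reg 202) (.reg 203)) (.reg 204))) (.reg 201)))
    (.set 206 (.sub (.reg 202) (.const 1)))) <|
  .seq (.ite (.sub (.div (.sub (.reg 200) (.mul (.reg 201) (.reg 202)))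
      (.mul (.reg 202) (.reg 203))) (.reg 204))
    (.set 207 (.reg 204))
    (.set 207 (.div (.sub (.reg 200) (.mul (.reg 201) (.reg 202)))
      (.mul (.reg 202) (.reg 203))))) <|
  .seq (.set 20 (.sub (.reg 205) (.reg 206))) <|
  .seq (.set 21 (.mul (.reg 202) (.reg 203))) <|
  .seq (.set 22 (.reg 201)) <|
  .set 23 (.sub (.reg 200) (.mul (.reg 201) (.reg 205)))

theorem ite_setReg (p : Prop) [Decidable p] (s : State) (r : ℕ) (v w : ℤ) :
    (if p then s.setReg r v else s.setReg r w) = s.setReg r (if p then v else w) := by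
  split_ifs <;> rfl

/-- Since d ≤ u and yu ≤ n, the modulus yd is at most n, so the kernel runs in O(log n). The
remaining bounds keep the parameters within the word size. -/
theorem outerInst_bounds {n u y d : ℕ} (h : IsOuterTriple n u y d) :
    1 ≤ (outerInst n u y d).m ∧ (outerInst n u y d).m ≤ n ∧ (outerInst n u y d).N ≤ n ∧
    0 ≤ capEnd n u y d ∧ capEnd n u y d ≤ (n / u : ℕ) ∧ 1 ≤ d ∧ u * y ≤ n ∧
    tCap u d ≤ n ∧ tDiag n u y d ≤ n := by
  obtain ⟨hu, hun, hy, hyn, hdu, -⟩ := h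
  have hd : 1 ≤ d := Nat.pos_of_dvd_of_pos hdu hu
  have hdu' : d ≤ u := Nat.le_of_dvd hu hdu
  have hyu : y * u ≤ n := (Nat.le_div_iff_mul_le hu).1 hyn
  have hle : (y : ℤ) - 1 ≤ capEnd n u y d := le_max_left _ _
  have hnu : n / u ≤ n := Nat.div_le_self n u
  have hcap : capEnd n u y d ≤ (n / u : ℕ) := by
    rw [capEnd, max_le_iff]
    refine ⟨by omega, ?_⟩
    push_cast
    exact Int.ediv_le_ediv (by omega) (by nlinarith [show 0 ≤ y * d * tCap u d by positivity])
  have ht : tCap u d ≤ n := (Nat.div_le_self _ _).trans (by omega)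
  refine ⟨Nat.mul_pos hy hd, (Nat.mul_le_mul_left y hdu').trans hyu, ?_, by omega, hcap, hd,
    by rw [mul_comm]; exact hyu, ht, (min_le_left _ _).trans ht⟩
  simp only [outerInst]
  omega

theorem outerPrep_run {s : State} {n u y d : ℕ} (h : IsOuterTriple n u y d)
    (h0 : s.reg 200 = n) (h1 : s.reg 201 = u) (h2 : s.reg 202 = y) (h3 : s.reg 203 = d) :
    outerPrep.run s = (((((((s.setReg 204 (tCap u d)).setReg 205 (n / u : ℕ)).setReg 206
      (capEnd n u y d)).setReg 207 (tDiag n u y d)).setReg 20 (outerInst n u y d).N).setReg 21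
      (outerInst n u y d).m).setReg 22 (outerInst n u y d).a).setReg 23 (outerInst n u y d).b := by
  obtain ⟨-, -, -, -, c1, hd, huy, -, -⟩ := outerInst_bounds h
  obtain ⟨hu, hun, hy, hyn, hdu, -⟩ := h
  have huX : u * (n / u) ≤ n := Nat.mul_div_le n u
  have e1 : ((u : ℤ) - 1) / d = tCap u d := by
    rw [tCap, Int.natCast_div, Nat.cast_sub hu]; rfl
  have e2 : (n : ℤ) / u = (n / u : ℕ) := by simp
  have e3 : (if 0 < ((n : ℤ) - y * d * tCap u d) / u - (y - 1) then
      ((n : ℤ) - y * d * tCap u d) / u else y - 1) = capEnd n u y d := by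
    rw [capEnd, max_def]
    split_ifs <;> omega
  have e4 : ((n : ℤ) - u * y) / (y * d) = ((n - u * y) / (y * d) : ℕ) := by
    push_cast [Nat.cast_sub huy]; rfl
  have e5 : (if 0 < (((n - u * y) / (y * d) : ℕ) : ℤ) - tCap u d then ((tCap u d : ℕ) : ℤ)
      else ((n - u * y) / (y * d) : ℕ)) = tDiag n u y d := by
    rw [tDiag, min_def]
    split_ifs <;> omega
  have e6 : ((n / u : ℕ) : ℤ) - capEnd n u y d = (outerInst n u y d).N := by
    simp only [outerInst]; omega
  have e7 : (y : ℤ) * d = (outerInst n u y d).m := by simp [outerInst]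
  have e8 : (n : ℤ) - u * (n / u : ℕ) = (outerInst n u y d).b := by
    simp only [outerInst]; push_cast [Nat.cast_sub huX]; rfl
  simp only [outerPrep, Cmd.run, Expr.val, ite_setReg, State.setReg_reg, h0, h1, h2, h3,
    Nat.reduceEqDiff, if_true, if_false, e1, e2, e3, e4, e5, e6, e8]
  rw [e7]
  rfl

theorem abs_outerTerm_le {n u y d : ℕ} (h : IsOuterTriple n u y d) :
    |outerTerm n u y d| ≤ ((n + 2) ^ 7 : ℕ) := by
  obtain ⟨hu, hun, hy, hyn, hdu, -⟩ := h
  have hyu : y * u ≤ n := (Nat.le_div_iff_mul_le hu).1 hyn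
  have hterm : ∀ t ∈ (Finset.Icc 1 u).filter (fun t => d * t < u),
      |∑ x ∈ (Finset.Icc y n).filter (fun x => x * u + y * (d * t) ≤ n),
        rectMult x y * ((n : ℤ) - x * u - y * (d * t)) * ((n : ℤ) - x * (d * t) - y * u)| ≤
      (n + 1) * (4 * n * n) := by
    intro t ht
    rw [Finset.mem_filter] at ht
    refine (Finset.abs_sum_le_sum_abs _ _).trans ((Finset.sum_le_card_nsmul _ _ (4 * n * n : ℤ)
      fun x hx => ?_).trans ?_)
    · rw [Finset.mem_filter, Finset.mem_Icc] at hx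
      have a1 : |rectMult x y| ≤ 4 := by unfold rectMult; split_ifs <;> simp
      have hx2 : (x : ℤ) * u + y * (d * t) ≤ n := by exact_mod_cast hx.2
      have p1 : (0 : ℤ) ≤ x * u := by positivity
      have p2 : (0 : ℤ) ≤ y * (d * t) := by positivity
      have p3 : (0 : ℤ) ≤ x * (d * t) := by positivity
      have p4 : (0 : ℤ) ≤ y * u := by positivity
      have dt : ((d : ℤ) * t) ≤ u := by exact_mod_cast ht.2.le
      have xy : (y : ℤ) ≤ x := by exact_mod_cast hx.1.1
      -- Rearrangement with y ≤ x and dt ≤ u: the condition on the first factor also bounds the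
      -- second between 0 and n.
      have key : (x : ℤ) * (d * t) + y * u ≤ x * u + y * (d * t) := by nlinarith
      have a2 : |(n : ℤ) - x * u - y * (d * t)| ≤ n := by rw [abs_le]; constructor <;> linarith
      have a3 : |(n : ℤ) - x * (d * t) - y * u| ≤ n := by rw [abs_le]; constructor <;> linarith
      rw [abs_mul, abs_mul]
      exact mul_le_mul (mul_le_mul a1 a2 (abs_nonneg _) (by norm_num)) a3 (abs_nonneg _)
        (by positivity)
    · rw [nsmul_eq_mul]
      have : (((Finset.Icc y n).filter (fun x => x * u + y * (d * t) ≤ n)).card : ℤ) ≤ n + 1 := by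
        have := (Finset.card_filter_le (Finset.Icc y n) (fun x => x * u + y * (d * t) ≤ n))
        rw [Nat.card_Icc] at this
        omega
      exact mul_le_mul_of_nonneg_right this (by positivity)
  have hcard : (((Finset.Icc 1 u).filter (fun t => d * t < u)).card : ℤ) ≤ n := by
    have := (Finset.card_filter_le (Finset.Icc 1 u) (fun t => d * t < u))
    rw [Nat.card_Icc] at this
    omega
  rw [outerTerm]
  refine (Finset.abs_sum_le_sum_abs _ _).trans ((Finset.sum_le_card_nsmul _ _ _ hterm).trans ?_)
  rw [nsmul_eq_mul]
  refine (mul_le_mul_of_nonneg_right hcard (by positivity)).trans ?_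
  have h2 : (4 : ℕ) ≤ (n + 2) ^ 3 := le_trans (by norm_num) (Nat.pow_le_pow_left (by omega : 2 ≤ n + 2) 3)
  have h3 : n * ((n + 1) * (4 * n * n)) ≤ (n + 2) ^ 7 := by
    calc n * ((n + 1) * (4 * n * n)) = 4 * (n * (n + 1) * n * n) := by ring
      _ ≤ (n + 2) ^ 3 * ((n + 2) * (n + 2) * (n + 2) * (n + 2)) := by gcongr <;> omega
      _ = (n + 2) ^ 7 := by ring
  exact_mod_cast h3

/-- The outer contribution of the triple in the registers `200`–`203`, with the result in register
`209`. -/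
noncomputable def outerCore : Cmd :=
  .seq outerPrep <| .seq kernelCore <| .set 209 outerExpr

/-- Stated for an arbitrary bounded state with a list of preserved registers and arrays, because
this code is also the body of the main loops. The result is polynomially bounded, so `B` survives.
-/
theorem exists_outerCore_bounds : ∃ K C : ℕ, ∀ (S B n u y d : ℕ) (s : State),
    IsOuterTriple n u y d → (n + 2) ^ 9 ≤ B → s.Bdd B → s.reg 200 = n → s.reg 201 = u →
    s.reg 202 = y → s.reg 203 = d → 2 * Nat.log 2 n + 3 ≤ S →
    Runs S (B ^ K) (C * (Nat.log 2 n + 1)) outerCore s fun s' =>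
      s'.reg 209 = outerTerm n u y d ∧ s'.Bdd B ∧
      (∀ r, 200 ≤ r ∧ r ≤ 203 ∨ 210 ≤ r → s'.reg r = s.reg r) ∧ ∀ a < 4, s'.mem a = s.mem a := by
  obtain ⟨K, C, hKC⟩ := exists_kernelCore_bounds
  refine ⟨K + outerPrep.weight + outerExpr.weight, outerPrep.size + C + (outerExpr.cost + 1),
    fun S B n u y d s h hB hs h0 h1 h2 h3 hS => ?_⟩
  have hb := outerInst_bounds h
  obtain ⟨c1, c2, c3, c4, c5, hd, huy, c6, c7⟩ := hb
  obtain ⟨hu, hun, hy, hyn, hdu, -⟩ := id h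
  have hM9 : n + 2 ≤ (n + 2) ^ 9 := Nat.le_self_pow (by norm_num) _
  have hB2 : 2 ≤ B := by omega
  have pw : ∀ w ≤ K + outerPrep.weight + outerExpr.weight,
      B ^ w ≤ B ^ (K + outerPrep.weight + outerExpr.weight) := fun w hw =>
    Nat.pow_le_pow_right (by omega) hw
  have hnu : n / u ≤ n := Nat.div_le_self n u
  have hcapB : |capEnd n u y d| ≤ B := by rw [abs_le]; constructor <;> omega
  have hydpos : (0 : ℤ) < y * d := by exact_mod_cast Nat.mul_pos hy hd
  have hsafe : outerPrep.Safe S s := by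
    simp [outerPrep, Cmd.Safe, Cmd.run, Expr.Safe, Expr.val, ite_setReg, State.setReg_reg, h1, h2,
      h3]
    omega
  have T1 : Runs S (B ^ (K + outerPrep.weight + outerExpr.weight)) outerPrep.size outerPrep s
      fun s' => s'.Bdd B ∧ s'.HoldsInst (outerInst n u y d) ∧ s'.reg 204 = tCap u d ∧
        s'.reg 205 = (n / u : ℕ) ∧ s'.reg 206 = capEnd n u y d ∧ s'.reg 207 = tDiag n u y d ∧
        (∀ r, 200 ≤ r ∧ r ≤ 203 ∨ 210 ≤ r → s'.reg r = s.reg r) ∧ s'.mem = s.mem := by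
    refine Runs.loopFree (by simp [outerPrep, Cmd.LoopFree]) hB2 hs hsafe (pw _ (by omega)) ?_
    rw [outerPrep_run h h0 h1 h2 h3]
    refine ⟨?_, by simp [State.HoldsInst, State.setReg_reg], rfl, rfl, rfl, rfl, ?_, rfl⟩
    · have e1 : (outerInst n u y d).a ≤ B := by simp only [outerInst]; omega
      have e2 : (outerInst n u y d).b ≤ B := by simp only [outerInst]; omega
      repeat' apply State.Bdd.setReg
      any_goals exact hs
      any_goals exact hcapB
      all_goals exact abs_natCast_le (by omega)
    · intro r hr
      simp only [State.setReg_reg]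
      repeat rw [if_neg (by omega)]
  have T2 : ∀ s₁ : State, s₁.Bdd B → s₁.HoldsInst (outerInst n u y d) → _ := fun s₁ hs₁ hi =>
    hKC S B (n + 2) (outerInst n u y d) s₁ c1
      ⟨by omega, by omega, by simp only [outerInst]; omega, by simp only [outerInst]; omega⟩
      (by omega) hB hs₁ hi
      (by have := Nat.log_mono_right (b := 2) c2; omega)
  refine (T1.seq_of fun s₁ hs₁ => ((T2 s₁ hs₁.1 hs₁.2.1).mono le_rfl (pw _ (by omega)) le_rfl
    fun _ h => h).seq_of fun s₂ hs₂ => ?_).mono (T := outerPrep.size +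
    (C * (Nat.log 2 (outerInst n u y d).m + 1) + (outerExpr.cost + 1))) le_rfl le_rfl ?_
    fun _ h => h
  · obtain ⟨hb₁, hi₁, g4, g5, g6, g7, gr, gm⟩ := hs₁
    obtain ⟨hm₂, hb₂, r₂, m₂⟩ := hs₂
    have hval : outerExpr.val s₂ = outerTerm n u y d := by
      refine outerExpr_val h ?_ ?_ ?_ ?_ ?_ ?_ ?_ ?_ hm₂
      · rw [r₂ _ (by norm_num), gr _ (by norm_num), h0]
      · rw [r₂ _ (by norm_num), gr _ (by norm_num), h1]
      · rw [r₂ _ (by norm_num), gr _ (by norm_num), h2]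
      · rw [r₂ _ (by norm_num), gr _ (by norm_num), h3]
      · rw [r₂ _ (by norm_num), g4]
      · rw [r₂ _ (by norm_num), g5]
      · rw [r₂ _ (by norm_num), g6]
      · rw [r₂ _ (by norm_num), g7]
    refine Runs.loopFree (c := .set 209 outerExpr) trivial hB2 hb₂
      (outerFn_isPolyFn.exists_expr.choose_spec.1 S s₂) (pw _ (by simp only [Cmd.weight]; omega)) ?_
    simp only [Cmd.run, hval]
    refine ⟨by simp [State.setReg_reg], hb₂.setReg _ ?_, fun r hr => ?_, fun a ha => ?_⟩
    · refine (abs_outerTerm_le h).trans ?_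
      exact_mod_cast (Nat.pow_le_pow_right (by omega) (by norm_num : 7 ≤ 9)).trans hB
    · rw [State.setReg_reg, if_neg (by omega), r₂ r (by omega), gr r hr]
    · rw [State.setReg_mem, m₂ a ha, gm]
  · have hlog := Nat.log_mono_right (b := 2) c2
    calc _ ≤ outerPrep.size + (C * (Nat.log 2 n + 1) + (outerExpr.cost + 1)) := by gcongr
      _ ≤ _ := by nlinarith [Nat.zero_le (Nat.log 2 n)]

/-! ### The programs for the kernel and for the outer contributions -/

theorem State.init_bdd {l : List ℤ} {B : ℕ} (h : ∀ z ∈ l, |z| ≤ B) : (State.init l).Bdd B := by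
  refine ⟨fun r => ?_, fun a i => by simp [State.init]⟩
  simp only [State.init, List.getD_eq_getElem?_getD]
  rcases hr : l[r]? with _ | z
  · simp
  · simpa using h z (List.mem_of_getElem? hr)

theorem exists_kernel : ∃ (kernel : Cmd) (K C : ℕ), ∀ N m a b : ℕ, 1 ≤ m → ∃ s : State,
    RunsWithin (C * (Nat.log 2 m + 1)) (C * (Nat.log 2 m + 1)) ((N + m + a + b + 2) ^ K) kernel
      (State.init [(N : ℤ), (m : ℤ), (a : ℤ), (b : ℤ)]) s ∧
      ∀ i ∈ tenStates, s.reg (5 * i.1 + i.2) = (floorMoment i.1 i.2 N m a b : ℤ) := by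
  obtain ⟨K, C, hKC⟩ := exists_kernelCore_bounds
  -- The bound `B` is the ninth power of the input size, large enough for all moments, whence the
  -- exponent. The summand 8 pays for the four copies and also makes the common bound large enough
  -- for the stack.
  refine ⟨.seq (.seq (.set 20 (.reg 0)) <| .seq (.set 21 (.reg 1)) <| .seq (.set 22 (.reg 2)) <|
    .set 23 (.reg 3)) kernelCore, 9 * (K + 1), C + 8, fun N m a b hm => ?_⟩
  set M := N + m + a + b + 2 with hM
  have hM9 : M ≤ M ^ 9 := Nat.le_self_pow (by norm_num) _
  have hbdd : (State.init [(N : ℤ), (m : ℤ), (a : ℤ), (b : ℤ)]).Bdd (M ^ 9) := by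
    refine State.init_bdd fun z hz => ?_
    simp only [List.mem_cons, List.not_mem_nil, or_false] at hz
    rcases hz with rfl | rfl | rfl | rfl <;> exact abs_natCast_le (by omega)
  rw [pow_mul]
  have pw : ∀ w ≤ K + 1, (M ^ 9) ^ w ≤ (M ^ 9) ^ (K + 1) := fun w hw =>
    Nat.pow_le_pow_right (by omega) hw
  have T1 : Runs ((C + 8) * (Nat.log 2 m + 1)) ((M ^ 9) ^ (K + 1)) 8 (.seq (.set 20 (.reg 0)) <|
      .seq (.set 21 (.reg 1)) <| .seq (.set 22 (.reg 2)) <| .set 23 (.reg 3))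
      (State.init [(N : ℤ), (m : ℤ), (a : ℤ), (b : ℤ)])
      fun s => s.Bdd (M ^ 9) ∧ s.HoldsInst ⟨N, m, a, b⟩ := by
    refine Runs.loopFree (c := .seq (.set 20 (.reg 0)) <|
      .seq (.set 21 (.reg 1)) <| .seq (.set 22 (.reg 2)) <| .set 23 (.reg 3))
      ⟨trivial, trivial, trivial, trivial⟩ (by omega) hbdd
      (by simp [Cmd.Safe, Expr.Safe]) (pw _ (by simp [Cmd.weight, Expr.weight])) ?_
    simp only [Cmd.run, Expr.val, State.setReg_reg, Nat.reduceEqDiff, if_false]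
    refine ⟨?_, by simp [State.HoldsInst, State.setReg_reg, State.init]⟩
    repeat' apply State.Bdd.setReg
    any_goals exact hbdd
    all_goals exact hbdd.1 _
  obtain ⟨s, ⟨k, hk, he⟩, hs⟩ := T1.seq_of (c₂ := kernelCore)
    (Q := fun s => ∀ i ∈ tenStates, s.reg (5 * i.1 + i.2) = (floorMoment i.1 i.2 N m a b : ℤ))
    fun s₁ hs₁ => (hKC ((C + 8) * (Nat.log 2 m + 1)) (M ^ 9) M ⟨N, m, a, b⟩ s₁ hm
      ⟨by dsimp only; omega, by dsimp only; omega, by dsimp only; omega, by dsimp only; omega⟩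
      (by omega) le_rfl hs₁.1 hs₁.2 (by dsimp only; nlinarith [Nat.zero_le (Nat.log 2 m)])).mono
      le_rfl (pw K (by omega)) le_rfl fun _ h => h.1
  exact ⟨s, ⟨k, hk.trans (by dsimp only; nlinarith [Nat.zero_le (Nat.log 2 m)]), he⟩, hs⟩

theorem exists_outer : ∃ (outer : Cmd) (K C : ℕ), ∀ n u y d : ℕ, IsOuterTriple n u y d →
    ∃ s : State, RunsWithin (C * (Nat.log 2 n + 1)) (C * (Nat.log 2 n + 1)) ((n + 2) ^ K) outer
      (State.init [(n : ℤ), (u : ℤ), (y : ℤ), (d : ℤ)]) s ∧ s.reg 0 = outerTerm n u y d := by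
  obtain ⟨K, C, hKC⟩ := exists_outerCore_bounds
  refine ⟨.seq (.seq (.set 200 (.reg 0)) <| .seq (.set 201 (.reg 1)) <|
    .seq (.set 202 (.reg 2)) <| .set 203 (.reg 3)) (.seq outerCore (.set 0 (.reg 209))),
    9 * (K + 1), C + 10, fun n u y d h => ?_⟩
  obtain ⟨c1, c2, c3, c4, c5, hd, huy, c6, c7⟩ := outerInst_bounds h
  obtain ⟨hu, hun, hy, hyn, hdu, -⟩ := id h
  have hnu : n / u ≤ n := Nat.div_le_self n u
  have hdn : d ≤ n := (Nat.le_of_dvd hu hdu).trans hun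
  set M := n + 2 with hM
  have hM9 : M ≤ M ^ 9 := Nat.le_self_pow (by norm_num) _
  have hbdd : (State.init [(n : ℤ), (u : ℤ), (y : ℤ), (d : ℤ)]).Bdd (M ^ 9) := by
    refine State.init_bdd fun z hz => ?_
    simp only [List.mem_cons, List.not_mem_nil, or_false] at hz
    rcases hz with rfl | rfl | rfl | rfl <;> exact abs_natCast_le (by omega)
  rw [pow_mul]
  have pw : ∀ w ≤ K + 1, (M ^ 9) ^ w ≤ (M ^ 9) ^ (K + 1) := fun w hw =>
    Nat.pow_le_pow_right (by omega) hw
  have T1 : Runs ((C + 10) * (Nat.log 2 n + 1)) ((M ^ 9) ^ (K + 1)) 8 (.seq (.set 200 (.reg 0)) <|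
      .seq (.set 201 (.reg 1)) <| .seq (.set 202 (.reg 2)) <| .set 203 (.reg 3))
      (State.init [(n : ℤ), (u : ℤ), (y : ℤ), (d : ℤ)])
      fun s => s.Bdd (M ^ 9) ∧ s.reg 200 = n ∧ s.reg 201 = u ∧ s.reg 202 = y ∧ s.reg 203 = d := by
    refine Runs.loopFree (c := .seq (.set 200 (.reg 0)) <|
      .seq (.set 201 (.reg 1)) <| .seq (.set 202 (.reg 2)) <| .set 203 (.reg 3))
      ⟨trivial, trivial, trivial, trivial⟩ (by omega) hbdd
      (by simp [Cmd.Safe, Expr.Safe]) (pw _ (by simp [Cmd.weight, Expr.weight])) ?_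
    simp only [Cmd.run, Expr.val, State.setReg_reg, Nat.reduceEqDiff, if_false]
    refine ⟨?_, by simp [State.init]⟩
    repeat' apply State.Bdd.setReg
    any_goals exact hbdd
    all_goals exact hbdd.1 _
  obtain ⟨s, ⟨k, hk, he⟩, hs⟩ := T1.seq_of (c₂ := .seq outerCore (.set 0 (.reg 209)))
    (Q := fun s => s.reg 0 = outerTerm n u y d) fun s₁ hs₁ =>
    ((hKC ((C + 10) * (Nat.log 2 n + 1)) (M ^ 9) n u y d s₁ h le_rfl hs₁.1 hs₁.2.1 hs₁.2.2.1
      hs₁.2.2.2.1 hs₁.2.2.2.2 (by nlinarith [Nat.zero_le (Nat.log 2 n)])).mono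
      le_rfl (pw K (by omega)) le_rfl fun _ h => h).seq_of fun s₂ hs₂ =>
        Runs.loopFree (c := .set 0 (.reg 209)) trivial (by omega) hs₂.2.1 trivial
          (pw _ (by simp [Cmd.weight, Expr.weight])) (by
            simp only [Cmd.run, Expr.val]
            rw [State.setReg_reg, if_pos rfl, hs₂.1])
  exact ⟨s, ⟨k, hk.trans (by
    simp only [Cmd.size, Expr.cost]
    nlinarith [Nat.zero_le (Nat.log 2 n)]), he⟩, hs⟩

end RAM

/-! ### Squarefree divisors -/

/-- A squarefree d = pe dividing pw has e ∣ w with e coprime to p, so p ∣ w already gives pe ∣ w. -/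
theorem sqfreeDivisors_mul_of_dvd {p w : ℕ} (hp : p.Prime) (hw : w ≠ 0) (h : p ∣ w) :
    sqfreeDivisors (p * w) = sqfreeDivisors w := by
  ext d
  simp only [sqfreeDivisors, Finset.mem_filter, Nat.mem_divisors]
  constructor
  · rintro ⟨⟨h1, -⟩, hs⟩
    refine ⟨⟨?_, hw⟩, hs⟩
    by_cases hpd : p ∣ d
    · obtain ⟨e, rfl⟩ := hpd
      have hcop : p.Coprime e := Nat.coprime_of_squarefree_mul hs
      exact Nat.Coprime.mul_dvd_of_dvd_of_dvd hcop h (Nat.dvd_of_mul_dvd_mul_left hp.pos h1)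
    · exact Nat.Coprime.dvd_of_dvd_mul_left ((Nat.Prime.coprime_iff_not_dvd hp).2 hpd).symm h1
  · rintro ⟨⟨h1, -⟩, hs⟩
    exact ⟨⟨h1.mul_left p, Nat.mul_ne_zero hp.ne_zero hw⟩, hs⟩

/-- The two halves are the divisors prime to p and those divisible by p. Equality of multisets is
stated because the stored list must contain each entry exactly once. -/
theorem sqfreeDivisors_mul_of_not_dvd {p w : ℕ} (hp : p.Prime) (h : ¬ p ∣ w) :
    (sqfreeDivisors (p * w)).val =
      (sqfreeDivisors w).val + (sqfreeDivisors w).val.map (p * ·) := by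
  have hw : w ≠ 0 := fun h0 => h (h0 ▸ dvd_zero p)
  have hinj : Function.Injective (p * ·) := fun a b hab => Nat.eq_of_mul_eq_mul_left hp.pos hab
  have hdisj : Disjoint (sqfreeDivisors w) ((sqfreeDivisors w).map ⟨_, hinj⟩) := by
    rw [Finset.disjoint_left]
    intro d hd hd'
    obtain ⟨e, -, rfl⟩ := Finset.mem_map.1 hd'
    simp only [sqfreeDivisors, Finset.mem_filter, Nat.mem_divisors] at hd
    exact h ((dvd_mul_right p e).trans hd.1.1)
  have : sqfreeDivisors (p * w) =
      (sqfreeDivisors w).disjUnion ((sqfreeDivisors w).map ⟨_, hinj⟩) hdisj := by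
    ext d
    simp only [sqfreeDivisors, Finset.mem_filter, Nat.mem_divisors, Finset.mem_disjUnion,
      Finset.mem_map, Function.Embedding.coeFn_mk]
    constructor
    · rintro ⟨⟨h1, -⟩, hs⟩
      by_cases hpd : p ∣ d
      · obtain ⟨e, rfl⟩ := hpd
        exact Or.inr ⟨e, ⟨⟨Nat.dvd_of_mul_dvd_mul_left hp.pos h1, hw⟩,
          hs.of_mul_right⟩, rfl⟩
      · exact Or.inl ⟨⟨Nat.Coprime.dvd_of_dvd_mul_left
          ((Nat.Prime.coprime_iff_not_dvd hp).2 hpd).symm h1, hw⟩, hs⟩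
    · rintro (⟨⟨h1, -⟩, hs⟩ | ⟨e, ⟨⟨h1, -⟩, hs⟩, rfl⟩)
      · exact ⟨⟨h1.mul_left p, Nat.mul_ne_zero hp.ne_zero hw⟩, hs⟩
      · refine ⟨⟨Nat.mul_dvd_mul_left p h1, Nat.mul_ne_zero hp.ne_zero hw⟩, ?_⟩
        rw [Nat.squarefree_mul_iff]
        exact ⟨(Nat.Prime.coprime_iff_not_dvd hp).2 fun hpe => h (hpe.trans h1),
          hp.prime.squarefree, hs⟩
  rw [this]
  rfl

theorem moebius_prime_mul {p d : ℕ} (hp : p.Prime) (h : ¬ p ∣ d) :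
    ArithmeticFunction.moebius (p * d) = -ArithmeticFunction.moebius d := by
  rw [ArithmeticFunction.isMultiplicative_moebius.map_mul_of_coprime
    ((Nat.Prime.coprime_iff_not_dvd hp).2 h), ArithmeticFunction.moebius_apply_prime hp]
  ring

/-- The list `D(u)` as a multiset of pairs. -/
def divisorPairs (u : ℕ) : Multiset (ℤ × ℤ) :=
  (sqfreeDivisors u).val.map fun d : ℕ => ((d : ℤ), ArithmeticFunction.moebius d)

/-- The second half is written with the multipliers p and -1, the form in which `RAM.copyLoop`
produces it. -/
theorem divisorPairs_mul_of_not_dvd {p w : ℕ} (hp : p.Prime) (h : ¬ p ∣ w) :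
    divisorPairs (p * w) =
      divisorPairs w + (divisorPairs w).map fun x => ((p : ℤ) * x.1, -1 * x.2) := by
  simp only [divisorPairs, sqfreeDivisors_mul_of_not_dvd hp h, Multiset.map_add, Multiset.map_map]
  congr 1
  refine Multiset.map_congr rfl fun d hd => ?_
  have hd' : d ∈ sqfreeDivisors w := hd
  simp only [sqfreeDivisors, Finset.mem_filter, Nat.mem_divisors] at hd'
  simp [moebius_prime_mul hp fun hpd => h (hpd.trans hd'.1.1)]

theorem divisorPairs_mem {u : ℕ} {x : ℤ × ℤ} (hx : x ∈ divisorPairs u) :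
    0 ≤ x.1 ∧ x.1 ≤ u ∧ |x.2| ≤ 1 := by
  obtain ⟨d, hd, rfl⟩ := Multiset.mem_map.1 hx
  have hd' : d ∈ sqfreeDivisors u := hd
  simp only [sqfreeDivisors, Finset.mem_filter, Nat.mem_divisors] at hd'
  refine ⟨by simp, ?_, ArithmeticFunction.abs_moebius_le_one⟩
  exact Int.ofNat_le.2 (Nat.le_of_dvd (Nat.pos_of_ne_zero hd'.1.2) hd'.1.1)

theorem card_divisorPairs (u : ℕ) : (divisorPairs u).card = (sqfreeDivisors u).card := by
  simp [divisorPairs]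

theorem sqfreeDivisors_one : sqfreeDivisors 1 = {1} := by
  ext d
  simp only [sqfreeDivisors, Nat.divisors_one, Finset.mem_filter, Finset.mem_singleton]
  exact ⟨fun h => h.1, fun h => ⟨h, h ▸ squarefree_one⟩⟩

theorem card_sqfreeDivisors_le_of_dvd {w u : ℕ} (hu : u ≠ 0) (h : w ∣ u) :
    (sqfreeDivisors w).card ≤ (sqfreeDivisors u).card :=
  Finset.card_le_card (Finset.filter_subset_filter _ (Nat.divisors_subset_of_dvd hu h))

/-- The position at which `D(u)` starts. -/
def divisorOffset (u : ℕ) : ℕ := ∑ v ∈ Finset.Ico 1 u, (sqfreeDivisors v).card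

theorem divisorOffset_succ {u : ℕ} (hu : 1 ≤ u) :
    divisorOffset (u + 1) = divisorOffset u + (sqfreeDivisors u).card :=
  Finset.sum_Ico_succ_top hu _

theorem divisorOffset_mono : Monotone divisorOffset := fun _ _ h =>
  Finset.sum_le_sum_of_subset (Finset.Ico_subset_Ico_right h)

theorem map_Ico_add {α : Type*} (P k : ℕ) (f : ℕ → α) :
    (Finset.Ico P (P + k)).val.map f = (Multiset.range k).map fun i => f (P + i) := by
  have : Finset.Ico P (P + k) = (Finset.range k).map (addLeftEmbedding P) := by
    ext x
    simp only [Finset.mem_Ico, Finset.mem_map, Finset.mem_range, addLeftEmbedding_apply]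
    exact ⟨fun h => ⟨x - P, by omega, by omega⟩, fun ⟨i, h1, h2⟩ => by omega⟩
  rw [this, Finset.map_val, Multiset.map_map]
  rfl

theorem map_range_add {α : Type*} (k l : ℕ) (f : ℕ → α) :
    (Multiset.range (k + l)).map f =
      (Multiset.range k).map f + (Multiset.range l).map fun i => f (k + i) := by
  rw [Multiset.range_add, Multiset.map_add, Multiset.map_map]
  rfl

namespace RAM

/-! ### The sieve for the smallest prime factors -/

/-- Store `d` (in register `211`) in all cells of array `3` whose address is a positive multiple of
`d` and at most `n` (in register `200`). -/
def sieveInner : Cmd :=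
  .loop (.sub (.add (.reg 200) (.const 1)) (.reg 212)) <|
    .seq (.store 3 (.reg 212) (.reg 211)) (.set 212 (.add (.reg 212) (.reg 211)))

theorem sieveInner_runs : ∃ K C : ℕ, ∀ (S B n d : ℕ) (s : State), 1 ≤ d → d ≤ n → n < S →
    2 * n + 2 ≤ B → s.Bdd B → s.reg 200 = n → s.reg 211 = d → s.reg 212 = d →
    Runs S (B ^ K) (C * (n / d + 1)) sieveInner s fun s' => s'.Bdd B ∧
      (∀ r, r ≠ 212 → s'.reg r = s.reg r) ∧ (∀ a, a ≠ 3 → s'.mem a = s.mem a) ∧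
      ∀ k, 1 ≤ k → k ≤ n → s'.mem 3 k = if d ∣ k then (d : ℤ) else s.mem 3 k := by
  set guard : Expr := .sub (.add (.reg 200) (.const 1)) (.reg 212) with hguard
  set body : Cmd := .seq (.store 3 (.reg 212) (.reg 211)) (.set 212 (.add (.reg 212) (.reg 211)))
    with hbody
  refine ⟨guard.weight + body.weight, body.size + (guard.cost + 1) + (guard.cost + 1),
    fun S B n d s hd hdn hS hB hs h0 h1 h2 => ?_⟩
  have hB2 : 2 ≤ B := by omega
  have pw : ∀ w ≤ guard.weight + body.weight, B ^ w ≤ B ^ (guard.weight + body.weight) :=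
    fun w hw => Nat.pow_le_pow_right (by omega) hw
  let I : ℕ → State → Prop := fun j s' => s'.Bdd B ∧ s'.reg 212 = ((j + 1) * d : ℕ) ∧ j * d ≤ n ∧
    (∀ r, r ≠ 212 → s'.reg r = s.reg r) ∧ (∀ a, a ≠ 3 → s'.mem a = s.mem a) ∧
    ∀ k, 1 ≤ k → s'.mem 3 k = if d ∣ k ∧ k < (j + 1) * d then (d : ℤ) else s.mem 3 k
  have hinit : I 0 s := by
    refine ⟨hs, by simp [h2], by simp, fun _ _ => rfl, fun _ _ => rfl, fun k hk => ?_⟩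
    rw [if_neg]
    rintro ⟨h, h'⟩
    have := Nat.le_of_dvd hk h
    omega
  refine (Runs.loop I (fun _ => body.size) (n / d) (fun j s' h => ?_) (fun j s' h hpos => ?_)
    hinit).mono le_rfl le_rfl ?_ ?_
  · exact Expr.Safe.ok (e := guard) hB2 h.1 (by simp [hguard, Expr.Safe]) (pw _ (by omega))
  · obtain ⟨hb, h212, hj, hr, hm, h3⟩ := h
    have g0 : s'.reg 200 = n := by rw [hr _ (by norm_num), h0]
    have g1 : s'.reg 211 = d := by rw [hr _ (by norm_num), h1]
    have hle : (j + 1) * d ≤ n := by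
      simp only [Expr.val, g0, h212] at hpos
      omega
    have hjd : (j + 1 + 1) * d = (j + 1) * d + d := by ring
    refine ⟨(Nat.le_div_iff_mul_le hd).2 hle, Runs.loopFree (by simp [hbody, Cmd.LoopFree]) hB2 hb
      ?_ (pw _ (by omega)) ?_⟩
    · simp only [hbody, Cmd.Safe, Expr.Safe, Expr.val, h212]
      refine ⟨⟨trivial, trivial, by positivity, by exact_mod_cast hle.trans_lt hS⟩, trivial, trivial⟩
    · have hrun : body.run s' = (s'.setMem 3 ((j + 1) * d) d).setReg 212 ((j + 1 + 1) * d : ℕ) := by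
        simp only [hbody, Cmd.run, Expr.val, State.setMem_reg, h212, g1, Int.toNat_natCast]
        rw [hjd]
        push_cast
        rfl
      rw [hrun]
      refine ⟨(hb.setMem _ _ (abs_natCast_le (by omega))).setReg _ (abs_natCast_le (by omega)),
        by simp [State.setReg_reg], hle, fun r hr' => ?_, fun a ha => ?_, fun k hk => ?_⟩
      · rw [State.setReg_reg, if_neg hr', State.setMem_reg, hr r hr']
      · funext i
        rw [State.setReg_mem, State.setMem_mem, if_neg (by tauto), hm a ha]
      · rw [State.setReg_mem, State.setMem_mem, h3 k hk]
        by_cases hk' : k = (j + 1) * d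
        · rw [if_pos ⟨rfl, hk'⟩, if_pos ⟨hk' ▸ dvd_mul_left d _, by omega⟩]
        · rw [if_neg (by tauto)]
          congr 1
          simp only [eq_iff_iff, and_congr_right_iff]
          rintro ⟨e, rfl⟩
          constructor
          · intro h; omega
          · intro h
            have h4 : e < j + 1 + 1 := by
              by_contra hcon
              have : (j + 1 + 1) * d ≤ d * e := by rw [mul_comm d e]; gcongr; omega
              omega
            have h5 : e ≠ j + 1 := fun h => hk' (by rw [h, mul_comm])
            have : (e + 1) * d ≤ (j + 1) * d := Nat.mul_le_mul_right _ (by omega)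
            nlinarith
  · simp only [Finset.sum_const, Finset.card_range, smul_eq_mul]
    nlinarith [Nat.zero_le (n / d), Nat.zero_le body.size, Nat.zero_le guard.cost]
  · rintro s' ⟨j, -, ⟨hb, h212, hj, hr, hm, h3⟩, hpos⟩
    refine ⟨hb, hr, hm, fun k hk hkn => ?_⟩
    have g0 : s'.reg 200 = n := by rw [hr _ (by norm_num), h0]
    simp only [Expr.val, g0, h212] at hpos
    rw [h3 k hk]
    congr 1
    simp only [eq_iff_iff, and_iff_left_iff_imp]
    intro _
    omega

/-- Store the smallest prime factor of `k` in the cell `k` of array `3`, for `2 ≤ k ≤ n`. -/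
def sieve : Cmd :=
  .seq (.set 211 (.reg 200)) <|
  .loop (.sub (.reg 211) (.const 1)) <|
    .seq (.set 212 (.reg 211)) <|
    .seq sieveInner <|
    .set 211 (.sub (.reg 211) (.const 1))

/-- The total length of the divisor lists of the integers up to `n`. -/
def divisorSum (n : ℕ) : ℕ := ∑ d ∈ Finset.Icc 1 n, n / d

theorem sum_range_div_eq (n : ℕ) : ∑ j ∈ Finset.range n, n / (n - j) = divisorSum n := by
  rw [divisorSum, ← Finset.sum_range_reflect]
  refine Finset.sum_bij' (fun j _ => j + 1) (fun d _ => d - 1) ?_ ?_ ?_ ?_ ?_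
  · intro j hj; simp only [Finset.mem_range, Finset.mem_Icc] at *; omega
  · intro d hd; simp only [Finset.mem_range, Finset.mem_Icc] at *; omega
  · intro j hj; simp
  · intro d hd; simp only [Finset.mem_Icc] at *; omega
  · intro j hj
    simp only [Finset.mem_range] at hj
    congr 1
    omega

theorem le_divisorSum (n : ℕ) : n ≤ divisorSum n := by
  rcases Nat.eq_zero_or_pos n with rfl | h
  · simp
  · calc n = n / 1 := by simp
      _ ≤ _ := Finset.single_le_sum (f := fun d => n / d) (fun _ _ => Nat.zero_le _)
        (Finset.mem_Icc.2 ⟨le_rfl, h⟩)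

/-- The sieve marks the multiples of every d from n down to 2, so the last value written to a cell
is its least divisor above 1, which is prime. No primality test is needed, and the harmonic cost Σ
n/d is affordable. -/
theorem sieve_runs : ∃ K C : ℕ, ∀ (S B n : ℕ) (s : State), n < S →
    2 * n + 2 ≤ B → s.Bdd B → s.reg 200 = n →
    Runs S (B ^ K) (C * (divisorSum n + 1)) sieve s fun s' => s'.Bdd B ∧ s'.reg 200 = n ∧
      ∀ k, 2 ≤ k → k ≤ n → s'.mem 3 k = k.minFac := by
  obtain ⟨K, C, hKC⟩ := sieveInner_runs
  refine ⟨K + 100, 2 * C + 100, fun S B n s hS hB hs h0 => ?_⟩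
  have hB2 : 2 ≤ B := by omega
  have pw : ∀ w ≤ K + 100, B ^ w ≤ B ^ (K + 100) :=
    fun w hw => Nat.pow_le_pow_right (by omega) hw
  -- After j rounds, a cell k > n - j holds the least divisor of k exceeding n - j; the restriction
  -- on k guarantees that there is one, namely k itself.
  let I : ℕ → State → Prop := fun j s' => s'.Bdd B ∧ s'.reg 200 = n ∧ s'.reg 211 = (n : ℤ) - j ∧
    j ≤ n - 1 ∧ ∀ k, 2 ≤ k → k ≤ n → n - j < k → ∃ e : ℕ, s'.mem 3 k = e ∧ n - j < e ∧ e ∣ k ∧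
      ∀ e', n - j < e' → e' ∣ k → e ≤ e'
  have T1 : Runs S (B ^ (K + 100)) 2 (.set 211 (.reg 200)) s (I 0) := by
    refine Runs.loopFree (c := .set 211 (.reg 200)) trivial hB2 hs trivial
      (pw _ (by simp only [Cmd.weight, Expr.weight]; omega)) ?_
    refine ⟨hs.setReg _ (hs.1 _), ?_, ?_, by omega, fun k _ h h' => by omega⟩
    · simp [Cmd.run, State.setReg_reg, h0]
    · simp [Cmd.run, State.setReg_reg, Expr.val, h0]
  refine (T1.seq_of fun s₁ h₁ => Runs.loop I (fun j => 2 + (C * (n / (n - j) + 1) + 4)) n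
    (fun j s' h => ?_) (fun j s' h hpos => ?_) h₁).mono le_rfl le_rfl ?_ ?_
  · exact Expr.Safe.ok hB2 h.1 ⟨trivial, trivial⟩ (pw _ (by simp [Expr.weight]))
  · obtain ⟨hb, g0, g1, hj, hmem⟩ := h
    have hjn : 1 < n - j := by
      simp only [Expr.val, g1] at hpos
      omega
    have g1' : s'.reg 211 = ((n - j : ℕ) : ℤ) := by rw [g1]; omega
    refine ⟨by omega, ?_⟩
    have R1 : Runs S (B ^ (K + 100)) 2 (.set 212 (.reg 211)) s'
        fun t => t = s'.setReg 212 ((n - j : ℕ) : ℤ) :=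
      Runs.loopFree (c := .set 212 (.reg 211)) trivial hB2 hb trivial
        (pw _ (by simp only [Cmd.weight, Expr.weight]; omega))
        (by simp only [Cmd.run, Expr.val, g1'])
    refine R1.seq_of ?_
    rintro _ rfl
    refine ((hKC S B n (n - j) (s'.setReg 212 ((n - j : ℕ) : ℤ)) (by omega) (by omega) hS hB
      (hb.setReg _ (abs_natCast_le (by omega))) ?_ ?_ ?_).mono le_rfl (pw _ (by omega)) le_rfl
      fun _ h => h).seq_of fun t ht => ?_
    · rw [State.setReg_reg, if_neg (by norm_num), g0]
    · rw [State.setReg_reg, if_neg (by norm_num), g1']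
    · rw [State.setReg_reg, if_pos rfl]
    · obtain ⟨tb, tr, tm, t3⟩ := ht
      have t200 : t.reg 200 = n := by
        rw [tr _ (by norm_num), State.setReg_reg, if_neg (by norm_num), g0]
      have t211 : t.reg 211 = ((n - j : ℕ) : ℤ) := by
        rw [tr _ (by norm_num), State.setReg_reg, if_neg (by norm_num), g1']
      refine Runs.loopFree (c := .set 211 (.sub (.reg 211) (.const 1))) trivial hB2 tb
        ⟨trivial, trivial⟩ (pw _ (by simp [Cmd.weight, Expr.weight])) ?_
      simp only [Cmd.run, Expr.val, t211]
      refine ⟨tb.setReg _ ?_, ?_, ?_, by omega, fun k hk hkn hjk => ?_⟩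
      · rw [abs_le]; constructor <;> omega
      · rw [State.setReg_reg, if_neg (by norm_num), t200]
      · rw [State.setReg_reg, if_pos rfl]; omega
      · rw [State.setReg_mem, t3 k (by omega) hkn]
        by_cases hd : n - j ∣ k
        · rw [if_pos hd]
          exact ⟨n - j, rfl, by omega, hd, fun e' he' _ => by omega⟩
        · rw [if_neg hd, State.setReg_mem]
          have hne : n - j ≠ k := fun h => hd (h ▸ dvd_rfl)
          obtain ⟨e, h1, h2, h3, h4⟩ := hmem k hk hkn (by omega)
          refine ⟨e, h1, by omega, h3, fun e' he' hdvd => h4 e' ?_ hdvd⟩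
          have : n - j ≠ e' := fun h => hd (h ▸ hdvd)
          omega
  · have hsum : ∑ j ∈ Finset.range n, (2 + (C * (n / (n - j) + 1) + 4) +
        ((Expr.sub (.reg 211) (.const 1)).cost + 1)) = C * divisorSum n + n * (C + 10) := by
      rw [← sum_range_div_eq, Finset.mul_sum]
      simp only [Expr.cost]
      rw [← Finset.card_range n, ← smul_eq_mul, ← Finset.sum_const, Finset.card_range,
        ← Finset.sum_add_distrib]
      exact Finset.sum_congr rfl fun j _ => by ring
    rw [hsum]
    have := le_divisorSum n
    simp only [Expr.cost]
    nlinarith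
  · rintro s' ⟨j, -, ⟨hb, g0, g1, hj, hmem⟩, hpos⟩
    refine ⟨hb, g0, fun k hk hkn => ?_⟩
    have hjn : n - j ≤ 1 := by
      simp only [Expr.val, g1] at hpos
      omega
    obtain ⟨e, h1, h2, h3, h4⟩ := hmem k hk hkn (by omega)
    rw [h1]
    congr 1
    have hp := Nat.minFac_prime (show k ≠ 1 by omega)
    exact le_antisymm (h4 _ (by have := hp.two_le; omega) (Nat.minFac_dvd k))
      (Nat.minFac_le_of_dvd (by omega) h3)

end RAM

namespace RAM

/-! ### The divisor lists -/

/-- Append the entries from position `j` (register `216`) to `hi` (register `217`) of the arrays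
`1` and `2`, multiplied by the registers `218` and `219`, at the position in register `213`. -/
def copyLoop : Cmd :=
  .loop (.sub (.reg 217) (.reg 216)) <|
    .seq (.store 1 (.reg 213) (.mul (.reg 218) (.load 1 (.reg 216)))) <|
    .seq (.store 2 (.reg 213) (.mul (.reg 219) (.load 2 (.reg 216)))) <|
    .seq (.set 213 (.add (.reg 213) (.const 1))) <|
    .set 216 (.add (.reg 216) (.const 1))

/-- The condition `lo + len ≤ P` puts the source entirely before the destination, so each read sees
the original entry. -/
theorem copyLoop_runs : ∃ K C : ℕ, ∀ (S B lo len P : ℕ) (c₁ c₂ : ℤ) (s : State), 2 ≤ B →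
    lo + len ≤ P → P + len ≤ S → P + len ≤ B → s.Bdd B → s.reg 213 = P → s.reg 216 = lo →
    s.reg 217 = (lo + len : ℕ) → s.reg 218 = c₁ → s.reg 219 = c₂ →
    (∀ i < len, |c₁ * s.mem 1 (lo + i)| ≤ B ∧ |c₂ * s.mem 2 (lo + i)| ≤ B) →
    Runs S (B ^ K) (C * (len + 1)) copyLoop s fun s' => s'.Bdd B ∧
      (∀ r, r ≠ 213 → r ≠ 216 → s'.reg r = s.reg r) ∧ s'.reg 213 = (P + len : ℕ) ∧
      s'.mem 0 = s.mem 0 ∧ s'.mem 3 = s.mem 3 ∧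
      (∀ i < P, s'.mem 1 i = s.mem 1 i ∧ s'.mem 2 i = s.mem 2 i) ∧
      ∀ i < len, s'.mem 1 (P + i) = c₁ * s.mem 1 (lo + i) ∧
        s'.mem 2 (P + i) = c₂ * s.mem 2 (lo + i) := by
  set body : Cmd :=
    .seq (.store 1 (.reg 213) (.mul (.reg 218) (.load 1 (.reg 216)))) <|
    .seq (.store 2 (.reg 213) (.mul (.reg 219) (.load 2 (.reg 216)))) <|
    .seq (.set 213 (.add (.reg 213) (.const 1))) <|
    .set 216 (.add (.reg 216) (.const 1)) with hbody
  refine ⟨body.weight + 3, body.size + 4,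
    fun S B lo len P c₁ c₂ s hB hlo hS hPB hs h213 h216 h217 h218 h219 hc => ?_⟩
  have pw : ∀ w ≤ body.weight + 3, B ^ w ≤ B ^ (body.weight + 3) :=
    fun w hw => Nat.pow_le_pow_right (by omega) hw
  let I : ℕ → State → Prop := fun j s' => s'.Bdd B ∧ j ≤ len ∧
    (∀ r, r ≠ 213 → r ≠ 216 → s'.reg r = s.reg r) ∧ s'.reg 213 = (P + j : ℕ) ∧
    s'.reg 216 = (lo + j : ℕ) ∧ s'.mem 0 = s.mem 0 ∧ s'.mem 3 = s.mem 3 ∧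
    (∀ i < P, s'.mem 1 i = s.mem 1 i ∧ s'.mem 2 i = s.mem 2 i) ∧
    ∀ i < j, s'.mem 1 (P + i) = c₁ * s.mem 1 (lo + i) ∧ s'.mem 2 (P + i) = c₂ * s.mem 2 (lo + i)
  have hinit : I 0 s := ⟨hs, by omega, fun _ _ _ => rfl, by simp [h213], by simp [h216], rfl, rfl,
    fun _ _ => ⟨rfl, rfl⟩, by simp⟩
  refine (Runs.loop I (fun _ => body.size) len (fun j s' h => ?_) (fun j s' h hpos => ?_)
    hinit).mono le_rfl le_rfl ?_ ?_
  · exact Expr.Safe.ok hB h.1 ⟨trivial, trivial⟩ (pw _ (by simp [Expr.weight]))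
  · obtain ⟨hb, hj, hr, g213, g216, m0, m3, hlow, hnew⟩ := h
    have g217 : s'.reg 217 = (lo + len : ℕ) := by rw [hr _ (by norm_num) (by norm_num), h217]
    have g218 : s'.reg 218 = c₁ := by rw [hr _ (by norm_num) (by norm_num), h218]
    have g219 : s'.reg 219 = c₂ := by rw [hr _ (by norm_num) (by norm_num), h219]
    have hjl : j < len := by
      simp only [Expr.val, g216, g217] at hpos
      omega
    obtain ⟨l1, l2⟩ := hlow (lo + j) (by omega)
    obtain ⟨b1, b2⟩ := hc j hjl
    refine ⟨hjl, Runs.loopFree (by simp [hbody, Cmd.LoopFree]) hB hb ?_ (pw _ (by omega)) ?_⟩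
    · simp only [hbody, Cmd.Safe, Cmd.run, Expr.Safe, Expr.val, State.setMem_reg, g213, g216,
        true_and, and_true]
      omega
    · have hrun : body.run s' = (((s'.setMem 1 (P + j) (c₁ * s.mem 1 (lo + j))).setMem 2 (P + j)
          (c₂ * s.mem 2 (lo + j))).setReg 213 (P + (j + 1) : ℕ)).setReg 216
          (lo + (j + 1) : ℕ) := by
        have e1 : ((P + j : ℕ) : ℤ) + 1 = (P + (j + 1) : ℕ) := by push_cast; ring
        have e2 : ((lo + j : ℕ) : ℤ) + 1 = (lo + (j + 1) : ℕ) := by push_cast; ring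
        simp only [hbody, Cmd.run, Expr.val, State.setMem_reg, State.setReg_reg, State.setMem_mem,
          g213, g216, g218, g219, Int.toNat_natCast, l1, l2, e1, e2, Nat.reduceEqDiff, if_false,
          false_and]
      rw [hrun]
      refine ⟨?_, hjl, fun r h1 h2 => ?_, ?_, ?_, ?_, ?_, fun i hi => ?_, fun i hi => ?_⟩
      · exact (((hb.setMem _ _ b1).setMem _ _ b2).setReg _ (abs_natCast_le (by omega))).setReg _
          (abs_natCast_le (by omega))
      · rw [State.setReg_reg, if_neg h2, State.setReg_reg, if_neg h1, State.setMem_reg,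
          State.setMem_reg, hr r h1 h2]
      · simp [State.setReg_reg]
      · simp [State.setReg_reg]
      · rw [← m0]; funext i; simp [State.setReg_mem, State.setMem_mem]
      · rw [← m3]; funext i; simp [State.setReg_mem, State.setMem_mem]
      · have : i ≠ P + j := by omega
        simpa [State.setReg_mem, State.setMem_mem, this] using hlow i hi
      · rcases Nat.lt_succ_iff_lt_or_eq.1 hi with hi | rfl
        · have : i ≠ j := by omega
          simpa [State.setReg_mem, State.setMem_mem, this] using hnew i hi
        · simp [State.setReg_mem, State.setMem_mem]
  · simp only [Finset.sum_const, Finset.card_range, smul_eq_mul, Expr.cost]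
    nlinarith [Nat.zero_le len, Nat.zero_le body.size]
  · rintro s' ⟨j, -, ⟨hb, hj, hr, g213, g216, m0, m3, hlow, hnew⟩, hpos⟩
    have g217 : s'.reg 217 = (lo + len : ℕ) := by rw [hr _ (by norm_num) (by norm_num), h217]
    obtain rfl : j = len := by
      simp only [Expr.val, g216, g217] at hpos
      omega
    exact ⟨hb, hr, g213, m0, m3, hlow, hnew⟩

/-- Prepare to copy `D(u / p)`, for `u ≥ 2` in register `211` and its smallest prime factor `p`. -/
def listHead : Cmd :=
  .seq (.set 214 (.load 3 (.reg 211))) <|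
  .seq (.set 215 (.div (.reg 211) (.reg 214))) <|
  .seq (.set 216 (.load 0 (.reg 215))) <|
  .seq (.set 217 (.load 0 (.add (.reg 215) (.const 1)))) <|
  .seq (.set 218 (.const 1)) <|
  .set 219 (.const 1)

/-- Prepare to copy `D(u / p)` a second time, multiplied by `(p, -1)`. -/
def listMid : Cmd :=
  .seq (.set 216 (.load 0 (.reg 215))) <|
  .seq (.set 218 (.reg 214)) <|
  .set 219 (.const (-1))

/-- Pass to the next `u` and store its list boundary. -/
def listTail : Cmd :=
  .seq (.set 211 (.add (.reg 211) (.const 1))) <| .store 0 (.reg 211) (.reg 213)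

/-- The remainder of `u / p` modulo `p`. -/
def listTest : Expr := .sub (.reg 215) (.mul (.div (.reg 215) (.reg 214)) (.reg 214))

/-- Append the list `D(u)`, for `u ≥ 2` in register `211`. -/
def listBody : Cmd :=
  .seq listHead <|
  .seq copyLoop <|
  .seq (.ite listTest (.seq listMid copyLoop) .skip) <|
  listTail

/-- The list of pairs at the positions `P, …, P + len - 1`. -/
def State.pairsAt (s : State) (P len : ℕ) : Multiset (ℤ × ℤ) :=
  (Multiset.range len).map fun i => (s.mem 1 (P + i), s.mem 2 (P + i))

theorem State.pairsAt_congr {s s' : State} {P P' len : ℕ}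
    (h : ∀ i < len, s'.mem 1 (P' + i) = s.mem 1 (P + i) ∧ s'.mem 2 (P' + i) = s.mem 2 (P + i)) :
    s'.pairsAt P' len = s.pairsAt P len := by
  refine Multiset.map_congr rfl fun i hi => ?_
  rw [Multiset.mem_range] at hi
  rw [(h i hi).1, (h i hi).2]

/-- The lists `D(v)` with `v < u` are stored. -/
structure ListInv (B n u : ℕ) (s : State) : Prop where
  bdd : s.Bdd B
  n_eq : s.reg 200 = n
  u_eq : s.reg 211 = u
  ptr : s.reg 213 = divisorOffset u
  minFac : ∀ k, 2 ≤ k → k ≤ n → s.mem 3 k = k.minFac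
  offset : ∀ v, 1 ≤ v → v ≤ u → s.mem 0 v = divisorOffset v
  pairs : ∀ v, 1 ≤ v → v < u →
    s.pairsAt (divisorOffset v) (sqfreeDivisors v).card = divisorPairs v

/-- With p the smallest prime factor of u and w = u/p, the list D(u) is D(w), followed when p ∤ w by
D(w) scaled by (p, -1). The number of entries copied is therefore the length of D(u), and this is
also the cost up to constants. -/
theorem listBody_runs : ∃ K C : ℕ, ∀ (S B n u : ℕ) (s : State), 2 ≤ u → u ≤ n →
    n + 1 < S → n + 1 ≤ B → divisorOffset (n + 1) ≤ S → divisorOffset (n + 1) ≤ B →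
    ListInv B n u s →
    Runs S (B ^ K) (C * ((sqfreeDivisors u).card + 1)) listBody s (ListInv B n (u + 1)) := by
  obtain ⟨K, C, hKC⟩ := copyLoop_runs
  refine ⟨K + listHead.weight + listMid.weight + listTail.weight + listTest.weight + 1,
    2 * C + listHead.size + listMid.size + listTail.size + listTest.cost + 3,
    fun S B n u s hu hun hS hB hoS hoB h => ?_⟩
  have hB2 : 2 ≤ B := by omega
  have pw : ∀ w ≤ K + listHead.weight + listMid.weight + listTail.weight + listTest.weight + 1,
      B ^ w ≤ B ^ (K + listHead.weight + listMid.weight + listTail.weight + listTest.weight + 1) :=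
    fun w hw => Nat.pow_le_pow_right (by omega) hw
  set W := B ^ (K + listHead.weight + listMid.weight + listTail.weight + listTest.weight + 1)
  set p := u.minFac with hp
  set w := u / p with hw
  have hprime : p.Prime := Nat.minFac_prime (by omega)
  have hpw : p * w = u := Nat.mul_div_cancel' (Nat.minFac_dvd u)
  have hwpos : 1 ≤ w := Nat.pos_of_ne_zero fun h0 => by rw [h0] at hpw; omega
  have hwu : w < u := by nlinarith [hprime.two_le]
  have hpu : p ≤ u := Nat.minFac_le (by omega)
  set len := (sqfreeDivisors w).card with hlen
  set lo := divisorOffset w with hlo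
  set P := divisorOffset u with hP
  have hlo1 : divisorOffset (w + 1) = lo + len := divisorOffset_succ hwpos
  have hloP : lo + len ≤ P := hlo1 ▸ divisorOffset_mono (by omega)
  have hlenu : len ≤ (sqfreeDivisors u).card :=
    card_sqfreeDivisors_le_of_dvd (by omega) ⟨p, by rw [mul_comm, hpw]⟩
  have hPu : divisorOffset (u + 1) = P + (sqfreeDivisors u).card := divisorOffset_succ (by omega)
  have hPn : P + (sqfreeDivisors u).card ≤ divisorOffset (n + 1) :=
    hPu ▸ divisorOffset_mono (by omega)
  have hpairs := h.pairs w hwpos hwu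
  have hmem : ∀ i < len, 0 ≤ s.mem 1 (lo + i) ∧ s.mem 1 (lo + i) ≤ w ∧
      |s.mem 2 (lo + i)| ≤ 1 := fun i hi => by
    have : (s.mem 1 (lo + i), s.mem 2 (lo + i)) ∈ divisorPairs w := by
      rw [← hpairs]
      exact Multiset.mem_map_of_mem _ (Multiset.mem_range.2 hi)
    exact divisorPairs_mem this
  have hwuB : (w : ℤ) ≤ B := by omega
  have hdiv : (u : ℤ) / p = w := by rw [hw]; simp
  have T1 : Runs S W listHead.size listHead s fun t => t = (((((s.setReg 214 p).setReg 215
      w).setReg 216 lo).setReg 217 (lo + len : ℕ)).setReg 218 1).setReg 219 1 := by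
    have e0 : s.mem 3 u = p := h.minFac u hu hun
    have e1 : s.mem 0 w = lo := h.offset w hwpos (by omega)
    have e2 : s.mem 0 (w + 1) = (lo + len : ℕ) := by rw [h.offset (w + 1) (by omega) (by omega), hlo1]
    have e3 : ((w : ℤ) + 1).toNat = w + 1 := by omega
    refine Runs.loopFree (by simp [listHead, Cmd.LoopFree]) hB2 h.bdd ?_ (pw _ (by omega)) ?_
    · have := hprime.pos
      simp [listHead, Cmd.Safe, Cmd.run, Expr.Safe, Expr.val, State.setReg_reg, State.setReg_mem,
        h.u_eq, e0, hdiv]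
      omega
    · simp only [listHead, Cmd.run, Expr.val, State.setReg_reg, State.setReg_mem, h.u_eq,
        Int.toNat_natCast, e0, hdiv, e1, e2, e3, Nat.reduceEqDiff, if_true, if_false]
  have T2 : ∀ t, t = (((((s.setReg 214 p).setReg 215
      w).setReg 216 lo).setReg 217 (lo + len : ℕ)).setReg 218 1).setReg 219 1 →
      Runs S W (C * (len + 1)) copyLoop t fun t => t.Bdd B ∧ t.reg 200 = n ∧ t.reg 211 = u ∧
        t.reg 213 = (P + len : ℕ) ∧ t.reg 214 = p ∧ t.reg 215 = w ∧ t.reg 217 = (lo + len : ℕ) ∧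
        t.mem 0 = s.mem 0 ∧ t.mem 3 = s.mem 3 ∧
        (∀ i < P, t.mem 1 i = s.mem 1 i ∧ t.mem 2 i = s.mem 2 i) ∧
        ∀ i < len, t.mem 1 (P + i) = s.mem 1 (lo + i) ∧ t.mem 2 (P + i) = s.mem 2 (lo + i) := by
    rintro t rfl
    refine (hKC S B lo len P 1 1 _ hB2 hloP (by omega) (by omega) ?_ ?_ ?_ ?_ ?_ ?_ ?_).mono le_rfl
      (pw K (by omega)) le_rfl ?_
    · repeat' apply State.Bdd.setReg
      any_goals exact h.bdd
      any_goals rw [abs_one]; omega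
      all_goals exact abs_natCast_le (by omega)
    · simp [State.setReg_reg, h.ptr, hP]
    · simp [State.setReg_reg]
    · simp [State.setReg_reg]
    · simp [State.setReg_reg]
    · simp [State.setReg_reg]
    · intro i hi
      obtain ⟨m1, m2, m3⟩ := hmem i hi
      simp only [State.setReg_mem, one_mul]
      exact ⟨by rw [abs_le]; constructor <;> omega, m3.trans (by omega)⟩
    · rintro t ⟨tb, tr, t213, t0, t3, tlow, tnew⟩
      simp only [one_mul, State.setReg_mem] at tnew tlow t0 t3
      refine ⟨tb, ?_, ?_, t213, ?_, ?_, ?_, t0, t3, tlow, tnew⟩ <;>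
      · rw [tr _ (by norm_num) (by norm_num)]
        simp [State.setReg_reg, h.n_eq, h.u_eq]
  have T3 : ∀ t : State, (t.Bdd B ∧ t.reg 200 = n ∧ t.reg 211 = u ∧
        t.reg 213 = (P + len : ℕ) ∧ t.reg 214 = p ∧ t.reg 215 = w ∧ t.reg 217 = (lo + len : ℕ) ∧
        t.mem 0 = s.mem 0 ∧ t.mem 3 = s.mem 3 ∧
        (∀ i < P, t.mem 1 i = s.mem 1 i ∧ t.mem 2 i = s.mem 2 i) ∧
        ∀ i < len, t.mem 1 (P + i) = s.mem 1 (lo + i) ∧ t.mem 2 (P + i) = s.mem 2 (lo + i)) →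
      Runs S W (listTest.cost + 1 + (listMid.size + C * (len + 1) + 1))
        (.ite listTest (.seq listMid copyLoop) .skip) t fun t => t.Bdd B ∧ t.reg 200 = n ∧
        t.reg 211 = u ∧ t.reg 213 = divisorOffset (u + 1) ∧
        t.mem 0 = s.mem 0 ∧ t.mem 3 = s.mem 3 ∧
        (∀ i < P, t.mem 1 i = s.mem 1 i ∧ t.mem 2 i = s.mem 2 i) ∧
        t.pairsAt P (sqfreeDivisors u).card = divisorPairs u := by
    rintro t ⟨tb, t200, t211, t213, t214, t215, t217, t0, t3, tlow, tnew⟩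
    have htp : t.pairsAt P len = divisorPairs w := by rw [← hpairs]; exact State.pairsAt_congr tnew
    -- The test is positive exactly when p does not divide w, which is the case in which the second,
    -- signed copy is needed.
    have htest : listTest.val t = ((w % p : ℕ) : ℤ) := by
      simp only [listTest, Expr.val, t214, t215]
      have := Nat.div_add_mod w p
      zify at this ⊢
      linarith
    have hsafe : listTest.Safe S t := by
      have := hprime.pos
      simp [listTest, Expr.Safe, Expr.val, t214]
      omega
    refine Runs.ite (Expr.Safe.ok hB2 tb hsafe (pw _ (by omega))) (fun hpos => ?_) fun hpos => ?_
    · have hnd : ¬ p ∣ w := fun hd => by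
        rw [htest, Nat.mod_eq_zero_of_dvd hd] at hpos
        exact lt_irrefl _ hpos
      have hDu : divisorPairs u = divisorPairs w +
          (divisorPairs w).map fun x => ((p : ℤ) * x.1, -1 * x.2) := by
        rw [← hpw]; exact divisorPairs_mul_of_not_dvd hprime hnd
      have hcard : (sqfreeDivisors u).card = len + len := by
        rw [← card_divisorPairs, hDu, Multiset.card_add, Multiset.card_map, card_divisorPairs]
      have R1 : Runs S W listMid.size listMid t
          fun t' => t' = ((t.setReg 216 lo).setReg 218 p).setReg 219 (-1) := by
        have e1 : t.mem 0 w = lo := by rw [t0]; exact h.offset w hwpos (by omega)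
        refine Runs.loopFree (by simp [listMid, Cmd.LoopFree]) hB2 tb ?_ (pw _ (by omega)) ?_
        · simp [listMid, Cmd.Safe, Expr.Safe, Expr.val, t215]
          omega
        · simp only [listMid, Cmd.run, Expr.val, State.setReg_reg, t214, t215, e1,
            Int.toNat_natCast, Nat.reduceEqDiff, if_false]
      refine (R1.seq_of fun t' ht' => ?_).mono (T := listMid.size + C * (len + 1)) le_rfl le_rfl
        (by omega) fun _ h => h
      subst ht'
      refine (hKC S B lo len (P + len) p (-1) _ hB2 (by omega) (by omega) (by omega) ?_ ?_ ?_ ?_ ?_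
        ?_ ?_).mono le_rfl (pw K (by omega)) le_rfl ?_
      · repeat' apply State.Bdd.setReg
        any_goals exact tb
        any_goals exact abs_natCast_le (by omega)
        simp; omega
      · simp [State.setReg_reg, t213]
      · simp [State.setReg_reg]
      · simp [State.setReg_reg, t217]
      · simp [State.setReg_reg]
      · simp [State.setReg_reg]
      · intro i hi
        obtain ⟨m1, m2, m3⟩ := hmem i hi
        simp only [State.setReg_mem, (tlow (lo + i) (by omega)).1, (tlow (lo + i) (by omega)).2]
        constructor
        · have hle : (p : ℤ) * s.mem 1 (lo + i) ≤ u := by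
            calc (p : ℤ) * s.mem 1 (lo + i) ≤ p * w := by gcongr
              _ = u := by exact_mod_cast hpw
          have hge : 0 ≤ (p : ℤ) * s.mem 1 (lo + i) := by positivity
          rw [abs_le]; constructor <;> omega
        · rw [abs_mul]
          simp only [abs_neg, abs_one, one_mul]
          exact m3.trans (by omega)
      · rintro t' ⟨tb', tr', t213', t0', t3', tlow', tnew'⟩
        simp only [State.setReg_mem] at tnew' tlow' t0' t3'
        refine ⟨tb', ?_, ?_, ?_, t0'.trans t0, t3'.trans t3, fun i hi => ?_, ?_⟩
        · rw [tr' _ (by norm_num) (by norm_num)]; simp [State.setReg_reg, t200]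
        · rw [tr' _ (by norm_num) (by norm_num)]; simp [State.setReg_reg, t211]
        · rw [t213', hPu, hcard, add_assoc]
        · rw [(tlow' i (by omega)).1, (tlow' i (by omega)).2]; exact tlow i hi
        · rw [hcard, hDu, State.pairsAt, map_range_add]
          congr 1
          · rw [← htp]
            exact State.pairsAt_congr fun i hi => tlow' (P + i) (by omega)
          · rw [← hpairs, State.pairsAt, Multiset.map_map]
            refine Multiset.map_congr rfl fun i hi => ?_
            rw [Multiset.mem_range] at hi
            rw [← add_assoc, (tnew' i hi).1, (tnew' i hi).2, (tlow (lo + i) (by omega)).1,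
              (tlow (lo + i) (by omega)).2]
            rfl
    · have hd : p ∣ w := by
        rw [htest] at hpos
        exact Nat.dvd_of_mod_eq_zero (by omega)
      have hDu : sqfreeDivisors u = sqfreeDivisors w := by
        rw [← hpw]; exact sqfreeDivisors_mul_of_dvd hprime (by omega) hd
      refine (Runs.loopFree (c := .skip) trivial hB2 tb trivial
        (pw _ (by simp only [Cmd.weight]; omega)) ?_).mono le_rfl le_rfl
        (by simp only [Cmd.size]; omega) fun _ h => h
      refine ⟨tb, t200, t211, ?_, t0, t3, tlow, ?_⟩
      · rw [hPu, hDu]; exact t213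
      · rw [hDu, divisorPairs, hDu]; exact htp
  have T4 : ∀ t : State, (t.Bdd B ∧ t.reg 200 = n ∧
        t.reg 211 = u ∧ t.reg 213 = divisorOffset (u + 1) ∧
        t.mem 0 = s.mem 0 ∧ t.mem 3 = s.mem 3 ∧
        (∀ i < P, t.mem 1 i = s.mem 1 i ∧ t.mem 2 i = s.mem 2 i) ∧
        t.pairsAt P (sqfreeDivisors u).card = divisorPairs u) →
      Runs S W listTail.size listTail t (ListInv B n (u + 1)) := by
    rintro t ⟨tb, t200, t211, t213, t0, t3, tlow, tpairs⟩
    refine Runs.loopFree (by simp [listTail, Cmd.LoopFree]) hB2 tb ?_ (pw _ (by omega)) ?_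
    · simp [listTail, Cmd.Safe, Cmd.run, Expr.Safe, Expr.val, State.setReg_reg, t211]
      omega
    · have hrun : listTail.run t = (t.setReg 211 (u + 1 : ℕ)).setMem 0 (u + 1)
          (divisorOffset (u + 1)) := by
        have e1 : (u : ℤ) + 1 = (u + 1 : ℕ) := by simp
        simp only [listTail, Cmd.run, Expr.val, State.setReg_reg, t211, t213, e1,
          Int.toNat_natCast, Nat.reduceEqDiff, if_true, if_false]
      rw [hrun]
      refine ⟨(tb.setReg _ (abs_natCast_le (by omega))).setMem _ _ (abs_natCast_le (by omega)),
        ?_, ?_, ?_, fun k hk hkn => ?_, fun v hv hvu => ?_, fun v hv hvu => ?_⟩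
      · simp [State.setMem_reg, State.setReg_reg, t200]
      · simp [State.setMem_reg, State.setReg_reg]
      · simp [State.setMem_reg, State.setReg_reg, t213]
      · simp [State.setMem_mem, State.setReg_mem, t3, h.minFac k hk hkn]
      · rw [State.setMem_mem, State.setReg_mem]
        by_cases hv' : v = u + 1
        · rw [if_pos ⟨rfl, hv'⟩, hv']
        · rw [if_neg (by tauto), t0, h.offset v hv (by omega)]
      · have hc : ((t.setReg 211 (u + 1 : ℕ)).setMem 0 (u + 1) (divisorOffset (u + 1))).pairsAt
            (divisorOffset v) (sqfreeDivisors v).card =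
            t.pairsAt (divisorOffset v) (sqfreeDivisors v).card :=
          State.pairsAt_congr fun i _ => by simp [State.setMem_mem, State.setReg_mem]
        rw [hc]
        rcases Nat.lt_succ_iff_lt_or_eq.1 hvu with hvu | rfl
        · rw [← h.pairs v hv hvu]
          refine State.pairsAt_congr fun i hi => tlow _ ?_
          have h1 : divisorOffset (v + 1) = divisorOffset v + (sqfreeDivisors v).card :=
            divisorOffset_succ hv
          have h2 : divisorOffset (v + 1) ≤ P := divisorOffset_mono (by omega)
          omega
        · exact tpairs
  refine (T1.seq_of fun t ht => (T2 t ht).seq_of fun t ht => (T3 t ht).seq_of T4).mono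
    le_rfl le_rfl ?_ fun _ h => h
  calc _ ≤ listHead.size + (C * ((sqfreeDivisors u).card + 1) + (listTest.cost + 1 +
        (listMid.size + C * ((sqfreeDivisors u).card + 1) + 1) + listTail.size)) := by gcongr
    _ ≤ _ := by
      nlinarith [Nat.zero_le (sqfreeDivisors u).card, Nat.zero_le listHead.size,
        Nat.zero_le listMid.size, Nat.zero_le listTail.size, Nat.zero_le listTest.cost]

end RAM

/-- The pairs d ∣ v with v ≤ n are counted by d instead of by v, after dropping squarefreeness. -/
theorem divisorOffset_le_divisorSum (n : ℕ) : divisorOffset (n + 1) ≤ RAM.divisorSum n := by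
  have h1 : ∀ v ∈ Finset.Ico 1 (n + 1), (sqfreeDivisors v).card ≤
      ∑ d ∈ Finset.Icc 1 n, if d ∣ v then 1 else 0 := by
    intro v hv
    rw [Finset.mem_Ico] at hv
    rw [← Finset.card_filter]
    refine Finset.card_le_card fun d hd => ?_
    simp only [sqfreeDivisors, Finset.mem_filter, Nat.mem_divisors, Finset.mem_Icc] at hd ⊢
    have h2 := Nat.le_of_dvd (by omega) hd.1.1
    have h3 := Nat.pos_of_dvd_of_pos hd.1.1 (by omega)
    exact ⟨⟨h3, by omega⟩, hd.1.1⟩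
  refine (Finset.sum_le_sum h1).trans ?_
  rw [Finset.sum_comm, RAM.divisorSum]
  refine Finset.sum_le_sum fun d _ => ?_
  rw [← Finset.card_filter, ← Nat.Ioc_filter_dvd_card_eq_div]
  refine Finset.card_le_card fun v hv => ?_
  simp only [Finset.mem_filter, Finset.mem_Ico, Finset.mem_Ioc] at hv ⊢
  omega

namespace RAM

/-! ### The preprocessing program -/

/-- All lists `D(v)` with `1 ≤ v ≤ n` are stored. -/
def State.HasLists (n : ℕ) (s : State) : Prop :=
  (∀ v, 1 ≤ v → v ≤ n + 1 → s.mem 0 v = divisorOffset v) ∧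
    ∀ v, 1 ≤ v → v ≤ n → s.pairsAt (divisorOffset v) (sqfreeDivisors v).card = divisorPairs v

theorem State.HasLists.holdsDivisorLists {n : ℕ} {s : State} (h : s.HasLists n) :
    HoldsDivisorLists n s := by
  intro u hu hun
  refine ⟨divisorOffset u, divisorOffset (u + 1), divisorOffset_mono (by omega),
    h.1 u hu (by omega), h.1 (u + 1) (by omega) (by omega), ?_⟩
  rw [divisorOffset_succ hu, map_Ico_add]
  exact h.2 u hu hun

/-- Store `D(1)`. -/
def listInit : Cmd :=
  .seq (.store 0 (.const 1) (.const 0)) <|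
  .seq (.store 0 (.const 2) (.const 1)) <|
  .seq (.store 1 (.const 0) (.const 1)) <|
  .seq (.store 2 (.const 0) (.const 1)) <|
  .seq (.set 213 (.const 1)) <|
  .set 211 (.const 2)

/-- The preprocessing: the smallest prime factors, then the lists. -/
def preprocess : Cmd :=
  .seq (.set 200 (.reg 0)) <|
  .seq sieve <|
  .seq listInit <|
  .loop (.sub (.add (.reg 200) (.const 1)) (.reg 211)) listBody

theorem preprocess_runs : ∃ K C : ℕ, ∀ (S B n : ℕ), n + 3 ≤ S → divisorSum n ≤ S →
    2 * n + 2 ≤ B → divisorSum n ≤ B →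
    Runs S (B ^ K) (C * (divisorSum n + 1)) preprocess (State.init [(n : ℤ)]) fun s =>
      s.Bdd B ∧ s.reg 200 = n ∧ s.HasLists n := by
  obtain ⟨K₁, C₁, h₁⟩ := sieve_runs
  obtain ⟨K₂, C₂, h₂⟩ := listBody_runs
  refine ⟨K₁ + K₂ + listInit.weight + 10, C₁ + 2 * C₂ + listInit.size + 20,
    fun S B n hnS hdS hnB hdB => ?_⟩
  have hoff := divisorOffset_le_divisorSum n
  have hB2 : 2 ≤ B := by omega
  set K := K₁ + K₂ + listInit.weight + 10 with hK
  have pw : ∀ w ≤ K, B ^ w ≤ B ^ K := fun w hw => Nat.pow_le_pow_right (by omega) hw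
  have hinit : (State.init [(n : ℤ)]).Bdd B := by
    refine State.init_bdd fun z hz => ?_
    simp only [List.mem_singleton] at hz
    rw [hz]
    exact abs_natCast_le (by omega)
  have T1 : Runs S (B ^ K) 2 (.set 200 (.reg 0)) (State.init [(n : ℤ)])
      fun s => s.Bdd B ∧ s.reg 200 = n := by
    refine Runs.loopFree (c := .set 200 (.reg 0)) trivial hB2 hinit trivial
      (pw _ (by simp only [Cmd.weight, Expr.weight]; omega)) ?_
    refine ⟨hinit.setReg _ (hinit.1 _), ?_⟩
    simp [Cmd.run, State.setReg_reg, Expr.val, State.init]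
  have T3 : ∀ s : State, (s.Bdd B ∧ s.reg 200 = n ∧
      ∀ k, 2 ≤ k → k ≤ n → s.mem 3 k = k.minFac) →
      Runs S (B ^ K) listInit.size listInit s (ListInv B n 2) := by
    rintro s ⟨hb, h200, hmin⟩
    refine Runs.loopFree (by simp [listInit, Cmd.LoopFree]) hB2 hb ?_ (pw _ (by omega)) ?_
    · simp [listInit, Cmd.Safe, Expr.Safe, Expr.val]
      omega
    · have hrun : listInit.run s = (((((s.setMem 0 1 0).setMem 0 2 1).setMem 1 0 1).setMem 2 0
          1).setReg 213 1).setReg 211 2 := by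
        simp [listInit, Cmd.run, Expr.val]
      -- D(1) has the single entry (1, 1) in cell 0, so the list of 2 begins at cell 1.
      have o1 : divisorOffset 1 = 0 := rfl
      have o2 : divisorOffset 2 = 1 := by
        rw [divisorOffset_succ le_rfl, o1, sqfreeDivisors_one]; rfl
      rw [hrun]
      refine ⟨?_, ?_, ?_, ?_, fun k hk hkn => ?_, fun v hv hv2 => ?_, fun v hv hv2 => ?_⟩
      · have a0 : |(0 : ℤ)| ≤ B := by simp
        have a1 : |(1 : ℤ)| ≤ B := by rw [abs_one]; omega
        have a2 : |(2 : ℤ)| ≤ B := by rw [abs_two]; omega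
        exact (((((hb.setMem _ _ a0).setMem _ _ a1).setMem _ _ a1).setMem _ _ a1).setReg _
          a1).setReg _ a2
      · simp [State.setReg_reg, State.setMem_reg, h200]
      · simp [State.setReg_reg]
      · simp [State.setReg_reg, o2]
      · simp [State.setReg_mem, State.setMem_mem, hmin k hk hkn]
      · have : v = 1 ∨ v = 2 := by omega
        rcases this with rfl | rfl <;> simp [State.setReg_mem, State.setMem_mem, o1, o2]
      · obtain rfl : v = 1 := by omega
        simp [State.pairsAt, divisorPairs, sqfreeDivisors_one, o1, State.setReg_mem,
          State.setMem_mem]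
  have T4 : ∀ s : State, ListInv B n 2 s →
      Runs S (B ^ K) (∑ j ∈ Finset.range (n - 1), (C₂ * ((sqfreeDivisors (2 + j)).card + 1) + 6) + 6)
        (.loop (.sub (.add (.reg 200) (.const 1)) (.reg 211)) listBody) s
        fun s => s.Bdd B ∧ s.reg 200 = n ∧ s.HasLists n := by
    intro s hs
    refine (Runs.loop (fun j => ListInv B n (2 + j)) _ (n - 1) (fun j s' h => ?_)
      (fun j s' h hpos => ?_) hs).mono le_rfl le_rfl le_rfl ?_
    · exact Expr.Safe.ok hB2 h.bdd ⟨⟨trivial, trivial⟩, trivial⟩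
        (pw _ (by simp [Expr.weight]; omega))
    · simp only [Expr.val, h.n_eq, h.u_eq] at hpos
      have hj : 2 + j ≤ n := by omega
      refine ⟨by omega, (h₂ S B n (2 + j) s' (by omega) hj (by omega) (by omega) (by omega)
        (by omega) h).mono le_rfl (pw _ (by omega)) le_rfl fun _ h => h⟩
    · rintro s' ⟨j, hj, h, hpos⟩
      simp only [Expr.val, h.n_eq, h.u_eq] at hpos
      exact ⟨h.bdd, h.n_eq, fun v hv hvn => h.offset v hv (by omega),
        fun v hv hvn => h.pairs v hv (by omega)⟩
  refine (T1.seq_of fun s hs => ((h₁ S B n s (by omega) hnB hs.1 hs.2).mono le_rfl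
    (pw _ (by omega)) le_rfl fun _ h => h).seq_of fun s hs => (T3 s hs).seq_of T4).mono
    le_rfl le_rfl ?_ fun _ h => h
  have hsum : ∑ j ∈ Finset.range (n - 1), (C₂ * ((sqfreeDivisors (2 + j)).card + 1) + 6) ≤
      C₂ * divisorSum n + n * (C₂ + 6) := by
    calc _ = C₂ * ∑ j ∈ Finset.range (n - 1), (sqfreeDivisors (2 + j)).card +
          (n - 1) * (C₂ + 6) := by
          rw [Finset.mul_sum, ← Finset.card_range (n - 1), ← smul_eq_mul (Finset.card _),
            ← Finset.sum_const, Finset.card_range, ← Finset.sum_add_distrib]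
          exact Finset.sum_congr rfl fun j _ => by ring
      _ ≤ _ := by
          have : ∑ j ∈ Finset.range (n - 1), (sqfreeDivisors (2 + j)).card ≤
              divisorOffset (n + 1) := by
            rw [divisorOffset, Finset.sum_Ico_eq_sum_range]
            rcases n with _ | n
            · simp
            · simp only [Nat.add_sub_cancel]
              rw [Finset.sum_range_succ']
              refine le_trans (le_of_eq (Finset.sum_congr rfl fun j _ => ?_)) (Nat.le_add_right _ _)
              congr 2
              ring
          gcongr
          · omega
          · omega
  have := le_divisorSum n
  nlinarith

end RAM

/-- The contribution of the pair `(u, y)`. -/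
def pairTerm (n u y : ℕ) : ℤ :=
  ∑ d ∈ u.divisors, ArithmeticFunction.moebius d * outerTerm n u y d

/-- The Möbius function vanishes off the squarefree divisors, so the stored lists suffice for the
full divisor sum. -/
theorem sum_divisorPairs (n u y : ℕ) :
    ((divisorPairs u).map fun x => x.2 * outerTerm n u y x.1.toNat).sum = pairTerm n u y := by
  rw [divisorPairs, Multiset.map_map]
  change ∑ d ∈ sqfreeDivisors u, _ = _
  rw [pairTerm, sqfreeDivisors]
  refine (Finset.sum_filter_of_ne fun d _ hd => ?_)
  by_contra hsq
  simp [ArithmeticFunction.moebius_eq_zero_of_not_squarefree hsq] at hd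

namespace RAM

/-! ### The main program -/

theorem State.HasLists.congr {n : ℕ} {s s' : State} (h : s.HasLists n)
    (hm : ∀ a < 4, s'.mem a = s.mem a) : s'.HasLists n := by
  refine ⟨fun v hv hvn => ?_, fun v hv hvn => ?_⟩
  · rw [hm 0 (by norm_num)]; exact h.1 v hv hvn
  · rw [← h.2 v hv hvn]
    exact State.pairsAt_congr fun i _ => by rw [hm 1 (by norm_num), hm 2 (by norm_num)]; simp

/-- Before the contribution of a divisor. -/
def divisorHead : Cmd := .set 203 (.load 1 (.reg 222))

/-- After the contribution of a divisor. -/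
def divisorTail : Cmd :=
  .seq (.set 220 (.add (.reg 220) (.mul (.load 2 (.reg 222)) (.reg 209)))) <|
  .set 222 (.add (.reg 222) (.const 1))

/-- Add the contributions of all `d` for given `u, y` to register `220`. -/
noncomputable def divisorLoop : Cmd :=
  .loop (.sub (.reg 223) (.reg 222)) (.seq divisorHead (.seq outerCore divisorTail))

/-- Read the boundaries of `D(u)`. -/
def divisorInit : Cmd :=
  .seq (.set 222 (.load 0 (.reg 201))) (.set 223 (.load 0 (.add (.reg 201) (.const 1))))

/-- The invariant of the loops over `u` and `y`. -/
structure MainInv (B n u : ℕ) (acc : ℤ) (s : State) : Prop where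
  bdd : s.Bdd B
  n_eq : s.reg 200 = n
  u_eq : s.reg 201 = u
  acc_eq : s.reg 220 = acc
  lists : s.HasLists n

theorem abs_moebius_mul_outerTerm_le {n u y d : ℕ} (h : IsOuterTriple n u y d) :
    |ArithmeticFunction.moebius d * outerTerm n u y d| ≤ ((n + 2) ^ 7 : ℕ) := by
  rw [abs_mul]
  calc _ ≤ 1 * |outerTerm n u y d| :=
        mul_le_mul_of_nonneg_right ArithmeticFunction.abs_moebius_le_one (abs_nonneg _)
    _ ≤ _ := by rw [one_mul]; exact abs_outerTerm_le h

theorem card_sqfreeDivisors_le (u : ℕ) : (sqfreeDivisors u).card ≤ u :=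
  (Finset.card_filter_le _ _).trans (Nat.card_divisors_le_self u)

/-- The constraints on the space bound and on the bound for the integers. -/
structure MainBounds (S B n : ℕ) : Prop where
  space : n + 3 ≤ S
  space_log : 2 * Nat.log 2 n + 3 ≤ S
  space_lists : divisorSum n ≤ S
  word : (n + 2) ^ 11 ≤ B

/-- The accumulator has to fit within `B` at every moment, not only at the end. There are at most n
divisors, each contributing at most (n+2)⁷; this increment is exported for use in the enclosing
loop. -/
theorem divisorLoop_runs : ∃ K C : ℕ, ∀ (S B n u y : ℕ) (acc : ℤ) (s : State),
    MainBounds S B n → 1 ≤ u → u ≤ n → 1 ≤ y → y ≤ n / u →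
    |acc| + n * (n + 2) ^ 7 ≤ B → MainInv B n u acc s → s.reg 202 = y →
    Runs S (B ^ K) (C * (Nat.log 2 n + 1) * ((sqfreeDivisors u).card + 1))
      (.seq divisorInit divisorLoop) s fun s' =>
        MainInv B n u (acc + pairTerm n u y) s' ∧ s'.reg 202 = y ∧ s'.reg 221 = s.reg 221 ∧
        |acc + pairTerm n u y| ≤ |acc| + n * (n + 2) ^ 7 := by
  obtain ⟨K, C, hKC⟩ := exists_outerCore_bounds
  refine ⟨K + divisorInit.weight + divisorHead.weight + divisorTail.weight + 3,
    divisorInit.size + divisorHead.size + C + divisorTail.size + 8,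
    fun S B n u y acc s hSB hu hun hy hyn hacc h h202 => ?_⟩
  set W := B ^ (K + divisorInit.weight + divisorHead.weight + divisorTail.weight + 3) with hW
  have hM9 : (n + 2) ^ 9 ≤ B := (Nat.pow_le_pow_right (by omega) (by norm_num)).trans hSB.word
  have hM1 : n + 2 ≤ B := (Nat.le_self_pow (by norm_num) _).trans hM9
  have hB2 : 2 ≤ B := by omega
  have pw : ∀ w ≤ K + divisorInit.weight + divisorHead.weight + divisorTail.weight + 3,
      B ^ w ≤ W := fun w hw => Nat.pow_le_pow_right (by omega) hw
  have hoff := (divisorOffset_le_divisorSum n).trans hSB.space_lists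
  have hsp := hSB.space
  set len := (sqfreeDivisors u).card with hlen
  set lo := divisorOffset u with hlo
  have hlo1 : divisorOffset (u + 1) = lo + len := divisorOffset_succ hu
  have hloS : lo + len ≤ S := by
    have : divisorOffset (u + 1) ≤ divisorOffset (n + 1) := divisorOffset_mono (by omega)
    omega
  have hlenu : len ≤ n := (card_sqfreeDivisors_le u).trans hun
  have hpairs : s.pairsAt lo len = divisorPairs u := h.lists.2 u hu hun
  have hentry : ∀ i < len, ∃ d : ℕ, IsOuterTriple n u y d ∧ s.mem 1 (lo + i) = d ∧
      s.mem 2 (lo + i) = ArithmeticFunction.moebius d := fun i hi => by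
    have : (s.mem 1 (lo + i), s.mem 2 (lo + i)) ∈ divisorPairs u := by
      rw [← hpairs]
      exact Multiset.mem_map_of_mem _ (Multiset.mem_range.2 hi)
    obtain ⟨d, hd, he⟩ := Multiset.mem_map.1 this
    have hd' : d ∈ sqfreeDivisors u := hd
    simp only [sqfreeDivisors, Finset.mem_filter, Nat.mem_divisors] at hd'
    rw [Prod.mk.injEq] at he
    exact ⟨d, ⟨hu, hun, hy, hyn, hd'.1.1, hd'.2⟩, he.1.symm, he.2.symm⟩
  -- The summands are indexed by memory position, since the order of the entries within a list is
  -- not specified; only the total is identified, as a multiset sum.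
  set F : ℕ → ℤ := fun i => s.mem 2 (lo + i) * outerTerm n u y (s.mem 1 (lo + i)).toNat with hF
  have hFle : ∀ i < len, |F i| ≤ ((n + 2) ^ 7 : ℕ) := fun i hi => by
    obtain ⟨d, hd, e1, e2⟩ := hentry i hi
    simp only [hF, e1, e2, Int.toNat_natCast]
    exact abs_moebius_mul_outerTerm_le hd
  have hFsum : ∀ j ≤ len, |acc + ∑ i ∈ Finset.range j, F i| ≤ |acc| + n * (n + 2) ^ 7 := by
    intro j hj
    refine (abs_add_le _ _).trans (add_le_add le_rfl ?_)
    refine (Finset.abs_sum_le_sum_abs _ _).trans ?_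
    refine (Finset.sum_le_card_nsmul _ _ (((n + 2) ^ 7 : ℕ) : ℤ) fun i hi =>
      hFle i ((Finset.mem_range.1 hi).trans_le hj)).trans ?_
    rw [Finset.card_range, nsmul_eq_mul]
    push_cast
    gcongr
    omega
  have hFtotal : ∑ i ∈ Finset.range len, F i = pairTerm n u y := by
    rw [← sum_divisorPairs, ← hpairs, State.pairsAt, Multiset.map_map]
    rfl
  have T1 : Runs S W divisorInit.size divisorInit s
      fun t => t = (s.setReg 222 lo).setReg 223 (lo + len : ℕ) := by
    have e1 : s.mem 0 u = lo := h.lists.1 u hu (by omega)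
    have e2 : s.mem 0 (u + 1) = (lo + len : ℕ) := by
      rw [h.lists.1 (u + 1) (by omega) (by omega), hlo1]
    have e3 : ((u : ℤ) + 1).toNat = u + 1 := by omega
    refine Runs.loopFree (by simp [divisorInit, Cmd.LoopFree]) hB2 h.bdd ?_ (pw _ (by omega)) ?_
    · simp [divisorInit, Cmd.Safe, Cmd.run, Expr.Safe, Expr.val, State.setReg_reg, h.u_eq]
      omega
    · simp only [divisorInit, Cmd.run, Expr.val, State.setReg_reg, State.setReg_mem, h.u_eq,
        Int.toNat_natCast, e1, e2, e3, Nat.reduceEqDiff, if_false]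
  have hoffB : lo + len ≤ B := by
    have h1 : lo + len ≤ (n + 1) * n := by
      rw [← hlo1, divisorOffset]
      refine (Finset.sum_le_card_nsmul _ _ n fun v hv => ?_).trans ?_
      · rw [Finset.mem_Ico] at hv
        exact (card_sqfreeDivisors_le v).trans (by omega)
      · rw [smul_eq_mul, Nat.card_Ico]
        gcongr
        omega
    calc lo + len ≤ (n + 1) * n := h1
      _ ≤ (n + 2) ^ 2 := by nlinarith
      _ ≤ (n + 2) ^ 9 := Nat.pow_le_pow_right (by omega) (by norm_num)
      _ ≤ B := hM9
  let I : ℕ → State → Prop := fun j t =>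
    MainInv B n u (acc + ∑ i ∈ Finset.range j, F i) t ∧ j ≤ len ∧ t.reg 202 = y ∧
    t.reg 221 = s.reg 221 ∧ t.reg 222 = (lo + j : ℕ) ∧ t.reg 223 = (lo + len : ℕ) ∧
    ∀ a < 4, t.mem a = s.mem a
  have T2 : ∀ t, t = (s.setReg 222 lo).setReg 223 (lo + len : ℕ) →
      Runs S W (len * (divisorHead.size + (C * (Nat.log 2 n + 1) + divisorTail.size) + 4) + 4)
        divisorLoop t fun s' =>
        MainInv B n u (acc + pairTerm n u y) s' ∧ s'.reg 202 = y ∧ s'.reg 221 = s.reg 221 ∧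
        |acc + pairTerm n u y| ≤ |acc| + n * (n + 2) ^ 7 := by
    rintro t rfl
    refine (Runs.loop I (fun _ => divisorHead.size + (C * (Nat.log 2 n + 1) + divisorTail.size)) len
      (fun j t ht => ?_) (fun j t ht hpos => ?_) ?_).mono le_rfl le_rfl ?_ ?_
    · exact Expr.Safe.ok hB2 ht.1.bdd ⟨trivial, trivial⟩ (pw _ (by simp [Expr.weight]))
    · obtain ⟨hinv, hj, t202, t221, t222, t223, tm⟩ := ht
      have hjl : j < len := by
        simp only [Expr.val, t222, t223] at hpos
        omega
      obtain ⟨d, hd, e1, e2⟩ := hentry j hjl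
      have hdn : d ≤ n := (Nat.le_of_dvd hu hd.2.2.2.2.1).trans hun
      refine ⟨hjl, ?_⟩
      have R1 : Runs S W divisorHead.size divisorHead t fun t' => t' = t.setReg 203 d := by
        refine Runs.loopFree (by simp [divisorHead, Cmd.LoopFree]) hB2 hinv.bdd ?_
          (pw _ (by omega)) ?_
        · simp [divisorHead, Cmd.Safe, Expr.Safe, Expr.val, t222]
          omega
        · simp only [divisorHead, Cmd.run, Expr.val, t222, Int.toNat_natCast, tm 1 (by norm_num), e1]
      refine R1.seq_of ?_
      rintro _ rfl
      refine ((hKC S B n u y d (t.setReg 203 d) hd hM9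
        (hinv.bdd.setReg _ (abs_natCast_le (by omega))) ?_ ?_ ?_ ?_ hSB.space_log).mono le_rfl
        (pw K (by omega)) le_rfl fun _ h => h).seq_of fun t' ht' => ?_
      · simp [State.setReg_reg, hinv.n_eq]
      · simp [State.setReg_reg, hinv.u_eq]
      · simp [State.setReg_reg, t202]
      · simp [State.setReg_reg]
      · obtain ⟨u209, ub, ur, um⟩ := ht'
        have ur' : ∀ r, 200 ≤ r ∧ r ≤ 202 ∨ 210 ≤ r → t'.reg r = t.reg r := fun r hr => by
          rw [ur r (by omega), State.setReg_reg, if_neg (by omega)]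
        have um' : ∀ a < 4, t'.mem a = s.mem a := fun a ha => by
          rw [um a ha, State.setReg_mem, tm a ha]
        have u222 : t'.reg 222 = (lo + j : ℕ) := by rw [ur' _ (by norm_num), t222]
        have u220 : t'.reg 220 = acc + ∑ i ∈ Finset.range j, F i := by
          rw [ur' _ (by norm_num), hinv.acc_eq]
        have hrun : divisorTail.run t' = (t'.setReg 220 (acc + ∑ i ∈ Finset.range (j + 1),
            F i)).setReg 222 (lo + (j + 1) : ℕ) := by
          have e3 : ((lo + j : ℕ) : ℤ) + 1 = (lo + (j + 1) : ℕ) := by push_cast; ring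
          have e4 : acc + ∑ i ∈ Finset.range j, F i +
              ArithmeticFunction.moebius d * outerTerm n u y d =
              acc + ∑ i ∈ Finset.range (j + 1), F i := by
            rw [Finset.sum_range_succ]
            simp only [hF, e1, e2, Int.toNat_natCast]
            ring
          simp only [divisorTail, Cmd.run, Expr.val, State.setReg_reg, u222, u220, u209,
            Int.toNat_natCast, um' 2 (by norm_num), e2, e3, e4, Nat.reduceEqDiff, if_false]
        refine Runs.loopFree (by simp [divisorTail, Cmd.LoopFree]) hB2 ub ?_ (pw _ (by omega)) ?_
        · simp [divisorTail, Cmd.Safe, Expr.Safe, Expr.val, u222]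
          omega
        · rw [hrun]
          refine ⟨⟨?_, ?_, ?_, ?_, ?_⟩, hjl, ?_, ?_, ?_, ?_, um'⟩
          · exact (ub.setReg _ ((hFsum (j + 1) hjl).trans hacc)).setReg _
              (abs_natCast_le (by omega))
          · simp [State.setReg_reg, ur', hinv.n_eq]
          · simp [State.setReg_reg, ur', hinv.u_eq]
          · simp [State.setReg_reg]
          · exact h.lists.congr um'
          · simp [State.setReg_reg, ur', t202]
          · simp [State.setReg_reg, ur', t221]
          · simp [State.setReg_reg]
          · simp [State.setReg_reg, ur', t223]
    · refine ⟨⟨?_, ?_, ?_, ?_, ?_⟩, by omega, ?_, ?_, ?_, ?_, fun _ _ => rfl⟩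
      · exact (h.bdd.setReg _ (abs_natCast_le (by omega))).setReg _ (abs_natCast_le (by omega))
      · simp [State.setReg_reg, h.n_eq]
      · simp [State.setReg_reg, h.u_eq]
      · simp [State.setReg_reg, h.acc_eq]
      · exact h.lists.congr fun _ _ => rfl
      · simp [State.setReg_reg, h202]
      · simp [State.setReg_reg]
      · simp [State.setReg_reg]
      · simp [State.setReg_reg]
    · simp [Expr.cost]
    · rintro t ⟨j, -, ⟨hinv, hj, t202, t221, t222, t223, tm⟩, hpos⟩
      obtain rfl : j = len := by
        simp only [Expr.val, t222, t223] at hpos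
        omega
      have hle := hFsum len le_rfl
      rw [hFtotal] at hinv hle
      exact ⟨hinv, t202, t221, hle⟩
  refine (T1.seq_of T2).mono le_rfl le_rfl ?_ fun _ h => h
  generalize Nat.log 2 n = l
  have h1 : len * (divisorHead.size + (C * (l + 1) + divisorTail.size) + 4) ≤
      len * ((divisorHead.size + C + divisorTail.size + 4) * (l + 1)) := by
    gcongr
    nlinarith [Nat.zero_le l, Nat.zero_le divisorHead.size, Nat.zero_le divisorTail.size]
  have h2 : divisorInit.size + 4 ≤ (divisorInit.size + 4) * ((l + 1) * (len + 1)) :=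
    Nat.le_mul_of_pos_right _ (by positivity)
  calc _ ≤ (divisorInit.size + 4) * ((l + 1) * (len + 1)) +
        len * ((divisorHead.size + C + divisorTail.size + 4) * (l + 1)) := by omega
    _ ≤ (divisorInit.size + 4) * ((l + 1) * (len + 1)) +
        (len + 1) * ((divisorHead.size + C + divisorTail.size + 4) * (l + 1)) := by gcongr; omega
    _ = _ := by ring

end RAM

/-- The contribution of `u`. -/
def rowTerm (n u : ℕ) : ℤ := ∑ y ∈ Finset.Icc 1 (n / u), pairTerm n u y

namespace RAM

/-- Start the loop over `y`. -/
def rowInit : Cmd := .seq (.set 202 (.const 1)) (.set 221 (.div (.reg 200) (.reg 201)))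

/-- Pass to the next `y`. -/
def rowTail : Cmd := .set 202 (.add (.reg 202) (.const 1))

/-- Add the contributions of all `y, d` for given `u` to register `220`. -/
noncomputable def rowLoop : Cmd :=
  .loop (.sub (.add (.reg 221) (.const 1)) (.reg 202)) (.seq (.seq divisorInit divisorLoop) rowTail)

theorem rowLoop_runs : ∃ K C : ℕ, ∀ (S B n u : ℕ) (acc : ℤ) (s : State),
    MainBounds S B n → 1 ≤ u → u ≤ n →
    |acc| + n * (n * (n + 2) ^ 7) ≤ B → MainInv B n u acc s →
    Runs S (B ^ K) (C * (Nat.log 2 n + 1) * (n / u * ((sqfreeDivisors u).card + 1) + 1))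
      (.seq rowInit rowLoop) s fun s' =>
        MainInv B n u (acc + rowTerm n u) s' ∧
        |acc + rowTerm n u| ≤ |acc| + n * (n * (n + 2) ^ 7) := by
  obtain ⟨K, C, hKC⟩ := divisorLoop_runs
  refine ⟨K + rowInit.weight + rowTail.weight + 10, rowInit.size + C + rowTail.size + 12,
    fun S B n u acc s hSB hu hun hacc h => ?_⟩
  set W := B ^ (K + rowInit.weight + rowTail.weight + 10) with hW
  have hM1 : n + 2 ≤ B := (Nat.le_self_pow (by norm_num) _).trans hSB.word
  have hB2 : 2 ≤ B := by omega
  have pw : ∀ w ≤ K + rowInit.weight + rowTail.weight + 10,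
      B ^ w ≤ W := fun w hw => Nat.pow_le_pow_right (by omega) hw
  have hnu : n / u ≤ n := Nat.div_le_self n u
  have T1 : Runs S W rowInit.size rowInit s
      fun t => t = (s.setReg 202 1).setReg 221 (n / u : ℕ) := by
    refine Runs.loopFree (by simp [rowInit, Cmd.LoopFree]) hB2 h.bdd ?_ (pw _ (by omega)) ?_
    · simp [rowInit, Cmd.Safe, Cmd.run, Expr.Safe, Expr.val, State.setReg_reg, h.u_eq]
      omega
    · simp [rowInit, Cmd.run, Expr.val, State.setReg_reg, h.u_eq, h.n_eq]
  let I : ℕ → State → Prop := fun j t =>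
    MainInv B n u (acc + ∑ y ∈ Finset.Ico 1 (j + 1), pairTerm n u y) t ∧ j ≤ n / u ∧
    t.reg 202 = (j + 1 : ℕ) ∧ t.reg 221 = (n / u : ℕ) ∧
    |acc + ∑ y ∈ Finset.Ico 1 (j + 1), pairTerm n u y| ≤ |acc| + j * (n * (n + 2) ^ 7)
  have T2 : ∀ t, t = (s.setReg 202 1).setReg 221 (n / u : ℕ) →
      Runs S W (n / u * (C * (Nat.log 2 n + 1) * ((sqfreeDivisors u).card + 1) +
        rowTail.size + 6) + 6) rowLoop t fun s' =>
        MainInv B n u (acc + rowTerm n u) s' ∧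
        |acc + rowTerm n u| ≤ |acc| + n * (n * (n + 2) ^ 7) := by
    rintro t rfl
    refine (Runs.loop I (fun _ => C * (Nat.log 2 n + 1) * ((sqfreeDivisors u).card + 1) +
      rowTail.size) (n / u) (fun j t ht => ?_) (fun j t ht hpos => ?_) ?_).mono le_rfl le_rfl ?_ ?_
    · exact Expr.Safe.ok hB2 ht.1.bdd ⟨⟨trivial, trivial⟩, trivial⟩
        (pw _ (by simp [Expr.weight]))
    · obtain ⟨hinv, hj, t202, t221, hle⟩ := ht
      have hjl : j < n / u := by
        simp only [Expr.val, t202, t221] at hpos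
        omega
      have hstep : |acc| + (j : ℤ) * (n * (n + 2) ^ 7) + n * (n + 2) ^ 7 =
          |acc| + ((j + 1 : ℕ) : ℤ) * (n * (n + 2) ^ 7) := by push_cast; ring
      have hstep' : |acc| + ((j + 1 : ℕ) : ℤ) * (n * (n + 2) ^ 7) ≤
          |acc| + n * (n * (n + 2) ^ 7) := by
        gcongr
        omega
      refine ⟨hjl, ((hKC S B n u (j + 1) _ t hSB hu hun (by omega) hjl (by linarith) hinv
        t202).mono le_rfl (pw K (by omega)) le_rfl fun _ h => h).seq_of fun t' ht' => ?_⟩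
      obtain ⟨hinv', u202, u221, hle'⟩ := ht'
      have hsum : acc + ∑ y ∈ Finset.Ico 1 (j + 1), pairTerm n u y + pairTerm n u (j + 1) =
          acc + ∑ y ∈ Finset.Ico 1 (j + 1 + 1), pairTerm n u y := by
        rw [Finset.sum_Ico_succ_top (by omega : 1 ≤ j + 1)]; ring
      rw [hsum] at hinv' hle'
      have hrun : rowTail.run t' = t'.setReg 202 (j + 1 + 1 : ℕ) := by
        simp only [rowTail, Cmd.run, Expr.val, u202]
        push_cast
        rfl
      refine Runs.loopFree (c := rowTail) trivial hB2 hinv'.bdd ⟨trivial, trivial⟩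
        (pw _ (by omega)) ?_
      rw [hrun]
      refine ⟨⟨hinv'.bdd.setReg _ (abs_natCast_le (by omega)), ?_, ?_, ?_, ?_⟩, hjl, ?_, ?_, ?_⟩
      · simp [State.setReg_reg, hinv'.n_eq]
      · simp [State.setReg_reg, hinv'.u_eq]
      · simp [State.setReg_reg, hinv'.acc_eq]
      · exact hinv'.lists.congr fun _ _ => rfl
      · simp [State.setReg_reg]
      · rw [State.setReg_reg, if_neg (by norm_num), u221, t221]
      · linarith
    · refine ⟨⟨(h.bdd.setReg _ ?_).setReg _ (abs_natCast_le (by omega)), ?_, ?_, ?_, ?_⟩,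
        Nat.zero_le _, ?_, ?_, ?_⟩
      · rw [abs_one]; omega
      · simp [State.setReg_reg, h.n_eq]
      · simp [State.setReg_reg, h.u_eq]
      · simp [State.setReg_reg, h.acc_eq]
      · exact h.lists.congr fun _ _ => rfl
      · simp [State.setReg_reg]
      · rw [State.setReg_reg, if_pos rfl]
      · simp
    · simp [Expr.cost]
    · rintro t ⟨j, -, ⟨hinv, hj, t202, t221, hle⟩, hpos⟩
      obtain rfl : j = n / u := by
        simp only [Expr.val, t202, t221] at hpos
        omega
      have e : ∑ y ∈ Finset.Ico 1 (n / u + 1), pairTerm n u y = rowTerm n u := rfl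
      rw [e] at hinv hle
      refine ⟨hinv, hle.trans ?_⟩
      gcongr
  refine (T1.seq_of T2).mono le_rfl le_rfl ?_ fun _ h => h
  generalize Nat.log 2 n = l
  generalize (sqfreeDivisors u).card = D
  generalize n / u = q
  have h1 : q * (C * (l + 1) * (D + 1) + rowTail.size + 6) ≤
      q * ((C + rowTail.size + 6) * (l + 1) * (D + 1)) := by
    gcongr
    have : rowTail.size + 6 ≤ (rowTail.size + 6) * ((l + 1) * (D + 1)) :=
      Nat.le_mul_of_pos_right _ (by positivity)
    nlinarith
  have h2 : rowInit.size + 6 ≤ (rowInit.size + 6) * ((l + 1) * (q * (D + 1) + 1)) :=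
    Nat.le_mul_of_pos_right _ (by positivity)
  have h3 : (C + rowTail.size + 6) * (l + 1) * (q * (D + 1)) ≤
      (C + rowTail.size + 6) * (l + 1) * (q * (D + 1) + 1) := by gcongr; omega
  calc _ ≤ (rowInit.size + 6) * ((l + 1) * (q * (D + 1) + 1)) +
        q * ((C + rowTail.size + 6) * (l + 1) * (D + 1)) := by omega
    _ = (rowInit.size + 6) * ((l + 1) * (q * (D + 1) + 1)) +
        (C + rowTail.size + 6) * (l + 1) * (q * (D + 1)) := by ring
    _ ≤ (rowInit.size + 6) * ((l + 1) * (q * (D + 1) + 1)) +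
        (C + rowTail.size + 6) * (l + 1) * (q * (D + 1) + 1) := by omega
    _ = _ := by ring

/-- The number of outer triples for `n`. -/
def tripleSum (n : ℕ) : ℕ := ∑ u ∈ Finset.Icc 1 n, n / u * (sqfreeDivisors u).card

theorem one_le_card_sqfreeDivisors {u : ℕ} (hu : 1 ≤ u) : 1 ≤ (sqfreeDivisors u).card := by
  refine Finset.card_pos.2 ⟨1, ?_⟩
  simp [sqfreeDivisors, Nat.ne_of_gt hu]

/-- Both ⌊n/u⌋ and the length of D(u) are at least 1, so the loop overheads are absorbed into a
constant multiple of the number of triples. -/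
theorem row_cost_le (n : ℕ) : ∑ j ∈ Finset.range (n - 1),
    (n / (2 + j) * ((sqfreeDivisors (2 + j)).card + 1) + 1) ≤ 3 * tripleSum n := by
  have h1 : ∀ u ∈ Finset.Icc 1 n, n / u * ((sqfreeDivisors u).card + 1) + 1 ≤
      3 * (n / u * (sqfreeDivisors u).card) := by
    intro u hu
    rw [Finset.mem_Icc] at hu
    have h2 := one_le_card_sqfreeDivisors hu.1
    have h3 : 1 ≤ n / u := Nat.div_pos hu.2 hu.1
    nlinarith [Nat.mul_le_mul h3 h2]
  rw [tripleSum, Finset.mul_sum]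
  refine le_trans ?_ (Finset.sum_le_sum h1)
  refine (Finset.sum_map (Finset.range (n - 1)) (addLeftEmbedding 2)
    (fun u => n / u * ((sqfreeDivisors u).card + 1) + 1)).symm.le.trans ?_
  refine Finset.sum_le_sum_of_subset fun u hu => ?_
  simp only [Finset.mem_map, Finset.mem_range, addLeftEmbedding_apply] at hu
  obtain ⟨j, hj, rfl⟩ := hu
  rw [Finset.mem_Icc]
  omega

/-- Start the loop over `u`. -/
def mainInit : Cmd := .seq (.set 220 (.const 0)) (.set 201 (.const 2))

/-- Pass to the next `u`. -/
def mainTail : Cmd := .set 201 (.add (.reg 201) (.const 1))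

/-- Add all contributions to register `220`. -/
noncomputable def mainLoop : Cmd :=
  .loop (.sub (.add (.reg 200) (.const 1)) (.reg 201)) (.seq (.seq rowInit rowLoop) mainTail)

/-- The time is the number of outer triples times the logarithmic cost of one, with overheads
absorbed by `row_cost_le`. -/
theorem mainLoop_runs : ∃ K C : ℕ, ∀ (S B n : ℕ) (s : State), MainBounds S B n → s.Bdd B →
    s.reg 200 = n → s.HasLists n →
    Runs S (B ^ K) (C * (Nat.log 2 n + 1) * (tripleSum n + 1)) (.seq mainInit mainLoop) s fun s' =>
      s'.Bdd B ∧ s'.reg 200 = n ∧ s'.reg 220 = ∑ u ∈ Finset.Icc 2 n, rowTerm n u := by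
  obtain ⟨K, C, hKC⟩ := rowLoop_runs
  refine ⟨K + mainInit.weight + mainTail.weight + 10,
    mainInit.size + 3 * C + 3 * mainTail.size + 30, fun S B n s hSB hs h200 hlists => ?_⟩
  set W := B ^ (K + mainInit.weight + mainTail.weight + 10) with hW
  have hM1 : n + 2 ≤ B := (Nat.le_self_pow (by norm_num) _).trans hSB.word
  have hB2 : 2 ≤ B := by omega
  have pw : ∀ w ≤ K + mainInit.weight + mainTail.weight + 10,
      B ^ w ≤ W := fun w hw => Nat.pow_le_pow_right (by omega) hw
  -- At most n values each of u, y and d, with terms at most (n+2)⁷, bound all partial sums; this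
  -- accounts for the exponent in `MainBounds.word`.
  have hword : (n : ℤ) * (n * (n * (n + 2) ^ 7)) ≤ B := by
    have : n * (n * (n * (n + 2) ^ 7)) ≤ (n + 2) ^ 11 := by
      calc n * (n * (n * (n + 2) ^ 7)) ≤ (n + 2) * ((n + 2) * ((n + 2) * (n + 2) ^ 7)) := by
            gcongr <;> omega
        _ = (n + 2) ^ 10 := by ring
        _ ≤ (n + 2) ^ 11 := Nat.pow_le_pow_right (by omega) (by norm_num)
    exact_mod_cast this.trans hSB.word
  let I : ℕ → State → Prop := fun j t =>
    MainInv B n (2 + j) (∑ u ∈ Finset.Ico 2 (2 + j), rowTerm n u) t ∧ j ≤ n - 1 ∧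
    |∑ u ∈ Finset.Ico 2 (2 + j), rowTerm n u| ≤ j * (n * (n * (n + 2) ^ 7))
  have T1 : Runs S W mainInit.size mainInit s (I 0) := by
    refine Runs.loopFree (by simp [mainInit, Cmd.LoopFree]) hB2 hs
      (by simp [mainInit, Cmd.Safe, Expr.Safe]) (pw _ (by omega)) ?_
    simp only [mainInit, Cmd.run, Expr.val]
    refine ⟨⟨(hs.setReg _ (by simp)).setReg _ (by rw [abs_two]; omega), ?_, ?_, ?_, ?_⟩, by omega,
      by simp⟩
    · simp [State.setReg_reg, h200]
    · simp [State.setReg_reg]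
    · simp [State.setReg_reg]
    · exact hlists.congr fun _ _ => rfl
  have T2 : ∀ t, I 0 t → Runs S W (∑ j ∈ Finset.range (n - 1), (C * (Nat.log 2 n + 1) *
      (n / (2 + j) * ((sqfreeDivisors (2 + j)).card + 1) + 1) + mainTail.size + 6) + 6) mainLoop t
      fun s' => s'.Bdd B ∧ s'.reg 200 = n ∧
        s'.reg 220 = ∑ u ∈ Finset.Icc 2 n, rowTerm n u := by
    intro t ht
    refine (Runs.loop I _ (n - 1) (fun j t ht => ?_) (fun j t ht hpos => ?_) ht).mono le_rfl
      le_rfl le_rfl ?_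
    · exact Expr.Safe.ok hB2 ht.1.bdd ⟨⟨trivial, trivial⟩, trivial⟩
        (pw _ (by simp [Expr.weight]))
    · obtain ⟨hinv, hj, hle⟩ := ht
      have hjl : 2 + j ≤ n := by
        simp only [Expr.val, hinv.n_eq, hinv.u_eq] at hpos
        omega
      have hstep : (j : ℤ) * (n * (n * (n + 2) ^ 7)) + n * (n * (n + 2) ^ 7) =
          ((j + 1 : ℕ) : ℤ) * (n * (n * (n + 2) ^ 7)) := by push_cast; ring
      have hstep' : ((j + 1 : ℕ) : ℤ) * (n * (n * (n + 2) ^ 7)) ≤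
          n * (n * (n * (n + 2) ^ 7)) := by
        gcongr
        omega
      refine ⟨by omega, ((hKC S B n (2 + j) _ t hSB (by omega) hjl (by linarith) hinv).mono le_rfl
        (pw K (by omega)) le_rfl fun _ h => h).seq_of fun t' ht' => ?_⟩
      obtain ⟨hinv', hle'⟩ := ht'
      have hsum : ∑ u ∈ Finset.Ico 2 (2 + j), rowTerm n u + rowTerm n (2 + j) =
          ∑ u ∈ Finset.Ico 2 (2 + (j + 1)), rowTerm n u := by
        rw [← add_assoc, Finset.sum_Ico_succ_top (by omega : 2 ≤ 2 + j)]
      rw [hsum] at hinv' hle'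
      have hrun : mainTail.run t' = t'.setReg 201 (2 + (j + 1) : ℕ) := by
        simp only [mainTail, Cmd.run, Expr.val, hinv'.u_eq]
        push_cast
        rw [add_assoc]
      refine Runs.loopFree (c := mainTail) trivial hB2 hinv'.bdd ⟨trivial, trivial⟩
        (pw _ (by omega)) ?_
      rw [hrun]
      refine ⟨⟨hinv'.bdd.setReg _ (abs_natCast_le (by omega)), ?_, ?_, ?_, ?_⟩, by omega, ?_⟩
      · simp [State.setReg_reg, hinv'.n_eq]
      · simp [State.setReg_reg]
      · simp [State.setReg_reg, hinv'.acc_eq]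
      · exact hinv'.lists.congr fun _ _ => rfl
      · linarith
    · rintro t ⟨j, hj, ⟨hinv, -, -⟩, hpos⟩
      simp only [Expr.val, hinv.n_eq, hinv.u_eq] at hpos
      refine ⟨hinv.bdd, hinv.n_eq, ?_⟩
      rw [hinv.acc_eq]
      refine Finset.sum_congr ?_ fun _ _ => rfl
      ext u
      rw [Finset.mem_Ico, Finset.mem_Icc]
      omega
  refine (T1.seq_of T2).mono le_rfl le_rfl ?_ fun _ h => h
  have hrow := row_cost_le n
  have hcount : n - 1 ≤ ∑ j ∈ Finset.range (n - 1),
      (n / (2 + j) * ((sqfreeDivisors (2 + j)).card + 1) + 1) := by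
    calc n - 1 = ∑ j ∈ Finset.range (n - 1), 1 := by simp
      _ ≤ _ := Finset.sum_le_sum fun j _ => Nat.le_add_left _ _
  have hsum : ∑ j ∈ Finset.range (n - 1), (C * (Nat.log 2 n + 1) *
      (n / (2 + j) * ((sqfreeDivisors (2 + j)).card + 1) + 1) + mainTail.size + 6) =
      C * (Nat.log 2 n + 1) * (∑ j ∈ Finset.range (n - 1),
        (n / (2 + j) * ((sqfreeDivisors (2 + j)).card + 1) + 1)) +
      (n - 1) * (mainTail.size + 6) := by
    rw [Finset.mul_sum, ← Finset.card_range (n - 1), ← smul_eq_mul (Finset.card _),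
      ← Finset.sum_const, Finset.card_range, ← Finset.sum_add_distrib]
    exact Finset.sum_congr rfl fun j _ => by ring
  rw [hsum]
  generalize ∑ j ∈ Finset.range (n - 1),
    (n / (2 + j) * ((sqfreeDivisors (2 + j)).card + 1) + 1) = A at *
  generalize Nat.log 2 n = l
  generalize tripleSum n = T at *
  have h1 : C * (l + 1) * A ≤ C * (l + 1) * (3 * T) := by gcongr
  have h2 : (n - 1) * (mainTail.size + 6) ≤ 3 * T * (mainTail.size + 6) := by gcongr; omega
  have h3 : 3 * T * (mainTail.size + 6) ≤ 3 * T * (mainTail.size + 6) * (l + 1) :=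
    Nat.le_mul_of_pos_right _ (by positivity)
  have h4 : mainInit.size + 6 ≤ (mainInit.size + 6) * ((l + 1) * (T + 1)) :=
    Nat.le_mul_of_pos_right _ (by positivity)
  calc _ ≤ (mainInit.size + 6) * ((l + 1) * (T + 1)) + C * (l + 1) * (3 * T) +
        3 * T * (mainTail.size + 6) * (l + 1) := by omega
    _ ≤ (mainInit.size + 6) * ((l + 1) * (T + 1)) + C * (l + 1) * (3 * (T + 1)) +
        3 * (T + 1) * (mainTail.size + 6) * (l + 1) := by gcongr <;> omega
    _ ≤ (mainInit.size + 6) * ((l + 1) * (T + 1)) + C * (l + 1) * (3 * (T + 1)) +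
        3 * (T + 1) * (mainTail.size + 6) * (l + 1) + 6 * ((l + 1) * (T + 1)) :=
      Nat.le_add_right _ _
    _ = _ := by ring

/-- The final sum as a function of the registers. -/
def finalFn (v : ℕ → ℚ) : ℚ :=
  (v 200 ^ 2 * (v 200 + -1) ^ 2 * (1 / 4) + v 200 * (v 200 + -1) ^ 2 * (v 200 + -2) * (1 / 12)) +
    v 220

theorem finalFn_isPolyFn : IsPolyFn finalFn := by
  have h1 : ∀ a : ℚ, IsPolyFn fun v => v 200 + a := fun a => (IsPolyFn.var 200).add (IsPolyFn.const a)
  exact ((((IsPolyFn.var 200).pow 2).mul ((h1 (-1)).pow 2)).mul (IsPolyFn.const _)).add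
    ((((IsPolyFn.var 200).mul ((h1 (-1)).pow 2)).mul (h1 (-2))).mul (IsPolyFn.const _)) |>.add
    (IsPolyFn.var 220)

/-- The preprocessing and the main program, for any integer sequence with the given formula. -/
theorem exists_pre_main {G : ℕ → ℤ}
    (hG : ∀ n, (G n : ℚ) = boundaryCount n + ((∑ u ∈ Finset.Icc 2 n, rowTerm n u : ℤ) : ℚ)) :
    ∃ (pre main : Cmd) (K C : ℕ), ∀ n : ℕ, ∃ s₁ s₂ : State,
      RunsWithin (C * (divisorSum n + 1)) (3 * (divisorSum n + 1)) ((n + 2) ^ K) pre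
        (State.init [(n : ℤ)]) s₁ ∧
      HoldsDivisorLists n s₁ ∧
      RunsWithin (C * (Nat.log 2 n + 1) * (tripleSum n + 1)) (3 * (divisorSum n + 1))
        ((n + 2) ^ K) main s₁ s₂ ∧
      s₂.reg 0 = G n := by
  obtain ⟨K₁, C₁, h₁⟩ := preprocess_runs
  obtain ⟨K₂, C₂, h₂⟩ := mainLoop_runs
  obtain ⟨e, hsafe, he⟩ := finalFn_isPolyFn.exists_expr
  refine ⟨preprocess, .seq (.seq mainInit mainLoop) (.set 0 e), 11 * (K₁ + K₂ + e.weight),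
    C₁ + C₂ + e.cost + 1, fun n => ?_⟩
  have hn := le_divisorSum n
  have hlog : Nat.log 2 n ≤ n := Nat.log_le_self 2 n
  have hM1 : n + 2 ≤ (n + 2) ^ 11 := Nat.le_self_pow (by norm_num) _
  have hdB : divisorSum n ≤ (n + 2) ^ 2 := by
    rw [divisorSum]
    refine (Finset.sum_le_card_nsmul _ _ n fun d _ => Nat.div_le_self n d).trans ?_
    rw [Nat.card_Icc, smul_eq_mul, Nat.add_sub_cancel]
    nlinarith
  have hM2 : (n + 2) ^ 2 ≤ (n + 2) ^ 11 := Nat.pow_le_pow_right (by omega) (by norm_num)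
  have hlogS : 2 * Nat.log 2 n + 3 ≤ 3 * (divisorSum n + 1) := by omega
  have hSB : MainBounds (3 * (divisorSum n + 1)) ((n + 2) ^ 11) n :=
    ⟨by omega, hlogS, by omega, le_rfl⟩
  have hB2 : 2 ≤ (n + 2) ^ 11 := by omega
  rw [pow_mul]
  have pw : ∀ w ≤ K₁ + K₂ + e.weight,
      ((n + 2) ^ 11) ^ w ≤ ((n + 2) ^ 11) ^ (K₁ + K₂ + e.weight) := fun w hw =>
    Nat.pow_le_pow_right (by omega) hw
  obtain ⟨s₁, hrun₁, hb₁, h200, hlists⟩ := (h₁ (3 * (divisorSum n + 1)) ((n + 2) ^ 11) n (by omega)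
    (by omega) (by nlinarith) (by omega)).mono le_rfl (pw K₁ (by omega))
    (show _ ≤ (C₁ + C₂ + e.cost + 1) * (divisorSum n + 1) by gcongr; omega) fun _ h => h
  have hmain := ((h₂ (3 * (divisorSum n + 1)) ((n + 2) ^ 11) n s₁ hSB hb₁ h200 hlists).mono le_rfl
    (pw K₂ (by omega)) le_rfl fun _ h => h).seq_of (c₂ := .set 0 e) (Q := fun s => s.reg 0 = G n)
    fun s hs => Runs.loopFree (c := .set 0 e) trivial hB2 hs.1 (hsafe _ _)
      (pw _ (by simp only [Cmd.weight]; omega)) (by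
        simp only [Cmd.run]
        rw [State.setReg_reg, if_pos rfl]
        -- The denominators 4 and 12 do no harm: the total is the integer `G n`, so the compiled
        -- expression returns it exactly.
        refine he s _ ?_
        rw [hG, finalFn, hs.2.1, hs.2.2, boundaryCount]
        push_cast
        ring)
  obtain ⟨s₂, hrun₂, hval⟩ := hmain
  refine ⟨s₁, s₂, hrun₁, hlists.holdsDivisorLists, ?_, hval⟩
  obtain ⟨k, hk, hx⟩ := hrun₂
  refine ⟨k, hk.trans ?_, hx⟩
  have : e.cost + 1 ≤ (e.cost + 1) * ((Nat.log 2 n + 1) * (tripleSum n + 1)) :=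
    Nat.le_mul_of_pos_right _ (by positivity)
  simp only [Cmd.size]
  nlinarith [Nat.zero_le (C₁ * ((Nat.log 2 n + 1) * (tripleSum n + 1)))]

end RAM

/-! ### Asymptotics -/

section Asymptotics

open Filter Asymptotics

/-- Absorbs the additive constants in the explicit bounds, which are needed for small arguments
where the logarithm vanishes. -/
theorem one_isBigO_log : (fun _ : ℕ => (1 : ℝ)) =O[atTop] fun n : ℕ => Real.log n :=
  (Real.isLittleO_const_log_atTop.comp_tendsto tendsto_natCast_atTop_atTop).isBigO

theorem one_add_log_isBigO :
    (fun n : ℕ => 1 + Real.log n) =O[atTop] fun n : ℕ => Real.log n :=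
  one_isBigO_log.add (isBigO_refl _ _)

theorem natLog_isBigO (C : ℕ) :
    (fun n : ℕ => ((C * (Nat.log 2 n + 1) : ℕ) : ℝ)) =O[atTop] fun n : ℕ => Real.log n := by
  have h : (fun n : ℕ => (Nat.log 2 n : ℝ)) =O[atTop] fun n : ℕ => Real.log n := by
    refine IsBigO.of_bound (Real.log 2)⁻¹ (Eventually.of_forall fun n => ?_)
    have h1 := Real.natLog_le_logb n 2
    rw [Real.logb, div_eq_inv_mul] at h1
    rw [Real.norm_of_nonneg (by positivity),
      Real.norm_of_nonneg (Real.log_natCast_nonneg n)]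
    exact_mod_cast h1
  have := (h.add one_isBigO_log).const_mul_left (C : ℝ)
  refine this.congr_left fun n => ?_
  push_cast
  ring

theorem one_isBigO_natCast : (fun _ : ℕ => (1 : ℝ)) =O[atTop] fun n : ℕ => (n : ℝ) := by
  refine IsBigO.of_bound 1 ((eventually_ge_atTop 1).mono fun n hn => ?_)
  have : (1 : ℝ) ≤ n := by exact_mod_cast hn
  simpa using this

theorem sum_inv_le (n : ℕ) : ∑ d ∈ Finset.Icc 1 n, ((d : ℝ))⁻¹ ≤ 1 + Real.log n := by
  have := harmonic_le_one_add_log n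
  rw [harmonic_eq_sum_Icc] at this
  push_cast at this
  exact this

theorem natCast_div_le (n d : ℕ) : ((n / d : ℕ) : ℝ) ≤ n * (d : ℝ)⁻¹ :=
  Nat.cast_div_le.trans (le_of_eq (div_eq_mul_inv _ _))

theorem divisorSum_le (n : ℕ) : (RAM.divisorSum n : ℝ) ≤ n * (1 + Real.log n) := by
  rw [RAM.divisorSum]
  push_cast
  calc ∑ d ∈ Finset.Icc 1 n, ((n / d : ℕ) : ℝ) ≤ ∑ d ∈ Finset.Icc 1 n, (n : ℝ) * (d : ℝ)⁻¹ :=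
        Finset.sum_le_sum fun d _ => natCast_div_le n d
    _ = n * ∑ d ∈ Finset.Icc 1 n, (d : ℝ)⁻¹ := by rw [Finset.mul_sum]
    _ ≤ _ := by gcongr; exact sum_inv_le n

/-- Each quotient τ(u)/u is the sum of 1/(de) over de = u. Dropping the constraint de ≤ n leaves the
square of a harmonic sum. -/
theorem sum_card_divisors_div_le (n : ℕ) :
    ∑ u ∈ Finset.Icc 1 n, (u.divisors.card : ℝ) * (u : ℝ)⁻¹ ≤ (1 + Real.log n) ^ 2 := by
  have h1 : ∀ u ∈ Finset.Icc 1 n, (u.divisors.card : ℝ) * (u : ℝ)⁻¹ =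
      ∑ x ∈ (Finset.Icc 1 n ×ˢ Finset.Icc 1 n).filter (fun x => x.1 * x.2 = u),
        (x.1 : ℝ)⁻¹ * (x.2 : ℝ)⁻¹ := by
    intro u hu
    rw [Finset.mem_Icc] at hu
    have hset : (Finset.Icc 1 n ×ˢ Finset.Icc 1 n).filter (fun x => x.1 * x.2 = u) =
        u.divisorsAntidiagonal := by
      ext ⟨d, e⟩
      simp only [Finset.mem_filter, Finset.mem_product, Finset.mem_Icc,
        Nat.mem_divisorsAntidiagonal]
      constructor
      · rintro ⟨-, h⟩; exact ⟨h, by omega⟩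
      · rintro ⟨h, -⟩
        have hd : 0 < d := Nat.pos_of_ne_zero fun h0 => by simp [h0] at h; omega
        have he : 0 < e := Nat.pos_of_ne_zero fun h0 => by simp [h0] at h; omega
        have h1 := Nat.le_mul_of_pos_right d he
        have h2 := Nat.le_mul_of_pos_left e hd
        exact ⟨⟨⟨hd, by omega⟩, he, by omega⟩, h⟩
    rw [hset, ← Nat.map_div_right_divisors, Finset.sum_map]
    rw [← nsmul_eq_mul, ← Finset.sum_const]
    refine Finset.sum_congr rfl fun d hd => ?_
    have hdu := Nat.dvd_of_mem_divisors hd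
    have hmul : ((d * (u / d) : ℕ) : ℝ) = u := by rw [Nat.mul_div_cancel' hdu]
    change (u : ℝ)⁻¹ = (d : ℝ)⁻¹ * ((u / d : ℕ) : ℝ)⁻¹
    rw [← mul_inv, ← hmul, Nat.cast_mul]
  rw [Finset.sum_congr rfl h1]
  calc _ ≤ ∑ x ∈ Finset.Icc 1 n ×ˢ Finset.Icc 1 n, ((x.1 : ℝ)⁻¹ * (x.2 : ℝ)⁻¹) := by
        rw [Finset.sum_fiberwise_eq_sum_filter]
        exact Finset.sum_le_sum_of_subset_of_nonneg (Finset.filter_subset _ _)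
          fun _ _ _ => by positivity
    _ = (∑ d ∈ Finset.Icc 1 n, (d : ℝ)⁻¹) ^ 2 := by
        rw [Finset.sum_product, sq, Finset.sum_mul_sum]
    _ ≤ _ := by
        have := sum_inv_le n
        gcongr

theorem tripleSum_le (n : ℕ) : (RAM.tripleSum n : ℝ) ≤ n * (1 + Real.log n) ^ 2 := by
  rw [RAM.tripleSum]
  push_cast
  calc ∑ u ∈ Finset.Icc 1 n, ((n / u : ℕ) : ℝ) * ((sqfreeDivisors u).card : ℝ)
      ≤ ∑ u ∈ Finset.Icc 1 n, (n : ℝ) * ((u.divisors.card : ℝ) * (u : ℝ)⁻¹) := by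
        refine Finset.sum_le_sum fun u _ => ?_
        have h1 := natCast_div_le n u
        have h2 : ((sqfreeDivisors u).card : ℝ) ≤ u.divisors.card := by
          exact_mod_cast Finset.card_filter_le _ _
        calc ((n / u : ℕ) : ℝ) * ((sqfreeDivisors u).card : ℝ)
            ≤ n * (u : ℝ)⁻¹ * u.divisors.card := by gcongr
          _ = _ := by ring
    _ = n * ∑ u ∈ Finset.Icc 1 n, (u.divisors.card : ℝ) * (u : ℝ)⁻¹ := by rw [Finset.mul_sum]
    _ ≤ _ := by gcongr; exact sum_card_divisors_div_le n

theorem divisorSum_isBigO :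
    (fun n : ℕ => (RAM.divisorSum n : ℝ)) =O[atTop] fun n : ℕ => (n : ℝ) * Real.log n := by
  refine IsBigO.trans (IsBigO.of_norm_le fun n => ?_)
    ((isBigO_refl (fun n : ℕ => (n : ℝ)) atTop).mul one_add_log_isBigO)
  rw [Real.norm_of_nonneg (by positivity)]
  exact divisorSum_le n

theorem tripleSum_isBigO :
    (fun n : ℕ => (RAM.tripleSum n : ℝ)) =O[atTop] fun n : ℕ => (n : ℝ) * Real.log n ^ 2 := by
  refine IsBigO.trans (IsBigO.of_norm_le fun n => ?_)
    ((isBigO_refl (fun n : ℕ => (n : ℝ)) atTop).mul (one_add_log_isBigO.pow 2))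
  rw [Real.norm_of_nonneg (by positivity)]
  exact tripleSum_le n

theorem mul_divisorSum_succ_isBigO (C : ℕ) :
    (fun n : ℕ => ((C * (RAM.divisorSum n + 1) : ℕ) : ℝ)) =O[atTop]
      fun n : ℕ => (n : ℝ) * Real.log n := by
  have h1 : (fun _ : ℕ => (1 : ℝ)) =O[atTop] fun n : ℕ => (n : ℝ) * Real.log n := by
    simpa using one_isBigO_natCast.mul one_isBigO_log
  have := (divisorSum_isBigO.add h1).const_mul_left (C : ℝ)
  refine this.congr_left fun n => ?_
  push_cast
  ring

theorem mul_tripleSum_succ_isBigO (C : ℕ) :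
    (fun n : ℕ => ((C * (Nat.log 2 n + 1) * (RAM.tripleSum n + 1) : ℕ) : ℝ)) =O[atTop]
      fun n : ℕ => (n : ℝ) * Real.log n ^ 3 := by
  have h1 : (fun _ : ℕ => (1 : ℝ)) =O[atTop] fun n : ℕ => (n : ℝ) * Real.log n ^ 2 := by
    simpa using one_isBigO_natCast.mul (one_isBigO_log.pow 2)
  have := (natLog_isBigO C).mul (tripleSum_isBigO.add h1)
  refine (this.congr_left fun n => ?_).congr_right fun n => ?_
  · push_cast
    ring
  · ring

end Asymptotics

/-- Injecting the triples into a finite sigma type bounds their number by the same sum that measures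
the running time of the main program. -/
theorem card_outerTriple_le (n : ℕ) :
    Nat.card {w : ℕ × ℕ × ℕ // IsOuterTriple n w.1 w.2.1 w.2.2} ≤ RAM.tripleSum n := by
  set T := (Finset.Icc 1 n).sigma fun u => Finset.Icc 1 (n / u) ×ˢ sqfreeDivisors u with hT
  have hmem : ∀ w : {w : ℕ × ℕ × ℕ // IsOuterTriple n w.1 w.2.1 w.2.2},
      (⟨w.1.1, w.1.2⟩ : Σ _ : ℕ, ℕ × ℕ) ∈ T := by
    rintro ⟨⟨u, y, d⟩, h1, h2, h3, h4, h5, h6⟩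
    simp only [hT, Finset.mem_sigma, Finset.mem_product, Finset.mem_Icc, sqfreeDivisors,
      Finset.mem_filter, Nat.mem_divisors]
    exact ⟨⟨h1, h2⟩, ⟨h3, h4⟩, ⟨h5, by dsimp only at h1; omega⟩, h6⟩
  have hle := Nat.card_le_card_of_injective
    (fun w : {w : ℕ × ℕ × ℕ // IsOuterTriple n w.1 w.2.1 w.2.2} => (⟨_, hmem w⟩ : T)) (by
      rintro ⟨⟨u, y, d⟩, h⟩ ⟨⟨u', y', d'⟩, h'⟩ he
      simpa using he)
  refine hle.trans ?_
  rw [Nat.card_eq_fintype_card, Fintype.card_coe, hT, Finset.card_sigma, RAM.tripleSum]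
  refine le_of_eq (Finset.sum_congr rfl fun u _ => ?_)
  rw [Finset.card_product, Nat.card_Icc, Nat.add_sub_cancel]

theorem mainTheorem4 :
    -- the number of outer triples, and the total size of the squarefree divisor lists
    ((fun n : ℕ => (Nat.card {w : ℕ × ℕ × ℕ // IsOuterTriple n w.1 w.2.1 w.2.2} : ℝ))
      =O[Filter.atTop] fun n : ℕ => (n : ℝ) * Real.log n ^ 2) ∧
    ((fun n : ℕ => ((∑ u ∈ Finset.Icc 1 n, (sqfreeDivisors u).card : ℕ) : ℝ))
      =O[Filter.atTop] fun n : ℕ => (n : ℝ) * Real.log n) ∧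
    -- the decomposition of `F(n)` into outer contributions
    (∀ n : ℕ, (rectCount n : ℚ) = boundaryCount n +
      ((∑ u ∈ Finset.Icc 2 n, ∑ y ∈ Finset.Icc 1 (n / u), ∑ d ∈ u.divisors,
        ArithmeticFunction.moebius d * outerTerm n u y d : ℤ) : ℚ)) ∧
    -- each outer contribution is a fixed combination of the ten moments of one instance of the
    -- kernel, with polynomial coefficients, and of a polynomial correction
    (∃ (c : ℕ × ℕ → MvPolynomial (Fin 5) ℚ) (e : MvPolynomial (Fin 7) ℚ),
      ∀ n u y d : ℕ, IsOuterTriple n u y d →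
        (outerTerm n u y d : ℚ) =
          (∑ i ∈ tenStates,
            MvPolynomial.eval ![(n : ℚ), (u : ℚ), (y : ℚ), (d : ℚ), ((n / u : ℕ) : ℚ)] (c i) *
              (floorMoment i.1 i.2 (((n / u : ℕ) : ℤ) - capEnd n u y d).toNat
                (y * d) u (n - u * (n / u)) : ℚ)) +
          MvPolynomial.eval ![(n : ℚ), (u : ℚ), (y : ℚ), (d : ℚ), (tCap u d : ℚ),
            (capEnd n u y d : ℚ), (tDiag n u y d : ℚ)] e) ∧
    -- closure of the ten-state family under the affine Euclidean step
    (∃ (α : ℕ × ℕ → ℕ × ℕ → MvPolynomial (Fin 2) ℚ) (β : ℕ × ℕ → ℕ → MvPolynomial (Fin 2) ℚ),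
      ∀ i ∈ tenStates, ∀ N m a b : ℕ, 1 ≤ m →
        (floorMoment i.1 i.2 N m a b : ℚ) =
          (∑ j ∈ tenStates, MvPolynomial.eval ![((a / m : ℕ) : ℚ), ((b / m : ℕ) : ℚ)] (α i j) *
            (floorMoment j.1 j.2 N m (a % m) (b % m) : ℚ)) +
          ∑ r ∈ Finset.range 5, MvPolynomial.eval ![((a / m : ℕ) : ℚ), ((b / m : ℕ) : ℚ)] (β i r) *
            (powerSum r N : ℚ)) ∧
    -- closure of the ten-state family under the reciprocal Euclidean step
    (∃ (γ : ℕ × ℕ → ℕ × ℕ → ℚ) (ρ : ℕ × ℕ → ℕ → ℚ),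
      ∀ i ∈ tenStates, ∀ N m a b Y : ℕ, 1 ≤ N → 1 ≤ a → a < m → b < m →
        Y = (a * (N - 1) + b) / m →
        (floorMoment i.1 i.2 N m a b : ℚ) =
          (∑ j ∈ tenStates, γ i j * (floorMoment j.1 j.2 Y a m (m - b - 1) : ℚ)) +
          (powerSum i.1 N : ℚ) * (Y : ℚ) ^ i.2 +
          ∑ r ∈ Finset.range 5, ρ i r * (powerSum r Y : ℚ)) ∧
    -- all ten moments are computed together in `O(log m)` operations
    (∃ (kernel : RAM.Cmd) (K : ℕ) (T : ℕ → ℕ),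
      ((fun m : ℕ => (T m : ℝ)) =O[Filter.atTop] fun m : ℕ => Real.log m) ∧
      ∀ N m a b : ℕ, 1 ≤ m → ∃ s : RAM.State,
        RAM.RunsWithin (T m) (T m) ((N + m + a + b + 2) ^ K) kernel
          (RAM.State.init [(N : ℤ), (m : ℤ), (a : ℤ), (b : ℤ)]) s ∧
        ∀ i ∈ tenStates, s.reg (5 * i.1 + i.2) = (floorMoment i.1 i.2 N m a b : ℤ)) ∧
    -- each outer contribution is computed in `O(log n)` operations
    (∃ (outer : RAM.Cmd) (K : ℕ) (T : ℕ → ℕ),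
      ((fun n : ℕ => (T n : ℝ)) =O[Filter.atTop] fun n : ℕ => Real.log n) ∧
      ∀ n u y d : ℕ, IsOuterTriple n u y d → ∃ s : RAM.State,
        RAM.RunsWithin (T n) (T n) ((n + 2) ^ K) outer
          (RAM.State.init [(n : ℤ), (u : ℤ), (y : ℤ), (d : ℤ)]) s ∧
        s.reg 0 = outerTerm n u y d) ∧
    -- the algorithm: preprocessing, storage, and main computation
    (∃ (pre main : RAM.Cmd) (K : ℕ) (Tpre Tmain S : ℕ → ℕ),
      ((fun n : ℕ => (Tpre n : ℝ)) =O[Filter.atTop] fun n : ℕ => (n : ℝ) * Real.log n) ∧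
      ((fun n : ℕ => (S n : ℝ)) =O[Filter.atTop] fun n : ℕ => (n : ℝ) * Real.log n) ∧
      ((fun n : ℕ => (Tmain n : ℝ)) =O[Filter.atTop] fun n : ℕ => (n : ℝ) * Real.log n ^ 3) ∧
      ∀ n : ℕ, ∃ s₁ s₂ : RAM.State,
        RAM.RunsWithin (Tpre n) (S n) ((n + 2) ^ K) pre (RAM.State.init [(n : ℤ)]) s₁ ∧
        RAM.HoldsDivisorLists n s₁ ∧
        RAM.RunsWithin (Tmain n) (S n) ((n + 2) ^ K) main s₁ s₂ ∧
        s₂.reg 0 = (rectCount n : ℤ)) := by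
  refine ⟨?_, ?_, rectCount_eq_boundaryCount_add,
    ⟨outerCoeff, outerCorrection, fun _ _ _ _ h => outerTerm_eq h⟩,
    ⟨affineCoeff, fun i r => affineCoeff i (r, 0), floorMoment_affine⟩,
    ⟨fun i j => -(powDiffCoeff i.2 j.1 * powerSumCoeff i.1 j.2),
      fun i r => -(powDiffCoeff i.2 r * powerSumCoeff i.1 0),
      fun i hi N m a b Y hN ha _ hb hY => floorMoment_reciprocal i hi N m a b Y hN ha hb hY⟩,
    ?_, ?_, ?_⟩
  · refine Asymptotics.IsBigO.trans (Asymptotics.IsBigO.of_norm_le fun n => ?_) tripleSum_isBigO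
    rw [Real.norm_of_nonneg (by positivity)]
    exact_mod_cast card_outerTriple_le n
  · refine Asymptotics.IsBigO.trans (Asymptotics.IsBigO.of_norm_le fun n => ?_) divisorSum_isBigO
    rw [Real.norm_of_nonneg (by positivity)]
    exact_mod_cast divisorOffset_le_divisorSum n
  · obtain ⟨kernel, K, C, h⟩ := RAM.exists_kernel
    exact ⟨kernel, K, fun m => C * (Nat.log 2 m + 1), natLog_isBigO C, h⟩
  · obtain ⟨outer, K, C, h⟩ := RAM.exists_outer
    exact ⟨outer, K, fun n => C * (Nat.log 2 n + 1), natLog_isBigO C, h⟩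
  · obtain ⟨pre, main, K, C, h⟩ := RAM.exists_pre_main (G := fun n => (rectCount n : ℤ))
      fun n => by rw [Int.cast_natCast, rectCount_eq_boundaryCount_add]; rfl
    exact ⟨pre, main, K, fun n => C * (RAM.divisorSum n + 1),
      fun n => C * (Nat.log 2 n + 1) * (RAM.tripleSum n + 1),
      fun n => 3 * (RAM.divisorSum n + 1), mul_divisorSum_succ_isBigO C,
      mul_divisorSum_succ_isBigO 3, mul_tripleSum_succ_isBigO C, h⟩
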